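/- Let $D=(F,R,>)$ be a propositional defeasible theory: $F$ is a finite set of literals (facts), $R$ is a finite set of uniquely labelled rules $r: A(r)\hookrightarrow C(r)$, each with a finite set $A(r)$ of literals as body, a literal $C(r)$ as head, and one of three kinds (strict $\rightarrow$, defeasible $\Rightarrow$, defeater $\leadsto$), and $>$ is an acyclic relation on $R$ (its transitive closure is irreflexive). For a literal $q$ let ${\sim}q$ be its complement, $R[q]$ the set of all rules with head $q$, $R_s[q]$ the set of strict ones and $R_{sd}[q]$ the set of strict or defeasible ones. A derivation in $D$ is a finite sequence of tagged literals in which each line may be appended to the sequence $P$ of the preceding lines by one of the following rules. - $+\Delta q$: $q\in F$, or there is $r\in R_s[q]$ with $+\Delta a\in P$ for all $a\in A(r)$. - $-\Delta q$: $q\notin F$, and every $r\in R_s[q]$ has some $a\in A(r)$ with $-\Delta a\in P$. - $+\partial q$: either $+\Delta q\in P$; or all of: (i) there is $r\in R_{sd}[q]$ with $+\partial a\in P$ for all $a\in A(r)$; (ii) $-\Delta{\sim}q\in P$; (iii) for every $s\in R[{\sim}q]$, either $-\partial a\in P$ for some $a\in A(s)$, or there is $t\in R_{sd}[q]$ with $t>s$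 and $+\partial a\in P$ for all $a\in A(t)$. - $-\partial q$: $-\Delta q\in P$, and at least one of: (i) every $r\in R_{sd}[q]$ has some $a\in A(r)$ with $-\partial a\in P$; (ii) $+\Delta{\sim}q\in P$; (iii) there is $s\in R[{\sim}q]$ such that $+\partial a\in P$ for all $a\in A(s)$ and, for every $t\in R_{sd}[q]$, either $-\partial a\in P$ for some $a\in A(t)$ or $t\not>s$. The conclusions of $D$ are the tagged literals, over the atoms that occur in $D$, that are lines of derivations in $D$. Theorem. The set of all conclusions of a defeasible theory $D$ can be computed in $O(N)$ time, where $N$ is the number of symbols in $D$. That is, there are a single program for a random access machine (with unit-cost instructions, and with successor and predecessor as its only arithmetic) and a constant $C$ such that for every defeasible theory $D$, given as a list of its facts, rules and superiority statements in any order within each kind, with atoms and rule labels being natural numbers, the program halts after at most $C(N+1)$ steps and outputs a list of exactly the conclusions of $D$, each once. -/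

import Mathlib

namespace DefeasibleLogic

/-! ### Propositional defeasible theories -/

/-- A literal: a propositional atom or its negation. Atoms are named by natural numbers. -/
structure Literal where
  atom : ℕ
  positive : Bool
deriving DecidableEq

/-- The complementary literal. -/
def Literal.compl (q : Literal) : Literal := ⟨q.atom, !q.positive⟩

/-- Strict rules (`→`), defeasible rules (`⇒`) and defeaters (`⇝`). -/
inductive Arrow where
  | strict
  | defeasible
  | defeater
deriving DecidableEq

/-- A labelled rule; its body is a finite set of literals. -/
structure Rule where
  label : ℕ
  body : Finset Literal
  arrow : Arrow
  head : Literal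
deriving DecidableEq

/-- A defeasible theory `(F, R, >)`: finitely many facts, finitely many rules with unique labels,
and an acyclic superiority relation on the rules; `(r, s) ∈ sup` means `r > s`. -/
structure Theory where
  facts : Finset Literal
  rules : Finset Rule
  sup : Finset (Rule × Rule)
  label_unique : ∀ r ∈ rules, ∀ s ∈ rules, r.label = s.label → r = s
  sup_on_rules : ∀ p ∈ sup, p.1 ∈ rules ∧ p.2 ∈ rules
  sup_acyclic : ∀ r, ¬ Relation.TransGen (fun t s => (t, s) ∈ sup) r r

/-- The set `R[q]` of all rules with head `q`. -/
def Theory.rulesFor (D : Theory) (q : Literal) : Finset Rule :=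
  D.rules.filter fun r => r.head = q

/-- The set `R_s[q]` of strict rules with head `q`. -/
def Theory.strictFor (D : Theory) (q : Literal) : Finset Rule :=
  (D.rulesFor q).filter fun r => r.arrow = Arrow.strict

/-- The set `R_sd[q]` of strict and defeasible rules with head `q`. -/
def Theory.supportFor (D : Theory) (q : Literal) : Finset Rule :=
  (D.rulesFor q).filter fun r => r.arrow = Arrow.strict ∨ r.arrow = Arrow.defeasible

/-- The literals that are written in `D`. -/
def Theory.literals (D : Theory) : Finset Literal :=
  D.facts ∪ D.rules.biUnion fun r => insert r.head r.body

/-- The atoms of the language of `D`: those that occur in `D`. -/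
def Theory.atoms (D : Theory) : Finset ℕ := D.literals.image Literal.atom

/-! ### Proof theory -/

/-- The four tags `+Δ`, `-Δ`, `+∂`, `-∂`. -/
inductive Tag where
  | plusDelta
  | minusDelta
  | plusPartial
  | minusPartial
deriving DecidableEq

/-- A tagged literal. -/
structure Conclusion where
  tag : Tag
  lit : Literal
deriving DecidableEq

/-- `D.Infers P c`: a derivation consisting of the lines `P` may be extended by the line `c`. -/
def Theory.Infers (D : Theory) (P : List Conclusion) : Conclusion → Prop
  | ⟨.plusDelta, q⟩ =>
      q ∈ D.facts ∨
      ∃ r ∈ D.strictFor q, ∀ a ∈ r.body, ⟨.plusDelta, a⟩ ∈ P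
  | ⟨.minusDelta, q⟩ =>
      q ∉ D.facts ∧
      ∀ r ∈ D.strictFor q, ∃ a ∈ r.body, ⟨.minusDelta, a⟩ ∈ P
  | ⟨.plusPartial, q⟩ =>
      ⟨.plusDelta, q⟩ ∈ P ∨
      ((∃ r ∈ D.supportFor q, ∀ a ∈ r.body, ⟨.plusPartial, a⟩ ∈ P) ∧
       ⟨.minusDelta, q.compl⟩ ∈ P ∧
       ∀ s ∈ D.rulesFor q.compl,
         (∃ a ∈ s.body, ⟨.minusPartial, a⟩ ∈ P) ∨
         ∃ t ∈ D.supportFor q, (∀ a ∈ t.body, ⟨.plusPartial, a⟩ ∈ P) ∧ (t, s) ∈ D.sup)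
  | ⟨.minusPartial, q⟩ =>
      ⟨.minusDelta, q⟩ ∈ P ∧
      ((∀ r ∈ D.supportFor q, ∃ a ∈ r.body, ⟨.minusPartial, a⟩ ∈ P) ∨
       ⟨.plusDelta, q.compl⟩ ∈ P ∨
       ∃ s ∈ D.rulesFor q.compl,
         (∀ a ∈ s.body, ⟨.plusPartial, a⟩ ∈ P) ∧
         ∀ t ∈ D.supportFor q, (∃ a ∈ t.body, ⟨.minusPartial, a⟩ ∈ P) ∨ (t, s) ∉ D.sup)

/-- Derivations: finite sequences of tagged literals, each line of which is licensed by an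
inference rule applied to the lines before it. -/
inductive Theory.IsDerivation (D : Theory) : List Conclusion → Prop
  | nil : D.IsDerivation []
  | append {P : List Conclusion} {c : Conclusion} :
      D.IsDerivation P → D.Infers P c → D.IsDerivation (P ++ [c])

/-- `D ⊢ c`: the tagged literal `c` is a line of some derivation in `D`. -/
def Theory.Proves (D : Theory) (c : Conclusion) : Prop :=
  ∃ P, D.IsDerivation P ∧ c ∈ P

/-! ### The number of symbols -/

/-- A positive literal is one symbol, a negative literal is two (`¬` and the atom). -/
def Literal.size (q : Literal) : ℕ := if q.positive then 1 else 2

/-- The symbols of a rule: label, arrow, head, and the literals of the body. -/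
def Rule.size (r : Rule) : ℕ := 2 + r.head.size + ∑ a ∈ r.body, a.size

/-- The number of symbols in `D`; a superiority statement `r > s` consists of three symbols. -/
def Theory.size (D : Theory) : ℕ :=
  ∑ q ∈ D.facts, q.size + ∑ r ∈ D.rules, r.size + 3 * D.sup.card

/-! ### Input and output format

A sequence is written as its length followed by its entries. Every number that is written is
an atom, a label, a length, or a code below four. -/

def Literal.code (q : Literal) : List ℕ := [if q.positive then 0 else 1, q.atom]

def Arrow.code : Arrow → ℕ
  | .strict => 0
  | .defeasible => 1
  | .defeater => 2

/-- A rule whose body is listed as `b`. -/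
def Rule.code (r : Rule) (b : List Literal) : List ℕ :=
  [r.label, r.arrow.code] ++ r.head.code ++ [b.length] ++ b.flatMap Literal.code

def Tag.code : Tag → ℕ
  | .plusDelta => 0
  | .minusDelta => 1
  | .plusPartial => 2
  | .minusPartial => 3

def Conclusion.code (c : Conclusion) : List ℕ := c.tag.code :: c.lit.code

/-- `l` lists the elements of the finite set `S`, each once, in some order. -/
def Lists {α : Type} [DecidableEq α] (l : List α) (S : Finset α) : Prop :=
  l.Nodup ∧ l.toFinset = S

/-- `w` is a presentation of `D`: the facts, then the rules, then the superiority statements,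
with the facts, the rules, the literals of each body, and the superiority statements listed
in an arbitrary order. -/
def Theory.IsPresentation (D : Theory) (w : List ℕ) : Prop :=
  ∃ (fs : List Literal) (rs : List Rule) (body : Rule → List Literal) (ss : List (Rule × Rule)),
    Lists fs D.facts ∧ Lists rs D.rules ∧ (∀ r ∈ D.rules, Lists (body r) r.body) ∧
    Lists ss D.sup ∧
    w = [fs.length] ++ fs.flatMap Literal.code ++
        [rs.length] ++ rs.flatMap (fun r => r.code (body r)) ++
        [ss.length] ++ ss.flatMap (fun p => [p.1.label, p.2.label])

/-- `out` lists the conclusions of `D`, each once: all provable tagged literals over the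
language of `D`. -/
def Theory.IsConclusionList (D : Theory) (out : List ℕ) : Prop :=
  ∃ cs : List Conclusion, cs.Nodup ∧
    (∀ c, c ∈ cs ↔ c.lit.atom ∈ D.atoms ∧ D.Proves c) ∧
    out = cs.flatMap Conclusion.code

end DefeasibleLogic

/-! ### The machine model

A random access machine with finitely many registers and finitely many arrays (those that the
program names) over the natural numbers. The only arithmetic is successor and predecessor, so
that in `t` steps no number can grow by more than `t` beyond the numbers in the input and in the
program; hence counting every elementary operation as one step hides no work in long numbers. -/

namespace RAM

/-- Programs. `r`, `s`, `i` name registers, `a` names an array. -/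
inductive Prog where
  /-- `r := n` -/
  | const (r n : ℕ)
  /-- `r := s` -/
  | copy (r s : ℕ)
  /-- `r := r + 1` -/
  | succ (r : ℕ)
  /-- `r := r - 1`, and `0` stays `0` -/
  | pred (r : ℕ)
  /-- `r := a[i]` -/
  | load (r a i : ℕ)
  /-- `a[i] := r` -/
  | store (a i r : ℕ)
  /-- first `p`, then `q` -/
  | seq (p q : Prog)
  /-- if `r = s` then `p` else `q` -/
  | ifEq (r s : ℕ) (p q : Prog)
  /-- while `r ≠ s` do `p` -/
  | whileNe (r s : ℕ) (p : Prog)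

/-- The contents of the registers and of the array cells. -/
structure State where
  reg : ℕ → ℕ
  arr : ℕ → ℕ → ℕ

def State.setReg (σ : State) (r v : ℕ) : State :=
  { σ with reg := Function.update σ.reg r v }

def State.setArr (σ : State) (a i v : ℕ) : State :=
  { σ with arr := Function.update σ.arr a (Function.update (σ.arr a) i v) }

/-- One step of the machine. A configuration consists of the programs that remain to be
executed, first one first, and a state; the machine has halted when nothing remains. -/
def step : List Prog × State → List Prog × State
  | ([], σ) => ([], σ)
  | (.const r n :: k, σ) => (k, σ.setReg r n)
  | (.copy r s :: k, σ) => (k, σ.setReg r (σ.reg s))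
  | (.succ r :: k, σ) => (k, σ.setReg r (σ.reg r + 1))
  | (.pred r :: k, σ) => (k, σ.setReg r (σ.reg r - 1))
  | (.load r a i :: k, σ) => (k, σ.setReg r (σ.arr a (σ.reg i)))
  | (.store a i r :: k, σ) => (k, σ.setArr a (σ.reg i) (σ.reg r))
  | (.seq p q :: k, σ) => (p :: q :: k, σ)
  | (.ifEq r s p q :: k, σ) => (if σ.reg r = σ.reg s then p :: k else q :: k, σ)
  | (.whileNe r s p :: k, σ) => (if σ.reg r = σ.reg s then k else p :: .whileNe r s p :: k, σ)

/-- The initial state for input `w`: the entries of `w` are in array `0`, the length of `w` is in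
register `0`, everything else is zero. -/
def init (w : List ℕ) : State where
  reg := fun r => if r = 0 then w.length else 0
  arr := fun a i => if a = 0 then w.getD i 0 else 0

/-- The output: array `1`, up to the length given in register `1`. -/
def State.output (σ : State) : List ℕ := (List.range (σ.reg 1)).map (σ.arr 1)

/-- On input `w`, the program `p` halts after at most `T` steps, with output `out`. -/
def Computes (p : Prog) (w out : List ℕ) (T : ℕ) : Prop :=
  ∃ t ≤ T, ∃ σ : State, step^[t] ([p], init w) = ([], σ) ∧ σ.output = out

end RAM

/-! No inference rule asks for the absence of a line: each is a positive combination of earlier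
lines, with side conditions on the fixed data (facts, rules, `>`). Provability is therefore a least
fixed point. It is computed by propagation in an and-or graph, as in the linear-time satisfiability
test for Horn formulas. The negative tags are vertices in their own right, so the graph needs no
negation.

The graph `Theory.Edge` must have linear size, whereas the conditions for `+∂q` and `-∂q`, written
out, range over pairs of a rule for `q` and a rule for the complement. The remedy is to share
subconditions. Whether a body is proved or refuted is decided once per rule. The vertices `beaten`
and `win` of a rule `s` receive one edge for each relevant statement `t > s`: for `beaten` only
these `t` can help, and for `win` all other `t` satisfy the condition outright. Hence every fact,
body literal, rule and superiority statement causes a bounded number of edges.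

On tagged literals, the least closed set of vertices is provability. `Theory.Closed.of_proves` shows
by induction on derivations that every closed set contains what is provable. `Theory.closed_holds`
shows that the vertices whose intended meaning is true form a closed set; this rests on the fact
that derivations can be concatenated, so that finitely many provable premises occur together in one
derivation.

On the machine each vertex has a counter, which starts at the number of its incoming edges for a
conjunction and at one for a disjunction. A vertex whose counter drops to zero goes on a stack, and
its outgoing edges then decrease the counters of their targets. No vertex is stacked twice, so no
edge is followed twice (`Propagates.step`, `ev_propagate`), and `count_eq_zero_iff` reads
provability off the counters.

Atoms and labels are arbitrary numbers; used as array indices they lead in constant time to a block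
of `23` vertex numbers. Every number in the input gets a block, whether or not it is an atom or a
label, and the vertices `occ` select the atoms for the output. The theorem follows because the input
has at most linearly many entries (`length_le_size`) and each entry costs bounded time
(`runningTime_le`). -/

namespace RAM

/-! ### Timed execution -/

/-- Started in `σ`, the program `p` terminates within `T` steps in a state satisfying `Q`. -/
def Ev (p : Prog) (T : ℕ) (σ : State) (Q : State → Prop) : Prop :=
  ∃ t ≤ T, ∃ σ', (∀ k, step^[t] (p :: k, σ) = (k, σ')) ∧ Q σ'

theorem Ev.mono {p : Prog} {T T' : ℕ} {σ : State} {Q Q' : State → Prop} (h : Ev p T σ Q)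
    (hT : T ≤ T') (hQ : ∀ σ', Q σ' → Q' σ') : Ev p T' σ Q' := by
  obtain ⟨t, ht, σ', h1, h2⟩ := h
  exact ⟨t, ht.trans hT, σ', h1, hQ _ h2⟩

/-- `Ev` quantifies over the remaining programs, so `p` can be run with `q` waiting behind it. The
additional step unpacks the composition. -/
theorem Ev.seq {p q : Prog} {T₁ T₂ : ℕ} {σ : State} {Q R : State → Prop} (hp : Ev p T₁ σ R)
    (hq : ∀ σ', R σ' → Ev q T₂ σ' Q) : Ev (.seq p q) (T₁ + T₂ + 1) σ Q := by
  obtain ⟨t, ht, σ', h1, h2⟩ := hp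
  obtain ⟨u, hu, σ'', h3, h4⟩ := hq σ' h2
  refine ⟨u + (t + 1), by omega, σ'', fun k => ?_, h4⟩
  rw [Function.iterate_add_apply, Function.iterate_succ_apply]
  simp only [step]
  rw [h1, h3]

theorem Ev.ifEq {r s : ℕ} {p q : Prog} {T : ℕ} {σ : State} {Q : State → Prop}
    (hp : σ.reg r = σ.reg s → Ev p T σ Q) (hq : σ.reg r ≠ σ.reg s → Ev q T σ Q) :
    Ev (.ifEq r s p q) (T + 1) σ Q := by
  by_cases h : σ.reg r = σ.reg s
  · obtain ⟨t, ht, σ', h1, h2⟩ := hp h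
    refine ⟨t + 1, by omega, σ', fun k => ?_, h2⟩
    rw [Function.iterate_succ_apply]
    simp only [step, if_pos h]
    exact h1 k
  · obtain ⟨t, ht, σ', h1, h2⟩ := hq h
    refine ⟨t + 1, by omega, σ', fun k => ?_, h2⟩
    rw [Function.iterate_succ_apply]
    simp only [step, if_neg h]
    exact h1 k

/-- The rule for loops; `n` is a bound for the time that the remaining iterations take. -/
theorem Ev.whileNe {r s : ℕ} {p : Prog} (I : ℕ → State → Prop)
    -- One step for the test, `c` for the body, `m` for the later iterations; the inequality forces
    -- `m < n`, which gives termination.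
    (body : ∀ n σ, I n σ → σ.reg r ≠ σ.reg s → ∃ m c, c + 1 + m ≤ n ∧ Ev p c σ (I m)) :
    ∀ n σ, I n σ →
      Ev (.whileNe r s p) (n + 1) σ fun σ' => (∃ m, I m σ') ∧ σ'.reg r = σ'.reg s := by
  intro n
  induction n using Nat.strong_induction_on with
  | _ n ih =>
    intro σ hσ
    by_cases h : σ.reg r = σ.reg s
    · refine ⟨1, by omega, σ, fun k => ?_, ⟨n, hσ⟩, h⟩
      simp [step, h]
    · obtain ⟨m, c, hmc, t, ht, σ', h1, h2⟩ := body n σ hσ h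
      obtain ⟨u, hu, σ'', h3, h4⟩ := ih m (by omega) σ' h2
      refine ⟨u + (t + 1), by omega, σ'', fun k => ?_, h4⟩
      rw [Function.iterate_add_apply, Function.iterate_succ_apply]
      simp only [step, if_neg h]
      rw [h1, h3]

/-! ### Programs without loops -/

/-- There is no loop in the program. -/
def Prog.LoopFree : Prog → Prop
  | .seq p q => p.LoopFree ∧ q.LoopFree
  | .ifEq _ _ p q => p.LoopFree ∧ q.LoopFree
  | .whileNe _ _ _ => False
  | _ => True

/-- The effect of a program without loops. -/
def Prog.run : Prog → State → State
  | .const r n, σ => σ.setReg r n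
  | .copy r s, σ => σ.setReg r (σ.reg s)
  | .succ r, σ => σ.setReg r (σ.reg r + 1)
  | .pred r, σ => σ.setReg r (σ.reg r - 1)
  | .load r a i, σ => σ.setReg r (σ.arr a (σ.reg i))
  | .store a i r, σ => σ.setArr a (σ.reg i) (σ.reg r)
  | .seq p q, σ => q.run (p.run σ)
  | .ifEq r s p q, σ => if σ.reg r = σ.reg s then p.run σ else q.run σ
  -- A default value without meaning for the machine; with it `run_reg` and `run_arr` hold for all
  -- programs.
  | .whileNe _ _ _, σ => σ

/-- A bound for the running time of a program without loops. -/
def Prog.cost : Prog → ℕ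
  | .seq p q => p.cost + q.cost + 1
  | .ifEq _ _ p q => p.cost + q.cost + 1
  | _ => 1

theorem Prog.LoopFree.ev {p : Prog} (hp : p.LoopFree) (σ : State) {Q : State → Prop}
    (hQ : Q (p.run σ)) : Ev p p.cost σ Q := by
  suffices h : Ev p p.cost σ (· = p.run σ) from h.mono le_rfl fun _ h => h ▸ hQ
  clear hQ
  induction p generalizing σ with
  | seq p q ihp ihq =>
    refine Ev.seq (ihp hp.1 σ) fun σ' h => ?_
    subst h
    exact ihq hp.2 _
  | ifEq r s p q ihp ihq =>
    refine (Ev.ifEq (T := p.cost + q.cost) (fun h => ?_) fun h => ?_)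
    · refine (ihp hp.1 σ).mono (by omega) fun σ' h' => ?_
      simp [Prog.run, h, h']
    · refine (ihq hp.2 σ).mono (by omega) fun σ' h' => ?_
      simp [Prog.run, h, h']
  | whileNe r s p ih => exact hp.elim
  | _ => exact ⟨1, le_rfl, _, fun k => rfl, rfl⟩

/-- The registers that the program writes to. -/
def Prog.regs : Prog → List ℕ
  | .const r _ => [r]
  | .copy r _ => [r]
  | .succ r => [r]
  | .pred r => [r]
  | .load r _ _ => [r]
  | .store _ _ _ => []
  | .seq p q => p.regs ++ q.regs
  | .ifEq _ _ p q => p.regs ++ q.regs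
  | .whileNe _ _ p => p.regs

/-- The arrays that the program writes to. -/
def Prog.arrs : Prog → List ℕ
  | .store a _ _ => [a]
  | .seq p q => p.arrs ++ q.arrs
  | .ifEq _ _ p q => p.arrs ++ q.arrs
  | .whileNe _ _ p => p.arrs
  | _ => []

theorem Prog.run_reg {p : Prog} {r : ℕ} (h : r ∉ p.regs) (σ : State) :
    (p.run σ).reg r = σ.reg r := by
  induction p generalizing σ with
  | seq p q ihp ihq =>
    simp only [Prog.regs, List.mem_append, not_or] at h
    exact (ihq h.2 _).trans (ihp h.1 _)
  | ifEq r s p q ihp ihq =>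
    simp only [Prog.regs, List.mem_append, not_or] at h
    simp only [Prog.run]
    split_ifs
    · exact ihp h.1 _
    · exact ihq h.2 _
  | whileNe r s p ih => rfl
  | store => rfl
  | _ =>
    simp only [Prog.regs, List.mem_singleton] at h
    simp [Prog.run, State.setReg, h]

theorem Prog.run_arr {p : Prog} {a : ℕ} (h : a ∉ p.arrs) (σ : State) :
    (p.run σ).arr a = σ.arr a := by
  induction p generalizing σ with
  | seq p q ihp ihq =>
    simp only [Prog.arrs, List.mem_append, not_or] at h
    exact (ihq h.2 _).trans (ihp h.1 _)
  | ifEq r s p q ihp ihq =>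
    simp only [Prog.arrs, List.mem_append, not_or] at h
    simp only [Prog.run]
    split_ifs
    · exact ihp h.1 _
    · exact ihq h.2 _
  | store =>
    simp only [Prog.arrs, List.mem_singleton] at h
    simp [Prog.run, State.setArr, h]
  | _ => rfl

/-- A loop over a list. -/
theorem Ev.forList {α : Type*} {r s : ℕ} {p : Prog} (I : List α → State → Prop) (f : α → ℕ)
    (hnil : ∀ σ, I [] σ → σ.reg r = σ.reg s)
    (hcons : ∀ a l σ, I (a :: l) σ → σ.reg r ≠ σ.reg s ∧ Ev p (f a) σ (I l)) :
    ∀ (l : List α) (σ : State), I l σ →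
      Ev (.whileNe r s p) ((l.map fun a => f a + 1).sum + 1) σ (I []) := by
  intro l
  induction l with
  | nil =>
    intro σ h
    refine ⟨1, by simp, σ, fun k => ?_, h⟩
    simp [step, hnil σ h]
  | cons a l ih =>
    intro σ h
    obtain ⟨hne, t, ht, σ', h1, h2⟩ := hcons a l σ h
    obtain ⟨u, hu, σ'', h3, h4⟩ := ih σ' h2
    refine ⟨u + (t + 1), by rw [List.map_cons, List.sum_cons]; omega, σ'', fun k => ?_, h4⟩
    rw [Function.iterate_add_apply, Function.iterate_succ_apply]
    simp only [step, if_neg hne]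
    rw [h1, h3]

/-- A loop over a list, with a body that does not contain loops. -/
theorem Ev.forList_loopFree {α : Type*} {r s : ℕ} {p : Prog} (hp : p.LoopFree)
    (I : List α → State → Prop) (hnil : ∀ σ, I [] σ → σ.reg r = σ.reg s)
    (hcons : ∀ a l σ, I (a :: l) σ → σ.reg r ≠ σ.reg s ∧ I l (p.run σ))
    (l : List α) (σ : State) (h : I l σ) :
    Ev (.whileNe r s p) (l.length * (p.cost + 1) + 1) σ (I []) := by
  have := Ev.forList (r := r) (s := s) (p := p) I (fun _ => p.cost) hnil
    (fun a l σ h => ⟨(hcons a l σ h).1, hp.ev σ (hcons a l σ h).2⟩) l σ h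
  simpa using this

/-- The programs of a list, one after another. -/
def Prog.block : List Prog → Prog
  -- Copying a register to itself serves as the empty instruction throughout.
  | [] => .copy 3 3
  | [p] => p
  | p :: q :: l => .seq p (Prog.block (q :: l))

/-- `r := r + k` -/
def Prog.addK (r : ℕ) : ℕ → Prog
  | 0 => .copy r r
  | k + 1 => .seq (.succ r) (Prog.addK r k)

@[simp] theorem State.setReg_reg (σ : State) (r v : ℕ) :
    (σ.setReg r v).reg = Function.update σ.reg r v := rfl
@[simp] theorem State.setReg_arr (σ : State) (r v : ℕ) : (σ.setReg r v).arr = σ.arr := rfl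
@[simp] theorem State.setArr_reg (σ : State) (a i v : ℕ) : (σ.setArr a i v).reg = σ.reg := rfl
@[simp] theorem State.setArr_arr (σ : State) (a i v : ℕ) :
    (σ.setArr a i v).arr = Function.update σ.arr a (Function.update (σ.arr a) i v) := rfl

@[simp] theorem Prog.addK_loopFree (r k : ℕ) : (Prog.addK r k).LoopFree := by
  induction k with
  | zero => trivial
  | succ k ih => exact ⟨trivial, ih⟩

@[simp] theorem Prog.run_addK (r k : ℕ) (σ : State) :
    (Prog.addK r k).run σ = σ.setReg r (σ.reg r + k) := by
  induction k generalizing σ with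
  | zero => rfl
  | succ k ih =>
    simp only [Prog.addK, Prog.run, ih, State.setReg, Function.update_self, Function.update_idem]
    congr 2
    omega

@[simp] theorem Prog.mem_regs_addK (r k s : ℕ) : s ∈ (Prog.addK r k).regs ↔ s = r := by
  induction k with
  | zero => simp [Prog.addK, Prog.regs]
  | succ k ih => simp [Prog.addK, Prog.regs, ih]

@[simp] theorem Prog.arrs_addK (r k : ℕ) : (Prog.addK r k).arrs = [] := by
  induction k with
  | zero => rfl
  | succ k ih => simp [Prog.addK, Prog.arrs, ih]

@[simp] theorem State.setReg_self (σ : State) (r : ℕ) : σ.setReg r (σ.reg r) = σ := by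
  simp [State.setReg]

/-! ### Graphs in memory -/

/-- The linked list that starts at the cell `e` contains `l`; all of its cells lie in `[1, b]`. -/
def Chain (next tgt : ℕ → ℕ) (b : ℕ) : ℕ → List ℕ → Prop
  | e, [] => e = 0
  | e, v :: l => e ≠ 0 ∧ e ≤ b ∧ tgt e = v ∧ Chain next tgt b (next e) l

/-- The cell `b + 1` is fresh, so writing to it leaves every existing list intact. -/
theorem Chain.update {next tgt : ℕ → ℕ} {b e : ℕ} {l : List ℕ} (h : Chain next tgt b e l)
    (x y : ℕ) : Chain (Function.update next (b + 1) x) (Function.update tgt (b + 1) y) (b + 1) e l := by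
  induction l generalizing e with
  | nil => exact h
  | cons v l ih =>
    obtain ⟨h1, h2, h3, h4⟩ := h
    have : e ≠ b + 1 := by omega
    refine ⟨h1, by omega, by simp [this, h3], ?_⟩
    rw [Function.update_of_ne this]
    exact ih h4

/-- The targets of the edges that leave `u`. -/
def targets (E : List (ℕ × ℕ)) (u : ℕ) : List ℕ := (E.filter fun e => e.1 = u).map Prod.snd

/-- The threshold of a vertex: it becomes true as soon as that many of its edges do.
The vertices in `O` are disjunctions, the others are conjunctions. -/
def threshold (E : List (ℕ × ℕ)) (O : List ℕ) (v : ℕ) : ℕ :=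
  if v ∈ O then 1 else E.countP fun e => e.2 = v

/-- The state stores the graph with edges `E` and disjunctive vertices `O`:
register `2` holds the number of edges, register `10` is zero; arrays `2`, `3`, `4` are the heads
of the adjacency lists, the successor cells and the targets, array `5` holds the thresholds and
array `6` is the characteristic function of `O`. -/
structure Stores (E : List (ℕ × ℕ)) (O : List ℕ) (σ : State) : Prop where
  zero : σ.reg 10 = 0
  edges : σ.reg 2 = E.length
  chain : ∀ u, ∃ l, l.Perm (targets E u) ∧ Chain (σ.arr 3) (σ.arr 4) E.length (σ.arr 2 u) l
  count : ∀ v, σ.arr 5 v = threshold E O v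
  disj : ∀ v, σ.arr 6 v = if v ∈ O then 1 else 0

/-- The order of the edges is immaterial, and `O` counts only as a set. Each loop may thus add its
edges in the order in which it meets them. -/
theorem Stores.perm {E E' : List (ℕ × ℕ)} {O O' : List ℕ} {σ : State} (h : Stores E O σ)
    (hE : E.Perm E') (hO : ∀ v, v ∈ O ↔ v ∈ O') : Stores E' O' σ where
  zero := h.zero
  edges := h.edges.trans hE.length_eq
  chain u := by
    obtain ⟨l, h1, h2⟩ := h.chain u
    exact ⟨l, h1.trans ((hE.filter _).map _), hE.length_eq ▸ h2⟩
  count v := by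
    rw [h.count, threshold, threshold, hE.countP_eq]
    simp [hO]
  disj v := by rw [h.disj]; simp [hO]

theorem Stores.congr {E : List (ℕ × ℕ)} {O : List ℕ} {σ σ' : State} (h : Stores E O σ)
    (h2 : σ'.reg 2 = σ.reg 2) (h10 : σ'.reg 10 = σ.reg 10)
    (ha : ∀ a, 2 ≤ a → a ≤ 6 → σ'.arr a = σ.arr a) : Stores E O σ' where
  zero := h10.trans h.zero
  edges := h2.trans h.edges
  chain u := by
    rw [ha 2 (by omega) (by omega), ha 3 (by omega) (by omega), ha 4 (by omega) (by omega)]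
    exact h.chain u
  count v := by rw [ha 5 (by omega) (by omega)]; exact h.count v
  disj v := by rw [ha 6 (by omega) (by omega)]; exact h.disj v

/-- The parts of the state that building the graph does not use are the same. -/
structure Frame (σ σ' : State) : Prop where
  reg : ∀ r, r < 2 ∨ 10 ≤ r → σ'.reg r = σ.reg r
  arr : ∀ a, a < 2 ∨ 7 ≤ a → σ'.arr a = σ.arr a

theorem Frame.refl (σ : State) : Frame σ σ := ⟨fun _ _ => rfl, fun _ _ => rfl⟩

theorem Frame.trans {σ σ' σ'' : State} (h : Frame σ σ') (h' : Frame σ' σ'') : Frame σ σ'' :=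
  ⟨fun r hr => (h'.reg r hr).trans (h.reg r hr), fun a ha => (h'.arr a ha).trans (h.arr a ha)⟩

/-- An edge of a program: a pair of vertices, each of which is a register plus a constant. -/
structure Link where
  src : ℕ
  srcOff : ℕ
  tgt : ℕ
  tgtOff : ℕ

/-- The program that adds an edge to the graph. -/
def Link.prog (e : Link) : Prog := Prog.block
  [.copy 3 e.src, .addK 3 e.srcOff, .copy 4 e.tgt, .addK 4 e.tgtOff, .succ 2,
    -- The new cell becomes the front of the adjacency list of the source.
    .load 5 2 3, .store 3 2 5, .store 2 3 2, .store 4 2 4, .load 5 6 4,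
    -- Only a conjunction counts its incoming edges; the threshold of a disjunction stays one.
    .ifEq 5 10 (.seq (.load 6 5 4) (.seq (.succ 6) (.store 5 4 6))) (.copy 3 3)]

def Link.edge (e : Link) (σ : State) : ℕ × ℕ :=
  (σ.reg e.src + e.srcOff, σ.reg e.tgt + e.tgtOff)

theorem Link.prog_loopFree (e : Link) : e.prog.LoopFree := by
  simp [Link.prog, Prog.block, Prog.LoopFree]

theorem Link.run_prog {e : Link} {E : List (ℕ × ℕ)} {O : List ℕ} {σ : State} (h : Stores E O σ)
    (hs : 10 ≤ e.src) (ht : 10 ≤ e.tgt) :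
    Stores (e.edge σ :: E) O (e.prog.run σ) ∧ Frame σ (e.prog.run σ) := by
  obtain ⟨s, a, t, b⟩ := e
  simp only at hs ht
  -- Register `3` is overwritten before the target register is read.
  have ht3 : t ≠ 3 := by omega
  have h10 := h.zero
  have hd := h.disj (σ.reg t + b)
  have hframe : Frame σ ((Link.mk s a t b).prog.run σ) := by
    constructor
    · intro r hr
      refine Prog.run_reg ?_ σ
      simp [Link.prog, Prog.block, Prog.regs]
      omega
    · intro r hr
      refine Prog.run_arr ?_ σ
      simp [Link.prog, Prog.block, Prog.arrs]
      omega
  refine ⟨?_, hframe⟩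
  have hn := h.edges
  constructor
  · rw [hframe.reg 10 (by omega), h10]
  · simp only [Link.prog, Prog.block, Prog.run, Prog.run_addK]
    split_ifs <;> simp [hn]
  · intro u
    have e3 : ((Link.mk s a t b).prog.run σ).arr 3
        = Function.update (σ.arr 3) (E.length + 1) (σ.arr 2 (σ.reg s + a)) := by
      simp only [Link.prog, Prog.block, Prog.run, Prog.run_addK]
      split_ifs <;> simp [hn]
    have e4 : ((Link.mk s a t b).prog.run σ).arr 4
        = Function.update (σ.arr 4) (E.length + 1) (σ.reg t + b) := by
      simp only [Link.prog, Prog.block, Prog.run, Prog.run_addK]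
      split_ifs <;> simp [hn, ht3]
    have e2 : ((Link.mk s a t b).prog.run σ).arr 2
        = Function.update (σ.arr 2) (σ.reg s + a) (E.length + 1) := by
      simp only [Link.prog, Prog.block, Prog.run, Prog.run_addK]
      split_ifs <;> simp [hn]
    rw [e2, e3, e4]
    obtain ⟨l, h1, h2⟩ := h.chain u
    by_cases hu : u = σ.reg s + a
    · subst hu
      refine ⟨(σ.reg t + b) :: l, by simp [targets, Link.edge]; exact h1, ?_⟩
      simp only [Function.update_self, Chain, List.length_cons]
      refine ⟨by omega, le_rfl, trivial, ?_⟩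
      exact h2.update _ _
    · refine ⟨l, ?_, ?_⟩
      · simpa [targets, Link.edge, Ne.symm hu] using h1
      · rw [Function.update_of_ne hu]
        exact h2.update _ _
  · intro v
    have hc := h.count v
    by_cases hO : σ.reg t + b ∈ O
    · have e5 : ((Link.mk s a t b).prog.run σ).arr 5 = σ.arr 5 := by
        simp only [Link.prog, Prog.block, Prog.run, Prog.run_addK]
        rw [if_neg] <;> simp [ht3, h10, hd, hO]
      rw [e5, hc, threshold, threshold]
      split_ifs with hv
      · rfl
      · rw [List.countP_cons_of_neg]
        intro h'
        have : σ.reg t + b = v := of_decide_eq_true h'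
        exact hv (this ▸ hO)
    · have e5 : ((Link.mk s a t b).prog.run σ).arr 5
          = Function.update (σ.arr 5) (σ.reg t + b) (σ.arr 5 (σ.reg t + b) + 1) := by
        simp only [Link.prog, Prog.block, Prog.run, Prog.run_addK]
        rw [if_pos] <;> simp [ht3, h10, hd, hO]
      rw [e5]
      by_cases hv : v = σ.reg t + b
      · subst hv
        simp [hc, threshold, hO, Link.edge]
      · rw [Function.update_of_ne hv, hc, threshold, threshold, List.countP_cons_of_neg]
        intro h'
        have : σ.reg t + b = v := of_decide_eq_true h'
        exact hv this.symm
  · intro v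
    rw [← h.disj v]
    simp only [Link.prog, Prog.block, Prog.run, Prog.run_addK]
    split_ifs <;> simp

/-- The program that adds several edges to the graph. -/
def links : List Link → Prog
  | [] => .copy 3 3
  -- The tail runs first, since each new edge is put in front of the earlier ones.
  | e :: l => .seq (links l) e.prog

theorem links_loopFree (l : List Link) : (links l).LoopFree := by
  induction l with
  | nil => trivial
  | cons e l ih => exact ⟨ih, e.prog_loopFree⟩

/-- Building uses only registers below `10`, so all links may be evaluated in the initial state. -/
theorem run_links {l : List Link} {E : List (ℕ × ℕ)} {O : List ℕ} {σ : State} (h : Stores E O σ)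
    (hl : ∀ e ∈ l, 10 ≤ e.src ∧ 10 ≤ e.tgt) :
    Stores (l.map (·.edge σ) ++ E) O ((links l).run σ) ∧ Frame σ ((links l).run σ) := by
  induction l with
  | nil => simpa [links, Prog.run] using ⟨h, Frame.refl σ⟩
  | cons e l ih =>
    obtain ⟨h1, h2⟩ := ih fun e he => hl e (List.mem_cons_of_mem _ he)
    obtain ⟨hs, ht⟩ := hl e List.mem_cons_self
    obtain ⟨h3, h4⟩ := Link.run_prog (e := e) h1 hs ht
    refine ⟨?_, h2.trans h4⟩
    have : e.edge ((links l).run σ) = e.edge σ := by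
      simp [Link.edge, h2.reg _ (Or.inr hs), h2.reg _ (Or.inr ht)]
    rw [this] at h3
    exact h3

/-- The program that makes the vertex (register `p.1` plus `p.2`) a disjunction. -/
def disjProg (p : ℕ × ℕ) : Prog := Prog.block
  [.copy 3 p.1, .addK 3 p.2, .const 4 1, .store 5 3 4, .store 6 3 4]

theorem run_disjProg {p : ℕ × ℕ} {E : List (ℕ × ℕ)} {O : List ℕ} {σ : State} (h : Stores E O σ) :
    Stores E ((σ.reg p.1 + p.2) :: O) ((disjProg p).run σ) ∧ Frame σ ((disjProg p).run σ) := by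
  refine ⟨⟨?_, ?_, fun u => ?_, fun v => ?_, fun v => ?_⟩, fun r hr => ?_, fun a ha => ?_⟩
  · simp [disjProg, Prog.block, Prog.run, h.zero]
  · simp [disjProg, Prog.block, Prog.run, h.edges]
  · simpa [disjProg, Prog.block, Prog.run] using h.chain u
  · have := h.count v
    by_cases hv : v = σ.reg p.1 + p.2
    · simp [disjProg, Prog.block, Prog.run, hv, threshold]
    · simpa [disjProg, Prog.block, Prog.run, hv, threshold] using this
  · have := h.disj v
    by_cases hv : v = σ.reg p.1 + p.2
    · simp [disjProg, Prog.block, Prog.run, hv]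
    · simpa [disjProg, Prog.block, Prog.run, hv] using this
  · refine Prog.run_reg ?_ σ
    simp [disjProg, Prog.block, Prog.regs]
    omega
  · refine Prog.run_arr ?_ σ
    simp [disjProg, Prog.block, Prog.arrs]
    omega

/-- The program that makes several vertices disjunctions. -/
def disjs : List (ℕ × ℕ) → Prog
  | [] => .copy 3 3
  | p :: l => .seq (disjs l) (disjProg p)

theorem disjs_loopFree (l : List (ℕ × ℕ)) : (disjs l).LoopFree := by
  induction l with
  | nil => trivial
  | cons p l ih => exact ⟨ih, by simp [disjProg, Prog.block, Prog.LoopFree]⟩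

theorem run_disjs {l : List (ℕ × ℕ)} {E : List (ℕ × ℕ)} {O : List ℕ} {σ : State}
    (h : Stores E O σ) (hl : ∀ p ∈ l, 10 ≤ p.1) :
    Stores E (l.map (fun p => σ.reg p.1 + p.2) ++ O) ((disjs l).run σ) ∧
      Frame σ ((disjs l).run σ) := by
  induction l with
  | nil => simpa [disjs, Prog.run] using ⟨h, Frame.refl σ⟩
  | cons p l ih =>
    obtain ⟨h1, h2⟩ := ih fun e he => hl e (List.mem_cons_of_mem _ he)
    obtain ⟨h3, h4⟩ := run_disjProg (p := p) h1
    refine ⟨?_, h2.trans h4⟩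
    rw [h2.reg _ (Or.inr (hl p List.mem_cons_self))] at h3
    exact h3

end RAM

namespace RAM

/-! ### Propagation -/

/-- `C` contains the vertex `0`, every disjunctive vertex with an edge from `C`, and every
conjunctive vertex that has edges, all of them from `C`. -/
structure IsClosed (E : List (ℕ × ℕ)) (O : List ℕ) (C : ℕ → Prop) : Prop where
  root : C 0
  disj : ∀ e ∈ E, e.2 ∈ O → C e.1 → C e.2
  conj : ∀ v ∉ O, (∃ e ∈ E, e.2 = v) → (∀ e ∈ E, e.2 = v → C e.1) → C v

/-- An edge leaves exactly one vertex; as `P` has no repetitions, each edge with source in `P` is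
listed once. -/
theorem flatMap_targets_perm (E : List (ℕ × ℕ)) {P : List ℕ} (hP : P.Nodup) :
    (P.flatMap (targets E)).Perm ((E.filter fun e => e.1 ∈ P).map Prod.snd) := by
  induction P with
  | nil => simp
  | cons u P ih =>
    obtain ⟨hu, hP⟩ := List.nodup_cons.1 hP
    rw [List.flatMap_cons]
    refine ((ih hP).append_left _).trans ?_
    rw [targets, ← List.map_append]
    refine List.Perm.map _ ?_
    clear ih
    induction E with
    | nil => simp
    | cons e E ih =>
      by_cases h1 : e.1 = u
      · simpa [h1, hu] using ih
      · by_cases h2 : e.1 ∈ P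
        · simp only [h1, h2, decide_false, decide_true, List.mem_cons, false_or, Bool.false_eq_true,
            not_false_eq_true, List.filter_cons_of_neg, List.filter_cons_of_pos]
          exact List.perm_middle.trans (by simpa using ih)
        · simpa [h1, h2] using ih

theorem count_flatMap_targets (E : List (ℕ × ℕ)) {P : List ℕ} (hP : P.Nodup) (v : ℕ) :
    (P.flatMap (targets E)).count v = (E.filter fun e => e.2 = v).countP fun e => e.1 ∈ P := by
  rw [(flatMap_targets_perm E hP).count_eq, List.count, List.countP_map, List.countP_filter,
    List.countP_filter]
  refine List.countP_congr fun e _ => ?_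
  simp [and_comm]

/-- The link between counters and logic, where `P` is the set of vertices already true. For a
disjunction the threshold is one, so one edge from `P` suffices. For a conjunction it is the number
of incoming edges, which is attained only if all of them come from `P`, and it is positive only if
there are any. -/
theorem threshold_le_count_iff {E : List (ℕ × ℕ)} {O P : List ℕ} (hP : P.Nodup) (v : ℕ) :
    0 < threshold E O v ∧ threshold E O v ≤ (P.flatMap (targets E)).count v ↔
      (∃ e ∈ E, e.2 = v) ∧ ((v ∈ O ∧ ∃ e ∈ E, e.2 = v ∧ e.1 ∈ P) ∨
        (v ∉ O ∧ ∀ e ∈ E, e.2 = v → e.1 ∈ P)) := by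
  rw [count_flatMap_targets E hP, threshold]
  by_cases hv : v ∈ O
  · simp only [hv, if_true, true_and, not_true, false_and, or_false, Nat.succ_le_iff,
      List.countP_pos_iff, List.mem_filter, decide_eq_true_eq]
    aesop
  · simp only [hv, if_false, false_and, false_or, not_false_eq_true, true_and]
    rw [List.countP_pos_iff, List.countP_eq_length_filter]
    have : ((E.filter fun e => decide (e.2 = v)).length
        ≤ (E.filter fun e => decide (e.2 = v)).countP fun e => decide (e.1 ∈ P)) ↔
        ∀ e ∈ E, e.2 = v → e.1 ∈ P := by
      rw [(List.countP_le_length.ge_iff_eq : _ ↔ _), List.countP_eq_length]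
      simp
    rw [this]
    simp

/-- The array contains the list as a stack, with the last entry of the stack first in the list. -/
def StackIs (f : ℕ → ℕ) : List ℕ → Prop
  | [] => True
  | v :: S => f S.length = v ∧ StackIs f S

theorem StackIs.update {f : ℕ → ℕ} {S : List ℕ} (h : StackIs f S) {n : ℕ} (hn : S.length ≤ n)
    (v : ℕ) : StackIs (Function.update f n v) S := by
  induction S with
  | nil => trivial
  | cons u S ih =>
    simp only [List.length_cons] at hn
    refine ⟨?_, ih h.2 (by omega)⟩
    rw [Function.update_of_ne (by omega)]
    exact h.1

/-- One step of the propagation: register `25` is a cell of an adjacency list, register `24` is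
the height of the stack of the vertices whose edges are still to be followed, which is array `10`;
register `26` becomes `0` at the end. -/
def propagateStep : Prog :=
  .ifEq 25 10
    (.ifEq 24 10 (.const 26 0) (Prog.block [.pred 24, .load 27 10 24, .load 25 2 27]))
    (Prog.block [.load 27 4 25, .load 25 3 25, .load 28 5 27,
      .ifEq 28 10 (.copy 3 3) (Prog.block [.pred 28, .store 5 27 28,
        .ifEq 28 10 (.seq (.store 10 24 27) (.succ 24)) (.copy 3 3)])])

/-- The invariant of the propagation: `P` are the vertices whose edges have been followed, except
that the edges from its first element to `rem` are still to be followed, `S` is the stack, and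
`R` are the targets of the edges that have been followed. -/
structure Propagates (E : List (ℕ × ℕ)) (O P S R rem : List ℕ) (σ : State) : Prop where
  zero : σ.reg 10 = 0
  adj : ∀ u, ∃ l, l.Perm (targets E u) ∧ Chain (σ.arr 3) (σ.arr 4) E.length (σ.arr 2 u) l
  cur : Chain (σ.arr 3) (σ.arr 4) E.length (σ.reg 25) rem
  height : σ.reg 24 = S.length
  stack : StackIs (σ.arr 10) S
  nodup : (P ++ S).Nodup
  followed : (rem ++ R).Perm (P.flatMap (targets E))
  -- A vertex without threshold has counter zero from the start but is never reached; only vertex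
  -- `0` is exempt.
  reached : ∀ v, v ∈ P ++ S ↔ v = 0 ∨ 0 < threshold E O v ∧ threshold E O v ≤ R.count v
  -- Truncated subtraction: a counter that is zero stays zero.
  count : ∀ v, σ.arr 5 v = threshold E O v - R.count v
  least : ∀ C, IsClosed E O C → ∀ v ∈ P ++ S, C v

/-- Each edge is followed at most once; this is the source of the linear bound. -/
theorem length_flatMap_targets_le (E : List (ℕ × ℕ)) {P : List ℕ} (hP : P.Nodup) :
    (P.flatMap (targets E)).length ≤ E.length := by
  rw [(flatMap_targets_perm E hP).length_eq, List.length_map]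
  exact List.length_filter_le _ _

/-- Following an edge lowers the first summand of the measure by two and pushes at most one vertex;
taking a vertex off the stack lowers the second summand. The weight two pays for the push. `hroot`
prevents vertex `0`, which is on the stack initially, from being pushed again. -/
theorem Propagates.step {E : List (ℕ × ℕ)} {O P S R rem : List ℕ} {σ : State}
    (h : Propagates E O P S R rem σ) (hroot : threshold E O 0 = 0) :
    (rem = [] ∧ S = [] ∧ propagateStep.run σ = σ.setReg 26 0) ∨
    ((propagateStep.run σ).reg 26 = σ.reg 26 ∧ ∃ P' S' R' rem',
      Propagates E O P' S' R' rem' (propagateStep.run σ) ∧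
      2 * (E.length - R'.length) + S'.length < 2 * (E.length - R.length) + S.length) := by
  have h10 := h.zero
  cases rem with
  | nil =>
    have h25 : σ.reg 25 = 0 := h.cur
    cases S with
    | nil =>
      left
      have h24 := h.height
      simp [propagateStep, Prog.run, h25, h10, h24]
    | cons v S =>
      right
      have h24 := h.height
      simp only [List.length_cons] at h24
      have hrun : propagateStep.run σ
          = ((σ.setReg 24 S.length).setReg 27 v).setReg 25 (σ.arr 2 v) := by
        simp [propagateStep, Prog.run, Prog.block, h25, h10, h24, State.setReg, h.stack.1]
      rw [hrun]
      refine ⟨by simp, v :: P, S, R, ?_⟩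
      obtain ⟨l, h1, h2⟩ := h.adj v
      have hp : (v :: P ++ S).Perm (P ++ v :: S) := List.perm_middle.symm
      refine ⟨l, ⟨by simp [h10], by simpa using h.adj, by simpa using h2, by simp,
        by simpa using h.stack.2, hp.nodup_iff.2 h.nodup, ?_, ?_, by simpa using h.count, ?_⟩,
        by simp⟩
      · have := h.followed
        simp only [List.nil_append] at this
        simpa using h1.append this
      · intro w
        rw [hp.mem_iff, h.reached]
      · intro C hC w hw
        exact h.least C hC w (hp.mem_iff.1 hw)
  | cons v rem =>
    right
    obtain ⟨c1, c2, c3, c4⟩ := h.cur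
    have hnodup : P.Nodup := (List.nodup_append.1 h.nodup).1
    have hlen := length_flatMap_targets_le E hnodup
    rw [← h.followed.length_eq] at hlen
    simp only [List.cons_append, List.length_cons, List.length_append] at hlen
    have hfol : (rem ++ v :: R).Perm (P.flatMap (targets E)) :=
      List.perm_middle.trans h.followed
    have hcv := h.count v
    -- First case: the counter is already zero, and nothing changes but the position in the list.
    by_cases h0 : threshold E O v ≤ R.count v
    · have hrun : propagateStep.run σ
          = (((σ.setReg 27 v).setReg 25 (σ.arr 3 (σ.reg 25))).setReg 28 0) := by
        have : σ.arr 5 v = 0 := by omega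
        simp [propagateStep, Prog.run, Prog.block, h10, c1, c3, this]
        simp [State.setReg]
      rw [hrun]
      refine ⟨by simp, P, S, v :: R, rem, ⟨by simp [h10], by simpa using h.adj,
        by simpa using c4, by simpa using h.height, by simpa using h.stack, h.nodup, hfol,
        fun w => ?_, fun w => ?_, h.least⟩, by simp; omega⟩
      · rw [h.reached, List.count_cons]
        by_cases hw : v = w
        · subst hw
          simp
          omega
        · simp [hw]
      · simp only [State.setReg_arr, h.count, List.count_cons]
        by_cases hw : v = w
        · subst hw
          simp
          omega
        · simp [hw]
    -- The counter passes from one to zero, which happens once for each vertex; this is the moment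
    -- to push it.
    · by_cases h1 : threshold E O v = R.count v + 1
      · have hrun : propagateStep.run σ
            = (((((σ.setReg 27 v).setReg 25 (σ.arr 3 (σ.reg 25))).setReg 28 0).setArr 5 v 0).setArr
                10 S.length v).setReg 24 (S.length + 1) := by
          have : σ.arr 5 v = 1 := by omega
          simp [propagateStep, Prog.run, Prog.block, h10, c1, c3, this]
          simp [State.setReg, State.setArr, h.height]
        have hv : v ∉ P ++ S := by
          rw [h.reached]
          rintro (rfl | h2) <;> omega
        rw [hrun]
        refine ⟨by simp, P, v :: S, v :: R, rem, ⟨by simp [h10], by simpa using h.adj,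
          by simpa using c4, by simp, ?_, ?_, hfol,
          fun w => ?_, fun w => ?_, ?_⟩, by simp; omega⟩
        · exact ⟨by simp, by simpa using h.stack.update le_rfl v⟩
        · rw [List.perm_middle.nodup_iff, List.nodup_cons]
          exact ⟨hv, h.nodup⟩
        · rw [List.perm_middle.mem_iff, List.mem_cons, h.reached,
            List.count_cons]
          by_cases hw : v = w
          · subst hw
            simp
            omega
          · simp [hw, Ne.symm hw]
        · simp only [State.setReg_arr, State.setArr_arr, List.count_cons]
          by_cases hw : v = w
          · subst hw
            simp
            omega
          · simp [hw, Ne.symm hw, h.count]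
        · intro C hC w hw
          rw [List.perm_middle.mem_iff, List.mem_cons] at hw
          rcases hw with rfl | hw
          -- The edges in `rem` also leave `P`, so counting all targets of `P` still reaches the
          -- threshold; the sources are in `C` by the invariant, and closedness adds `w`.
          · have hc : 0 < threshold E O w ∧
                threshold E O w ≤ (P.flatMap (targets E)).count w := by
              rw [← h.followed.count_eq]
              simp
              omega
            obtain ⟨h2, ⟨h3, e, he, rfl, h4⟩ | ⟨h3, h4⟩⟩ := (threshold_le_count_iff hnodup w).1 hc
            · exact hC.disj e he h3 (h.least C hC _ (by simp [h4]))
            · exact hC.conj w h3 h2 fun e he hw => h.least C hC _ (by simp [h4 e he hw])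
          · exact h.least C hC w hw
      · have hrun : propagateStep.run σ
            = (((σ.setReg 27 v).setReg 25 (σ.arr 3 (σ.reg 25))).setReg 28
                (threshold E O v - R.count v - 1)).setArr 5 v (threshold E O v - R.count v - 1) := by
          have h2 : threshold E O v - R.count v ≠ 0 := by omega
          have h3 : threshold E O v - R.count v - 1 ≠ 0 := by omega
          simp [propagateStep, Prog.run, Prog.block, h10, c1, c3, hcv, h2, h3]
          simp [State.setReg, State.setArr]
        rw [hrun]
        refine ⟨by simp, P, S, v :: R, rem, ⟨by simp [h10], by simpa using h.adj,
          by simpa using c4, by simpa using h.height, by simpa using h.stack, h.nodup, hfol,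
          fun w => ?_, fun w => ?_, h.least⟩, by simp; omega⟩
        · rw [h.reached, List.count_cons]
          by_cases hw : v = w
          · subst hw
            simp
            omega
          · simp [hw]
        · simp only [State.setReg_arr, State.setArr_arr, List.count_cons]
          by_cases hw : v = w
          · subst hw
            simp
            omega
          · simp [hw, Ne.symm hw, h.count]

/-- The propagation, from a stack that consists of the vertex `0`. -/
def propagate : Prog := Prog.block
  [.store 10 10 10, .const 24 1, .const 25 0, .const 26 1, .whileNe 26 10 propagateStep]

theorem propagateStep_loopFree : propagateStep.LoopFree := by
  simp [propagateStep, Prog.block, Prog.LoopFree]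

theorem frame_propagateStep (σ : State) :
    (∀ r, r < 3 ∨ 4 ≤ r ∧ r < 24 → (propagateStep.run σ).reg r = σ.reg r) ∧
    ∀ a, a ≠ 5 → a ≠ 10 → (propagateStep.run σ).arr a = σ.arr a := by
  constructor
  · intro r hr
    refine Prog.run_reg ?_ σ
    simp [propagateStep, Prog.block, Prog.regs]
    omega
  · intro a h5 h10
    refine Prog.run_arr ?_ σ
    simp [propagateStep, Prog.block, Prog.arrs, h5, h10]

/-- When the stack and the current list are empty, all edges out of `P` have been followed, so `P`
itself is closed; the invariant `least` makes it the least closed set. -/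
theorem ev_propagate {E : List (ℕ × ℕ)} {O : List ℕ} {σ : State} (h : Stores E O σ)
    (hroot : threshold E O 0 = 0) :
    Ev propagate ((2 * E.length + 3) * (propagateStep.cost + 1) + 9) σ fun σ' =>
      ((∀ r, r < 3 ∨ 4 ≤ r ∧ r < 24 → σ'.reg r = σ.reg r) ∧
        ∀ a, a ≠ 5 → a ≠ 10 → σ'.arr a = σ.arr a) ∧
      IsClosed E O (fun v => v = 0 ∨ 0 < threshold E O v ∧ σ'.arr 5 v = 0) ∧
      ∀ C, IsClosed E O C → ∀ v, 0 < threshold E O v → σ'.arr 5 v = 0 → C v := by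
  set c := propagateStep.cost with hc
  let F : State → Prop := fun σ' => (∀ r, r < 3 ∨ 4 ≤ r ∧ r < 24 → σ'.reg r = σ.reg r) ∧
        ∀ a, a ≠ 5 → a ≠ 10 → σ'.arr a = σ.arr a
  -- Here `k` bounds the remaining iterations; the additional one is the iteration that finds the
  -- stack empty and clears register `26`.
  let I : ℕ → State → Prop := fun n σ' => F σ' ∧ σ'.reg 10 = 0 ∧ ∃ P S R rem k,
    Propagates E O P S R rem σ' ∧ (σ'.reg 26 = 0 → rem = [] ∧ S = []) ∧
    n = k * (c + 1) ∧ (σ'.reg 26 ≠ 0 → 2 * (E.length - R.length) + S.length + 1 ≤ k)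
  have hloop := Ev.whileNe (r := 26) (s := 10) (p := propagateStep) I (by
    rintro n σ' ⟨hF, h10, P, S, R, rem, k, hP, h26, rfl, hk⟩ hne
    rw [h10] at hne
    have hk := hk hne
    obtain ⟨k, rfl⟩ : ∃ k', k = k' + 1 := ⟨k - 1, by omega⟩
    have hfr := frame_propagateStep σ'
    refine ⟨k * (c + 1), c, by rw [Nat.succ_mul]; omega, propagateStep_loopFree.ev σ' ?_⟩
    refine ⟨⟨fun r hr => (hfr.1 r hr).trans (hF.1 r hr), fun a h5 h10 =>
      (hfr.2 a h5 h10).trans (hF.2 a h5 h10)⟩, by rw [hfr.1 10 (by omega), h10], ?_⟩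
    rcases hP.step hroot with ⟨rfl, rfl, hrun⟩ | ⟨h26', P', S', R', rem', hP', hlt⟩
    · refine ⟨P, [], R, [], k, ?_, fun _ => ⟨rfl, rfl⟩, rfl, fun h => ?_⟩
      · rw [hrun]
        exact ⟨by simp [h10], by simpa using hP.adj, by simpa using hP.cur,
          by simpa using hP.height, trivial, hP.nodup, hP.followed, hP.reached,
          by simpa using hP.count, hP.least⟩
      · simp [hrun] at h
    · refine ⟨P', S', R', rem', k, hP', fun h => ?_, rfl, fun _ => by omega⟩
      rw [h26'] at h
      exact absurd h hne)
  have hinit : I ((2 * E.length + 3) * (c + 1))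
      (((((σ.setArr 10 0 0).setReg 24 1).setReg 25 0).setReg 26 1)) := by
    refine ⟨⟨fun r hr => ?_, fun a h5 h10 => ?_⟩, ?_, [], [0], [], [], 2 * E.length + 3, ?_,
      fun h => ?_, rfl, fun _ => by simp⟩
    · have h24 : r ≠ 24 := by omega
      have h25 : r ≠ 25 := by omega
      have h26 : r ≠ 26 := by omega
      simp [h24, h25, h26]
    · simp [h10]
    · simp [h.zero]
    · refine ⟨by simp [h.zero], by simpa using h.chain, by simp [Chain], by simp,
        by simp [StackIs], by simp, by simp, fun v => ?_, fun v => by simp [h.count], ?_⟩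
      · simp only [List.nil_append, List.mem_singleton, List.count_nil]
        omega
      · intro C hC v hv
        obtain rfl : v = 0 := by simpa using hv
        exact hC.root
    · simp at h
  refine (Ev.seq (T₁ := 1) (T₂ := (2 * E.length + 3) * (c + 1) + 7)
    (Prog.LoopFree.ev (p := .store 10 10 10) trivial σ rfl) ?_).mono (by omega) fun _ h => h
  rintro _ rfl
  refine (Ev.seq (T₁ := 1) (T₂ := (2 * E.length + 3) * (c + 1) + 5)
    (Prog.LoopFree.ev (p := .const 24 1) trivial _ rfl) ?_).mono (by omega) fun _ h => h
  rintro _ rfl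
  refine (Ev.seq (T₁ := 1) (T₂ := (2 * E.length + 3) * (c + 1) + 3)
    (Prog.LoopFree.ev (p := .const 25 0) trivial _ rfl) ?_).mono (by omega) fun _ h => h
  rintro _ rfl
  refine (Ev.seq (T₁ := 1) (T₂ := (2 * E.length + 3) * (c + 1) + 1)
    (Prog.LoopFree.ev (p := .const 26 1) trivial _ rfl) ?_).mono (by omega) fun _ h => h
  rintro _ rfl
  simp only [Prog.run, h.zero]
  refine (hloop _ _ hinit).mono le_rfl ?_
  rintro σ' ⟨⟨m, hF, h10, P, S, R, rem, k, hP, h26, -, -⟩, hr⟩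
  obtain ⟨rfl, rfl⟩ := h26 (hr.trans h10)
  have hn : P.Nodup := by simpa using hP.nodup
  have hmem : ∀ v, v ∈ P ↔ v = 0 ∨ 0 < threshold E O v ∧ σ'.arr 5 v = 0 := by
    intro v
    have := hP.reached v
    rw [List.append_nil] at this
    rw [this, hP.count]
    omega
  have hfol : R.Perm (P.flatMap (targets E)) := by simpa using hP.followed
  have hreach : ∀ v, v ∈ P ↔ v = 0 ∨ 0 < threshold E O v ∧
      threshold E O v ≤ (P.flatMap (targets E)).count v := by
    intro v
    rw [← hfol.count_eq]
    simpa using hP.reached v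
  refine ⟨hF, ?_, fun C hC v h0 hv => hP.least C hC v (by simp [hmem, h0, hv])⟩
  simp only [← hmem]
  refine ⟨(hmem 0).2 (Or.inl rfl), fun e he hO hs => ?_, fun v hv hE hs => ?_⟩
  · rw [hreach, threshold_le_count_iff hn]
    exact Or.inr ⟨⟨e, he, rfl⟩, Or.inl ⟨hO, e, he, rfl, hs⟩⟩
  · rw [hreach, threshold_le_count_iff hn]
    exact Or.inr ⟨hE, Or.inr ⟨hv, hs⟩⟩

end RAM

namespace DefeasibleLogic

/-! ### The dependency graph of a defeasible theory -/

/-- The vertices of the dependency graph that belong to a literal `q`: the four tags, that some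
supportive rule for `q` is applicable, that `+∂q` holds by its second clause, that all supportive
rules for `q` are inapplicable, and the disjunction in the condition for `-∂q`. -/
inductive LitKind where
  | pd | md | pp | mp | sup | ppand | mpand | mpor

/-- The vertices that belong to a rule: its body is definitely proved or refuted, defeasibly proved
or refuted, the rule is countered, and the rule is applicable without being countered. -/
inductive RuleKind where
  | sd | fd | sp | fp | beaten | win

/-- The vertices of the dependency graph: `root` is true, `dead` is false, `occ a` says that the
atom `a` occurs in the theory. -/
inductive Vertex where
  | root
  | dead
  | lit (k : LitKind) (q : Literal)
  | rule (k : RuleKind) (l : ℕ)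
  | occ (a : ℕ)

def LitKind.IsDisj : LitKind → Prop
  | .pd | .pp | .sup | .mpor => True
  | _ => False

def RuleKind.IsDisj : RuleKind → Prop
  | .fd | .fp | .beaten => True
  | _ => False

/-- The vertices that hold as soon as one of their predecessors does. -/
def Vertex.IsDisj : Vertex → Prop
  | .lit k _ => k.IsDisj
  | .rule k _ => k.IsDisj
  | .occ _ => True
  | _ => False

/-- The edges of the dependency graph; `D.Edge v u` if there is an edge from `u` to `v`. -/
def Theory.Edge (D : Theory) : Vertex → Vertex → Prop
  | .root, _ => False
  | .dead, _ => False
  | .lit .pd q, u => (u = .root ∧ q ∈ D.facts) ∨ ∃ r ∈ D.strictFor q, u = .rule .sd r.label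
  -- An edge from `root` lets a conjunction without further premises hold, as closedness asks for at
  -- least one edge. The edge from `dead` blocks `-Δq` when `q` is a fact.
  | .lit .md q, u => u = .root ∨ (u = .dead ∧ q ∈ D.facts) ∨
      ∃ r ∈ D.strictFor q, u = .rule .fd r.label
  | .lit .pp q, u => u = .lit .pd q ∨ u = .lit .ppand q
  | .lit .mp q, u => u = .root ∨ u = .lit .md q ∨ u = .lit .mpor q
  | .lit .sup q, u => ∃ r ∈ D.supportFor q, u = .rule .sp r.label
  | .lit .ppand q, u => u = .root ∨ u = .lit .sup q ∨ u = .lit .md q.compl ∨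
      ∃ s ∈ D.rulesFor q.compl, u = .rule .beaten s.label
  | .lit .mpand q, u => u = .root ∨ ∃ r ∈ D.supportFor q, u = .rule .fp r.label
  | .lit .mpor q, u => u = .lit .mpand q ∨ u = .lit .pd q.compl ∨
      ∃ s ∈ D.rulesFor q.compl, u = .rule .win s.label
  | .rule .sd l, u => u = .root ∨ ∃ r ∈ D.rules, r.label = l ∧ ∃ a ∈ r.body, u = .lit .pd a
  | .rule .fd l, u => ∃ r ∈ D.rules, r.label = l ∧ ∃ a ∈ r.body, u = .lit .md a
  | .rule .sp l, u => u = .root ∨ ∃ r ∈ D.rules, r.label = l ∧ ∃ a ∈ r.body, u = .lit .pp a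
  | .rule .fp l, u => ∃ r ∈ D.rules, r.label = l ∧ ∃ a ∈ r.body, u = .lit .mp a
  | .rule .beaten l, u => u = .rule .fp l ∨
      ∃ s ∈ D.rules, s.label = l ∧ ∃ t ∈ D.supportFor s.head.compl, (t, s) ∈ D.sup ∧
        u = .rule .sp t.label
  | .rule .win l, u => u = .root ∨ u = .rule .sp l ∨
      ∃ s ∈ D.rules, s.label = l ∧ ∃ t ∈ D.supportFor s.head.compl, (t, s) ∈ D.sup ∧
        u = .rule .fp t.label
  | .occ a, u => u = .root ∧ a ∈ D.atoms

/-- The number that names the vertex occurs in `w`. -/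
def Vertex.Known (w : List ℕ) : Vertex → Prop
  | .root => True
  | .dead => True
  | .lit _ q => q.atom ∈ w
  | .rule _ l => l ∈ w
  | .occ a => a ∈ w

/-- All atoms and labels of `D` occur in `w`. -/
structure Theory.WrittenIn (D : Theory) (w : List ℕ) : Prop where
  atoms : ∀ a ∈ D.atoms, a ∈ w
  labels : ∀ r ∈ D.rules, r.label ∈ w

/-- `X` is closed under the propagation in the part of the dependency graph that `w` names. -/
structure Theory.Closed (D : Theory) (w : List ℕ) (X : Vertex → Prop) : Prop where
  root : X .root
  disj : ∀ v u, v.Known w → v.IsDisj → D.Edge v u → X u → X v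
  conj : ∀ v, v.Known w → ¬ v.IsDisj → (∃ u, D.Edge v u) → (∀ u, D.Edge v u → X u) → X v

def Tag.kind : Tag → LitKind
  | .plusDelta => .pd
  | .minusDelta => .md
  | .plusPartial => .pp
  | .minusPartial => .mp

def Conclusion.vertex (c : Conclusion) : Vertex := .lit c.tag.kind c.lit

@[simp] theorem Literal.compl_compl (q : Literal) : q.compl.compl = q := by
  simp [Literal.compl]

theorem Theory.mem_rulesFor {D : Theory} {q : Literal} {r : Rule} :
    r ∈ D.rulesFor q ↔ r ∈ D.rules ∧ r.head = q := by simp [Theory.rulesFor]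

theorem Theory.mem_strictFor {D : Theory} {q : Literal} {r : Rule} :
    r ∈ D.strictFor q ↔ r ∈ D.rules ∧ r.head = q ∧ r.arrow = .strict := by
  simp [Theory.strictFor, Theory.rulesFor, and_assoc]

theorem Theory.mem_supportFor {D : Theory} {q : Literal} {r : Rule} :
    r ∈ D.supportFor q ↔
      r ∈ D.rules ∧ r.head = q ∧ (r.arrow = .strict ∨ r.arrow = .defeasible) := by
  simp [Theory.supportFor, Theory.rulesFor, and_assoc]

theorem Theory.head_mem_atoms {D : Theory} {r : Rule} (hr : r ∈ D.rules) :
    r.head.atom ∈ D.atoms := by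
  simp only [Theory.atoms, Theory.literals, Finset.mem_image]
  exact ⟨r.head, by simp only [Finset.mem_union, Finset.mem_biUnion]; exact Or.inr ⟨r, hr, by simp⟩,
    rfl⟩

theorem Theory.body_mem_atoms {D : Theory} {r : Rule} (hr : r ∈ D.rules) {a : Literal}
    (ha : a ∈ r.body) : a.atom ∈ D.atoms := by
  simp only [Theory.atoms, Theory.literals, Finset.mem_image]
  exact ⟨a, by simp only [Finset.mem_union, Finset.mem_biUnion]; exact Or.inr ⟨r, hr, by simp [ha]⟩,
    rfl⟩

theorem Theory.fact_mem_atoms {D : Theory} {q : Literal} (hq : q ∈ D.facts) :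
    q.atom ∈ D.atoms := by
  simp only [Theory.atoms, Theory.literals, Finset.mem_image]
  exact ⟨q, by simp [hq], rfl⟩

/-! ### Provable conclusions lie in every closed set of vertices. -/

section Closed

variable {D : Theory} {w : List ℕ} {X : Vertex → Prop}

theorem Theory.Closed.body_proved (h : D.Closed w X) (hw : D.WrittenIn w) {r : Rule}
    (hr : r ∈ D.rules) (hX : ∀ a ∈ r.body, X (.lit .pp a)) : X (.rule .sp r.label) := by
  refine h.conj _ (hw.labels r hr) id ⟨.root, Or.inl rfl⟩ ?_
  rintro u (rfl | ⟨r', hr', hl, a, ha, rfl⟩)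
  · exact h.root
  · exact hX a (D.label_unique r' hr' r hr hl ▸ ha)

theorem Theory.Closed.body_strictly_proved (h : D.Closed w X) (hw : D.WrittenIn w) {r : Rule}
    (hr : r ∈ D.rules) (hX : ∀ a ∈ r.body, X (.lit .pd a)) : X (.rule .sd r.label) := by
  refine h.conj _ (hw.labels r hr) id ⟨.root, Or.inl rfl⟩ ?_
  rintro u (rfl | ⟨r', hr', hl, a, ha, rfl⟩)
  · exact h.root
  · exact hX a (D.label_unique r' hr' r hr hl ▸ ha)

theorem Theory.Closed.body_refuted (h : D.Closed w X) (hw : D.WrittenIn w) {r : Rule}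
    (hr : r ∈ D.rules) (hX : ∃ a ∈ r.body, X (.lit .mp a)) : X (.rule .fp r.label) := by
  obtain ⟨a, ha, hX⟩ := hX
  exact h.disj _ _ (hw.labels r hr) trivial ⟨r, hr, rfl, a, ha, rfl⟩ hX

theorem Theory.Closed.body_strictly_refuted (h : D.Closed w X) (hw : D.WrittenIn w) {r : Rule}
    (hr : r ∈ D.rules) (hX : ∃ a ∈ r.body, X (.lit .md a)) : X (.rule .fd r.label) := by
  obtain ⟨a, ha, hX⟩ := hX
  exact h.disj _ _ (hw.labels r hr) trivial ⟨r, hr, rfl, a, ha, rfl⟩ hX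

/-- Each clause of an inference rule is traced through the auxiliary vertices. Derivations may
mention atoms foreign to `D`, which need not have vertices; the restriction to atoms in `w` excludes
them, and passing to complements or to bodies of rules preserves it. -/
theorem Theory.Closed.of_infers (h : D.Closed w X) (hw : D.WrittenIn w) {P : List Conclusion}
    {c : Conclusion} (hc : D.Infers P c) (ha : c.lit.atom ∈ w)
    (hP : ∀ c' ∈ P, c'.lit.atom ∈ w → X c'.vertex) : X c.vertex := by
  have hbody : ∀ {r : Rule} {a : Literal}, r ∈ D.rules → a ∈ r.body → ∀ t, ⟨t, a⟩ ∈ P →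
      X (.lit t.kind a) := fun hr ha t ht => hP _ ht (hw.atoms _ (D.body_mem_atoms hr ha))
  obtain ⟨tag, q⟩ := c
  change q.atom ∈ w at ha
  have hself : ∀ t, ⟨t, q⟩ ∈ P → X (.lit t.kind q) := fun t ht => hP _ ht ha
  have hcompl : ∀ t, ⟨t, q.compl⟩ ∈ P → X (.lit t.kind q.compl) := fun t ht => hP _ ht ha
  cases tag with
  | plusDelta =>
    rcases hc with hq | ⟨r, hr, hb⟩
    · exact h.disj (.lit .pd q) _ ha trivial (Or.inl ⟨rfl, hq⟩) h.root
    · have hr' := (Theory.mem_strictFor.1 hr).1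
      exact h.disj (.lit .pd q) _ ha trivial (Or.inr ⟨r, hr, rfl⟩)
        (h.body_strictly_proved hw hr' fun a ha => hbody hr' ha .plusDelta (hb a ha))
  | minusDelta =>
    refine h.conj (.lit .md q) ha id ⟨.root, Or.inl rfl⟩ ?_
    rintro u (rfl | ⟨rfl, hq⟩ | ⟨r, hr, rfl⟩)
    · exact h.root
    · exact absurd hq hc.1
    · have hr' := (Theory.mem_strictFor.1 hr).1
      obtain ⟨a, ha, hb⟩ := hc.2 r hr
      exact h.body_strictly_refuted hw hr' ⟨a, ha, hbody hr' ha .minusDelta hb⟩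
  | plusPartial =>
    rcases hc with hq | ⟨⟨r, hr, hb⟩, hmd, hs⟩
    · exact h.disj (.lit .pp q) _ ha trivial (Or.inl rfl) (hself .plusDelta hq)
    · refine h.disj (.lit .pp q) _ ha trivial (Or.inr rfl) ?_
      refine h.conj (.lit .ppand q) ha id ⟨.root, Or.inl rfl⟩ ?_
      rintro u (rfl | rfl | rfl | ⟨s, hs', rfl⟩)
      · exact h.root
      · have hr' := (Theory.mem_supportFor.1 hr).1
        exact h.disj (.lit .sup q) _ ha trivial ⟨r, hr, rfl⟩
          (h.body_proved hw hr' fun a ha => hbody hr' ha .plusPartial (hb a ha))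
      · exact hcompl .minusDelta hmd
      · obtain ⟨hs1, hs2⟩ := Theory.mem_rulesFor.1 hs'
        rcases hs s hs' with ⟨a, ha, hb⟩ | ⟨t, ht, hb, hts⟩
        · exact h.disj (.rule .beaten s.label) _ (hw.labels s hs1) trivial (Or.inl rfl)
            (h.body_refuted hw hs1 ⟨a, ha, hbody hs1 ha .minusPartial hb⟩)
        · have ht' := (Theory.mem_supportFor.1 ht).1
          refine h.disj (.rule .beaten s.label) _ (hw.labels s hs1) trivial
            (Or.inr ⟨s, hs1, rfl, t, by rw [hs2]; simpa using ht, hts, rfl⟩)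
            (h.body_proved hw ht' fun a ha => hbody ht' ha .plusPartial (hb a ha))
  | minusPartial =>
    obtain ⟨hmd, hor⟩ := hc
    refine h.conj (.lit .mp q) ha id ⟨.root, Or.inl rfl⟩ ?_
    rintro u (rfl | rfl | rfl)
    · exact h.root
    · exact hself .minusDelta hmd
    · rcases hor with hr | hpd | ⟨s, hs, hb, ht⟩
      · refine h.disj (.lit .mpor q) _ ha trivial (Or.inl rfl) ?_
        refine h.conj (.lit .mpand q) ha id ⟨.root, Or.inl rfl⟩ ?_
        rintro u (rfl | ⟨r, hr', rfl⟩)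
        · exact h.root
        · have hr1 := (Theory.mem_supportFor.1 hr').1
          obtain ⟨a, ha, hb⟩ := hr r hr'
          exact h.body_refuted hw hr1 ⟨a, ha, hbody hr1 ha .minusPartial hb⟩
      · exact h.disj (.lit .mpor q) _ ha trivial (Or.inr (Or.inl rfl)) (hcompl .plusDelta hpd)
      · obtain ⟨hs1, hs2⟩ := Theory.mem_rulesFor.1 hs
        refine h.disj (.lit .mpor q) _ ha trivial (Or.inr (Or.inr ⟨s, hs, rfl⟩)) ?_
        refine h.conj (.rule .win s.label) (hw.labels s hs1) id ⟨.root, Or.inl rfl⟩ ?_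
        rintro u (rfl | rfl | ⟨s', hs', hl, t, ht', hts, rfl⟩)
        · exact h.root
        · exact h.body_proved hw hs1 fun a ha => hbody hs1 ha .plusPartial (hb a ha)
        · obtain rfl := D.label_unique s' hs' s hs1 hl
          rw [hs2, Literal.compl_compl] at ht'
          have ht1 := (Theory.mem_supportFor.1 ht').1
          rcases ht t ht' with ⟨a, ha, hb⟩ | hn
          · exact h.body_refuted hw ht1 ⟨a, ha, hbody ht1 ha .minusPartial hb⟩
          · exact absurd hts hn

/-- Every provable conclusion is reached in the dependency graph. -/
theorem Theory.Closed.of_proves (h : D.Closed w X) (hw : D.WrittenIn w) {c : Conclusion}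
    (hc : D.Proves c) (ha : c.lit.atom ∈ w) : X c.vertex := by
  obtain ⟨P, hP, hc⟩ := hc
  induction hP generalizing c with
  | nil => simp at hc
  | append hP hi ih =>
    rcases List.mem_append.1 hc with hc | hc
    · exact ih ha hc
    · obtain rfl := List.mem_singleton.1 hc
      exact h.of_infers hw hi ha fun c' hc' ha' => ih ha' hc'

end Closed

/-! ### Provability -/

/-- Lines occur only positively in the inference rules; what is negated concerns the theory alone.
-/
theorem Theory.Infers.mono {D : Theory} {P P' : List Conclusion} (hP : ∀ c ∈ P, c ∈ P')
    {c : Conclusion} (h : D.Infers P c) : D.Infers P' c := by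
  obtain ⟨tag, q⟩ := c
  cases tag with
  | plusDelta => exact h.imp_right fun ⟨r, hr, hb⟩ => ⟨r, hr, fun a ha => hP _ (hb a ha)⟩
  | minusDelta =>
    exact ⟨h.1, fun r hr => (h.2 r hr).imp fun a ha => ⟨ha.1, hP _ ha.2⟩⟩
  | plusPartial =>
    refine h.imp (hP _) fun ⟨⟨r, hr, hb⟩, hmd, hs⟩ =>
      ⟨⟨r, hr, fun a ha => hP _ (hb a ha)⟩, hP _ hmd, fun s hs' => (hs s hs').imp ?_ ?_⟩
    · exact fun ⟨a, ha, hb⟩ => ⟨a, ha, hP _ hb⟩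
    · exact fun ⟨t, ht, hb, hts⟩ => ⟨t, ht, fun a ha => hP _ (hb a ha), hts⟩
  | minusPartial =>
    refine ⟨hP _ h.1, h.2.imp ?_ (Or.imp (hP _) ?_)⟩
    · exact fun hr r hr' => (hr r hr').imp fun a ha => ⟨ha.1, hP _ ha.2⟩
    · exact fun ⟨s, hs, hb, ht⟩ => ⟨s, hs, fun a ha => hP _ (hb a ha), fun t ht' =>
        (ht t ht').imp_left fun ⟨a, ha, hb⟩ => ⟨a, ha, hP _ hb⟩⟩

theorem Theory.IsDerivation.concat {D : Theory} {P P' : List Conclusion} (h : D.IsDerivation P)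
    (h' : D.IsDerivation P') : D.IsDerivation (P ++ P') := by
  induction h' with
  | nil => simpa using h
  | append hP hi ih =>
    rw [← List.append_assoc]
    exact ih.append (hi.mono fun c hc => List.mem_append_right _ hc)

/-- One derivation for each provable member of the finite list, all of them concatenated. -/
theorem Theory.exists_derivation (D : Theory) (F : List Conclusion) :
    ∃ P, D.IsDerivation P ∧ ∀ c ∈ F, D.Proves c → c ∈ P := by
  induction F with
  | nil => exact ⟨[], .nil, by simp⟩
  | cons c F ih =>
    obtain ⟨P, hP, hF⟩ := ih
    by_cases hc : D.Proves c
    · obtain ⟨P', hP', hc'⟩ := hc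
      refine ⟨P ++ P', hP.concat hP', fun d hd hp => ?_⟩
      rcases List.mem_cons.1 hd with rfl | hd
      · exact List.mem_append_right _ hc'
      · exact List.mem_append_left _ (hF d hd hp)
    · refine ⟨P, hP, fun d hd hp => ?_⟩
      rcases List.mem_cons.1 hd with rfl | hd
      · exact absurd hp hc
      · exact hF d hd hp

/-- For each literal `q` there is a derivation that contains every provable conclusion about `q`,
its complement and the literals in the bodies of the rules. -/
theorem Theory.exists_saturated (D : Theory) (q : Literal) :
    ∃ P, D.IsDerivation P ∧ ∀ t, (D.Proves ⟨t, q⟩ → ⟨t, q⟩ ∈ P) ∧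
      (D.Proves ⟨t, q.compl⟩ → ⟨t, q.compl⟩ ∈ P) ∧
      ∀ r ∈ D.rules, ∀ a ∈ r.body, D.Proves ⟨t, a⟩ → ⟨t, a⟩ ∈ P := by
  obtain ⟨P, hP, hF⟩ := D.exists_derivation
    ((q :: q.compl :: D.literals.toList).flatMap fun a =>
      [⟨.plusDelta, a⟩, ⟨.minusDelta, a⟩, ⟨.plusPartial, a⟩, ⟨.minusPartial, a⟩])
  have key : ∀ t, ∀ a ∈ q :: q.compl :: D.literals.toList, D.Proves ⟨t, a⟩ → ⟨t, a⟩ ∈ P :=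
    fun t a ha => hF _ (List.mem_flatMap.2 ⟨a, ha, by cases t <;> simp⟩)
  refine ⟨P, hP, fun t => ⟨key t _ (by simp), key t _ (by simp), fun r hr a ha => key t a ?_⟩⟩
  simp only [List.mem_cons, Finset.mem_toList, Theory.literals, Finset.mem_union,
    Finset.mem_biUnion]
  exact Or.inr (Or.inr (Or.inr ⟨r, hr, by simp [ha]⟩))

theorem Theory.IsDerivation.proves {D : Theory} {P : List Conclusion} (hP : D.IsDerivation P)
    {c : Conclusion} (h : D.Infers P c) : D.Proves c :=
  ⟨P ++ [c], hP.append h, by simp⟩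

/-- What the vertices of the dependency graph say. -/
def Theory.Holds (D : Theory) : Vertex → Prop
  | .root => True
  | .dead => False
  | .lit .pd q => D.Proves ⟨.plusDelta, q⟩
  | .lit .md q => D.Proves ⟨.minusDelta, q⟩
  | .lit .pp q => D.Proves ⟨.plusPartial, q⟩
  | .lit .mp q => D.Proves ⟨.minusPartial, q⟩
  | .lit .sup q => ∃ r ∈ D.supportFor q, ∀ a ∈ r.body, D.Proves ⟨.plusPartial, a⟩
  | .lit .ppand q => (∃ r ∈ D.supportFor q, ∀ a ∈ r.body, D.Proves ⟨.plusPartial, a⟩) ∧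
      D.Proves ⟨.minusDelta, q.compl⟩ ∧ ∀ s ∈ D.rulesFor q.compl,
        (∃ a ∈ s.body, D.Proves ⟨.minusPartial, a⟩) ∨
        ∃ t ∈ D.supportFor q, (∀ a ∈ t.body, D.Proves ⟨.plusPartial, a⟩) ∧ (t, s) ∈ D.sup
  | .lit .mpand q => ∀ r ∈ D.supportFor q, ∃ a ∈ r.body, D.Proves ⟨.minusPartial, a⟩
  | .lit .mpor q => (∀ r ∈ D.supportFor q, ∃ a ∈ r.body, D.Proves ⟨.minusPartial, a⟩) ∨
      D.Proves ⟨.plusDelta, q.compl⟩ ∨ ∃ s ∈ D.rulesFor q.compl,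
        (∀ a ∈ s.body, D.Proves ⟨.plusPartial, a⟩) ∧ ∀ t ∈ D.supportFor q,
          (∃ a ∈ t.body, D.Proves ⟨.minusPartial, a⟩) ∨ (t, s) ∉ D.sup
  -- Vacuous at a number that is not a label; no edge joins such a vertex to a literal. For a label
  -- there is exactly one such rule.
  | .rule .sd l => ∀ r ∈ D.rules, r.label = l → ∀ a ∈ r.body, D.Proves ⟨.plusDelta, a⟩
  | .rule .fd l => ∀ r ∈ D.rules, r.label = l → ∃ a ∈ r.body, D.Proves ⟨.minusDelta, a⟩
  | .rule .sp l => ∀ r ∈ D.rules, r.label = l → ∀ a ∈ r.body, D.Proves ⟨.plusPartial, a⟩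
  | .rule .fp l => ∀ r ∈ D.rules, r.label = l → ∃ a ∈ r.body, D.Proves ⟨.minusPartial, a⟩
  | .rule .beaten l => ∀ s ∈ D.rules, s.label = l →
      (∃ a ∈ s.body, D.Proves ⟨.minusPartial, a⟩) ∨
      ∃ t ∈ D.supportFor s.head.compl, (∀ a ∈ t.body, D.Proves ⟨.plusPartial, a⟩) ∧ (t, s) ∈ D.sup
  | .rule .win l => ∀ s ∈ D.rules, s.label = l →
      (∀ a ∈ s.body, D.Proves ⟨.plusPartial, a⟩) ∧ ∀ t ∈ D.supportFor s.head.compl,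
        (∃ a ∈ t.body, D.Proves ⟨.minusPartial, a⟩) ∨ (t, s) ∉ D.sup
  | .occ a => a ∈ D.atoms

/-- This and the next three results let provability replace membership in the inference rules: in a
saturated derivation every provable premise is a line, so the rule can be applied to it. -/
theorem Theory.proves_plusDelta {D : Theory} {q : Literal}
    (h : q ∈ D.facts ∨ ∃ r ∈ D.strictFor q, ∀ a ∈ r.body, D.Proves ⟨.plusDelta, a⟩) :
    D.Proves ⟨.plusDelta, q⟩ := by
  obtain ⟨P, hP, hs⟩ := D.exists_saturated q
  refine hP.proves (h.imp_right fun ⟨r, hr, hb⟩ => ⟨r, hr, fun a ha => ?_⟩)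
  exact (hs _).2.2 r (Theory.mem_strictFor.1 hr).1 a ha (hb a ha)

theorem Theory.proves_minusDelta {D : Theory} {q : Literal} (h : q ∉ D.facts)
    (h' : ∀ r ∈ D.strictFor q, ∃ a ∈ r.body, D.Proves ⟨.minusDelta, a⟩) :
    D.Proves ⟨.minusDelta, q⟩ := by
  obtain ⟨P, hP, hs⟩ := D.exists_saturated q
  refine hP.proves ⟨h, fun r hr => (h' r hr).imp fun a ha => ⟨ha.1, ?_⟩⟩
  exact (hs _).2.2 r (Theory.mem_strictFor.1 hr).1 a ha.1 ha.2

theorem Theory.proves_plusPartial {D : Theory} {q : Literal}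
    (h : D.Proves ⟨.plusDelta, q⟩ ∨ D.Holds (.lit .ppand q)) : D.Proves ⟨.plusPartial, q⟩ := by
  obtain ⟨P, hP, hs⟩ := D.exists_saturated q
  refine hP.proves (h.imp (hs _).1 fun ⟨⟨r, hr, hb⟩, hmd, hs'⟩ =>
    ⟨⟨r, hr, fun a ha => ?_⟩, (hs _).2.1 hmd, fun s hs1 => (hs' s hs1).imp ?_ ?_⟩)
  · exact (hs _).2.2 r (Theory.mem_supportFor.1 hr).1 a ha (hb a ha)
  · exact fun ⟨a, ha, hb⟩ => ⟨a, ha, (hs _).2.2 s (Theory.mem_rulesFor.1 hs1).1 a ha hb⟩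
  · exact fun ⟨t, ht, hb, hts⟩ => ⟨t, ht, fun a ha =>
      (hs _).2.2 t (Theory.mem_supportFor.1 ht).1 a ha (hb a ha), hts⟩

theorem Theory.proves_minusPartial {D : Theory} {q : Literal} (h : D.Proves ⟨.minusDelta, q⟩)
    (h' : D.Holds (.lit .mpor q)) : D.Proves ⟨.minusPartial, q⟩ := by
  obtain ⟨P, hP, hs⟩ := D.exists_saturated q
  refine hP.proves ⟨(hs _).1 h, h'.imp ?_ (Or.imp (hs _).2.1 ?_)⟩
  · exact fun hr r hr' => (hr r hr').imp fun a ha =>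
      ⟨ha.1, (hs _).2.2 r (Theory.mem_supportFor.1 hr').1 a ha.1 ha.2⟩
  · exact fun ⟨s, hs1, hb, ht⟩ => ⟨s, hs1, fun a ha =>
      (hs _).2.2 s (Theory.mem_rulesFor.1 hs1).1 a ha (hb a ha), fun t ht' =>
        (ht t ht').imp_left fun ⟨a, ha, hb⟩ =>
          ⟨a, ha, (hs _).2.2 t (Theory.mem_supportFor.1 ht').1 a ha hb⟩⟩

/-- What is reached in the dependency graph holds. -/
theorem Theory.closed_holds (D : Theory) (w : List ℕ) : D.Closed w D.Holds where
  root := trivial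
  disj := by
    intro v u _ hv hu hX
    match v, hv with
    | .lit .pd q, _ =>
      refine D.proves_plusDelta ?_
      rcases hu with ⟨rfl, hq⟩ | ⟨r, hr, rfl⟩
      · exact Or.inl hq
      · exact Or.inr ⟨r, hr, hX r (Theory.mem_strictFor.1 hr).1 rfl⟩
    | .lit .pp q, _ =>
      refine D.proves_plusPartial ?_
      rcases hu with rfl | rfl
      · exact Or.inl hX
      · exact Or.inr hX
    | .lit .sup q, _ =>
      obtain ⟨r, hr, rfl⟩ := hu
      exact ⟨r, hr, hX r (Theory.mem_supportFor.1 hr).1 rfl⟩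
    | .lit .mpor q, _ =>
      rcases hu with rfl | rfl | ⟨s, hs, rfl⟩
      · exact Or.inl hX
      · exact Or.inr (Or.inl hX)
      · obtain ⟨hs1, hs2⟩ := Theory.mem_rulesFor.1 hs
        have := hX s hs1 rfl
        rw [hs2, Literal.compl_compl] at this
        exact Or.inr (Or.inr ⟨s, hs, this⟩)
    | .rule .fd l, _ =>
      obtain ⟨r, hr, rfl, a, ha, rfl⟩ := hu
      exact fun r' hr' hl => ⟨a, D.label_unique r' hr' r hr hl ▸ ha, hX⟩
    | .rule .fp l, _ =>
      obtain ⟨r, hr, rfl, a, ha, rfl⟩ := hu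
      exact fun r' hr' hl => ⟨a, D.label_unique r' hr' r hr hl ▸ ha, hX⟩
    | .rule .beaten l, _ =>
      intro s hs hl
      rcases hu with rfl | ⟨s', hs', hl', t, ht, hts, rfl⟩
      · exact Or.inl (hX s hs hl)
      · obtain rfl := D.label_unique s hs s' hs' (hl.trans hl'.symm)
        exact Or.inr ⟨t, ht, hX t (Theory.mem_supportFor.1 ht).1 rfl, hts⟩
    | .occ a, _ => exact hu.2
  conj := by
    intro v _ hv he hX
    match v, hv with
    | .root, _ => trivial
    -- No edge enters `dead`, so closedness does not require it.
    | .dead, _ => exact he.elim fun _ h => h.elim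
    | .lit .md q, _ =>
      -- If `q` were a fact, `dead` would be among the premises, but its meaning is false.
      refine D.proves_minusDelta (fun hq => hX .dead (Or.inr (Or.inl ⟨rfl, hq⟩))) fun r hr => ?_
      exact hX _ (Or.inr (Or.inr ⟨r, hr, rfl⟩)) r (Theory.mem_strictFor.1 hr).1 rfl
    | .lit .mp q, _ =>
      exact D.proves_minusPartial (hX _ (Or.inr (Or.inl rfl))) (hX _ (Or.inr (Or.inr rfl)))
    | .lit .ppand q, _ =>
      refine ⟨hX _ (Or.inr (Or.inl rfl)), hX _ (Or.inr (Or.inr (Or.inl rfl))), fun s hs => ?_⟩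
      obtain ⟨hs1, hs2⟩ := Theory.mem_rulesFor.1 hs
      have := hX _ (Or.inr (Or.inr (Or.inr ⟨s, hs, rfl⟩))) s hs1 rfl
      rw [hs2, Literal.compl_compl] at this
      exact this
    | .lit .mpand q, _ =>
      exact fun r hr => hX _ (Or.inr ⟨r, hr, rfl⟩) r (Theory.mem_supportFor.1 hr).1 rfl
    | .rule .sd l, _ =>
      exact fun r hr hl a ha => hX _ (Or.inr ⟨r, hr, hl, a, ha, rfl⟩)
    | .rule .sp l, _ =>
      exact fun r hr hl a ha => hX _ (Or.inr ⟨r, hr, hl, a, ha, rfl⟩)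
    | .rule .win l, _ =>
      refine fun s hs hl => ⟨hX _ (Or.inr (Or.inl rfl)) s hs hl, fun t ht => ?_⟩
      by_cases hts : (t, s) ∈ D.sup
      · exact Or.inl (hX _ (Or.inr (Or.inr ⟨s, hs, hl, t, ht, hts, rfl⟩)) t
          (Theory.mem_supportFor.1 ht).1 rfl)
      · exact Or.inr hts
    | .lit .pd _, hv | .lit .pp _, hv | .lit .sup _, hv | .lit .mpor _, hv | .rule .fd _, hv
    | .rule .fp _, hv | .rule .beaten _, hv | .occ _, hv => exact absurd trivial hv

theorem Theory.holds_vertex (D : Theory) (c : Conclusion) : D.Holds c.vertex ↔ D.Proves c := by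
  obtain ⟨t, q⟩ := c
  cases t <;> rfl

end DefeasibleLogic

namespace DefeasibleLogic

/-! ### Numbering the dependency graph -/

def LitKind.idx : LitKind → ℕ
  | .pd => 0
  | .md => 1
  | .pp => 2
  | .mp => 3
  | .sup => 4
  | .ppand => 5
  | .mpand => 6
  | .mpor => 7

def RuleKind.idx : RuleKind → ℕ
  | .sd => 0
  | .fd => 1
  | .sp => 2
  | .fp => 3
  | .beaten => 4
  | .win => 5

/-- The number of the first vertex of a literal, if the vertices named by `x` start at `base x`. -/
def litId (base : ℕ → ℕ) (q : Literal) : ℕ := base q.atom + if q.positive then 0 else 8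

/-- Layout of a block: eight vertices for the positive literal, eight for the negative one, six for
a rule, one for `occ`, in all `23`. A number may be both an atom and a label, so its block has room
for both. -/
def Vertex.id (base : ℕ → ℕ) : Vertex → ℕ
  | .root => 0
  | .dead => 1
  | .lit k q => litId base q + k.idx
  | .rule k l => base l + (16 + k.idx)
  | .occ a => base a + 22

/-- The blocks of `23` numbers that start at `base x`, for `x` in `w`, are disjoint. -/
structure Allocates (w : List ℕ) (base : ℕ → ℕ) : Prop where
  two_le : ∀ x ∈ w, 2 ≤ base x
  disjoint : ∀ x ∈ w, ∀ y ∈ w, x ≠ y → base x + 23 ≤ base y ∨ base y + 23 ≤ base x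

theorem LitKind.idx_lt (k : LitKind) : k.idx < 8 := by cases k <;> decide

theorem RuleKind.idx_lt (k : RuleKind) : k.idx < 6 := by cases k <;> decide

theorem LitKind.idx_injective : Function.Injective LitKind.idx := by
  intro k k'
  cases k <;> cases k' <;> simp [LitKind.idx]

theorem RuleKind.idx_injective : Function.Injective RuleKind.idx := by
  intro k k'
  cases k <;> cases k' <;> simp [RuleKind.idx]

section Numbering

variable {w : List ℕ} {base : ℕ → ℕ}

theorem Allocates.eq (h : Allocates w base) {x y i j : ℕ} (hx : x ∈ w) (hy : y ∈ w) (hi : i < 23)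
    (hj : j < 23) (he : base x + i = base y + j) : x = y ∧ i = j := by
  by_cases hxy : x = y
  · subst hxy
    exact ⟨rfl, by omega⟩
  · have := h.disjoint x hx y hy hxy
    omega

theorem litId_eq (base : ℕ → ℕ) (q : Literal) (k : ℕ) :
    litId base q + k = base q.atom + ((if q.positive then 0 else 8) + k) := by
  rw [litId, Nat.add_assoc]

/-- A block and an offset determine a vertex, and `0` and `1` lie below all blocks. Nothing is known
about `base` outside `w`, hence the restriction to known vertices. -/
theorem Vertex.id_inj (h : Allocates w base) {u v : Vertex} (hu : u.Known w) (hv : v.Known w)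
    (he : u.id base = v.id base) : u = v := by
  have hlt : ∀ (q : Literal) (k : LitKind), (if q.positive then 0 else 8) + k.idx < 16 := by
    intro q k
    have := k.idx_lt
    split_ifs <;> omega
  cases u <;> cases v <;> simp only [Vertex.id, Vertex.Known, litId_eq] at hu hv he
  case root.root => rfl
  case dead.dead => rfl
  case lit.lit k q k' q' =>
    obtain ⟨h1, h2⟩ := h.eq hu hv (by have := hlt q k; omega) (by have := hlt q' k'; omega) he
    obtain ⟨a, p⟩ := q
    obtain ⟨a', p'⟩ := q'
    have := k.idx_lt
    have := k'.idx_lt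
    obtain rfl : p = p' := by cases p <;> cases p' <;> simp at h2 ⊢ <;> omega
    have h1 : a = a' := h1
    rw [h1, LitKind.idx_injective (Nat.add_left_cancel h2)]
  case rule.rule k l k' l' =>
    have := k.idx_lt
    have := k'.idx_lt
    obtain ⟨h1, h2⟩ := h.eq hu hv (by omega) (by omega) he
    rw [h1, RuleKind.idx_injective (Nat.add_left_cancel h2)]
  case occ.occ a a' =>
    rw [(h.eq hu hv (by omega) (by omega) he).1]
  case lit.rule k q k' l' =>
    have := hlt q k
    have := k'.idx_lt
    have := h.eq hu hv (by omega) (by omega) he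
    omega
  case rule.lit k' l' k q =>
    have := hlt q k
    have := k'.idx_lt
    have := h.eq hu hv (by omega) (by omega) he
    omega
  case lit.occ k q a =>
    have := hlt q k
    have := h.eq hu hv (by omega) (by omega) he
    omega
  case occ.lit a k q =>
    have := hlt q k
    have := h.eq hu hv (by omega) (by omega) he
    omega
  case rule.occ k l a =>
    have := k.idx_lt
    have := h.eq hu hv (by omega) (by omega) he
    omega
  case occ.rule a k l =>
    have := k.idx_lt
    have := h.eq hu hv (by omega) (by omega) he
    omega
  all_goals first
    | omega
    | (have := h.two_le _ hu; omega)
    | (have := h.two_le _ hv; omega)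

theorem Vertex.two_le_id (h : Allocates w base) {v : Vertex} (hv : v.Known w) (h0 : v ≠ .root)
    (h1 : v ≠ .dead) : 2 ≤ v.id base := by
  cases v with
  | root => exact absurd rfl h0
  | dead => exact absurd rfl h1
  | lit k q => have := h.two_le _ hv; simp only [Vertex.id, litId]; omega
  | rule k l => have := h.two_le _ hv; simp only [Vertex.id]; omega
  | occ a => have := h.two_le _ hv; simp only [Vertex.id]; omega

end Numbering

/-! ### Listing the dependency graph -/

/-- The disjunctive vertices that are named by `x`. -/
def disjVertices (x : ℕ) : List Vertex :=
  [.lit .pd ⟨x, true⟩, .lit .pp ⟨x, true⟩, .lit .sup ⟨x, true⟩, .lit .mpor ⟨x, true⟩,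
    .lit .pd ⟨x, false⟩, .lit .pp ⟨x, false⟩, .lit .sup ⟨x, false⟩, .lit .mpor ⟨x, false⟩,
    .rule .fd x, .rule .fp x, .rule .beaten x, .occ x]

/-- The edges to the vertices of `q` that do not depend on the theory, source first. -/
def literalEdges (q : Literal) : List (Vertex × Vertex) :=
  [(.root, .lit .md q), (.root, .lit .mp q), (.root, .lit .ppand q), (.root, .lit .mpand q),
    (.lit .pd q, .lit .pp q), (.lit .ppand q, .lit .pp q), (.lit .md q, .lit .mp q),
    (.lit .mpor q, .lit .mp q), (.lit .sup q, .lit .ppand q), (.lit .md q.compl, .lit .ppand q),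
    (.lit .mpand q, .lit .mpor q), (.lit .pd q.compl, .lit .mpor q)]

/-- The edges to the vertices of a rule that depend only on its label. -/
def labelEdges (l : ℕ) : List (Vertex × Vertex) :=
  [(.root, .rule .sd l), (.root, .rule .sp l), (.root, .rule .win l),
    (.rule .fp l, .rule .beaten l), (.rule .sp l, .rule .win l)]

/-- These edges are added for each entry of the input, before it is known which entries are atoms
and which are labels. -/
def nameEdges (x : ℕ) : List (Vertex × Vertex) :=
  literalEdges ⟨x, true⟩ ++ (literalEdges ⟨x, false⟩ ++ labelEdges x)

def factEdges (q : Literal) : List (Vertex × Vertex) :=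
  [(.root, .lit .pd q), (.dead, .lit .md q), (.root, .occ q.atom)]

def bodyEdges (l : ℕ) (a : Literal) : List (Vertex × Vertex) :=
  [(.lit .pd a, .rule .sd l), (.lit .md a, .rule .fd l), (.lit .pp a, .rule .sp l),
    (.lit .mp a, .rule .fp l), (.root, .occ a.atom)]

def headEdges (r : Rule) : List (Vertex × Vertex) :=
  [(.rule .beaten r.label, .lit .ppand r.head.compl),
    (.rule .win r.label, .lit .mpor r.head.compl), (.root, .occ r.head.atom)]

def strictEdges (r : Rule) : List (Vertex × Vertex) :=
  if r.arrow = .strict then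
    [(.rule .sd r.label, .lit .pd r.head), (.rule .fd r.label, .lit .md r.head)]
  else []

def supportEdges (r : Rule) : List (Vertex × Vertex) :=
  if r.arrow = .defeater then []
  else [(.rule .sp r.label, .lit .sup r.head), (.rule .fp r.label, .lit .mpand r.head)]

/-- The edges for a rule whose body is listed as `b`. -/
def ruleEdges (r : Rule) (b : List Literal) : List (Vertex × Vertex) :=
  b.flatMap (bodyEdges r.label) ++ (supportEdges r ++ (strictEdges r ++ headEdges r))

def supEdges (p : Rule × Rule) : List (Vertex × Vertex) :=
  if p.1.arrow ≠ .defeater ∧ p.1.head.compl = p.2.head then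
    [(.rule .sp p.1.label, .rule .beaten p.2.label), (.rule .fp p.1.label, .rule .win p.2.label)]
  else []

/-- All edges of the dependency graph. -/
def graphEdges (w : List ℕ) (fs : List Literal) (rs : List Rule) (body : Rule → List Literal)
    (ss : List (Rule × Rule)) : List (Vertex × Vertex) :=
  ss.flatMap supEdges ++ (rs.flatMap (fun r => ruleEdges r (body r)) ++
    (fs.flatMap factEdges ++ w.flatMap nameEdges))

theorem mem_disjVertices {w : List ℕ} {v : Vertex} :
    v ∈ w.flatMap disjVertices ↔ v.Known w ∧ v.IsDisj := by
  simp only [List.mem_flatMap]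
  constructor
  · rintro ⟨x, hx, hv⟩
    simp only [disjVertices, List.mem_cons, List.not_mem_nil, or_false] at hv
    rcases hv with rfl | rfl | rfl | rfl | rfl | rfl | rfl | rfl | rfl | rfl | rfl | rfl <;>
      exact ⟨hx, trivial⟩
  · rintro ⟨hk, hd⟩
    match v, hk, hd with
    | .lit .pd ⟨x, p⟩, hk, _ | .lit .pp ⟨x, p⟩, hk, _ | .lit .sup ⟨x, p⟩, hk, _
    | .lit .mpor ⟨x, p⟩, hk, _ =>
      exact ⟨x, hk, by cases p <;> simp [disjVertices]⟩
    | .rule .fd x, hk, _ | .rule .fp x, hk, _ | .rule .beaten x, hk, _ | .occ x, hk, _ =>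
      exact ⟨x, hk, by simp [disjVertices]⟩

theorem mem_literalEdges_of_mem {w : List ℕ} {q : Literal} (hq : q.atom ∈ w)
    {e : Vertex × Vertex} (he : e ∈ literalEdges q) : e ∈ w.flatMap nameEdges := by
  refine List.mem_flatMap.2 ⟨q.atom, hq, ?_⟩
  obtain ⟨a, p⟩ := q
  cases p
  · exact List.mem_append_right _ (List.mem_append_left _ he)
  · exact List.mem_append_left _ he

/-- Membership is all that is needed. An edge may be listed repeatedly, as numbers recur in `w`; a
repetition raises the threshold of a conjunction, but it is also followed as often. -/
theorem mem_graphEdges {D : Theory} {w : List ℕ} (hw : D.WrittenIn w) {fs : List Literal}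
    {rs : List Rule} {body : Rule → List Literal} {ss : List (Rule × Rule)}
    (hfs : Lists fs D.facts) (hrs : Lists rs D.rules) (hb : ∀ r ∈ D.rules, Lists (body r) r.body)
    (hss : Lists ss D.sup) (u v : Vertex) :
    (u, v) ∈ graphEdges w fs rs body ss ↔ v.Known w ∧ D.Edge v u := by
  have hf : ∀ q, q ∈ fs ↔ q ∈ D.facts := fun q => by rw [← hfs.2, List.mem_toFinset]
  have hr : ∀ r, r ∈ rs ↔ r ∈ D.rules := fun r => by rw [← hrs.2, List.mem_toFinset]
  have hs : ∀ p, p ∈ ss ↔ p ∈ D.sup := fun p => by rw [← hss.2, List.mem_toFinset]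
  have hbd : ∀ r ∈ D.rules, ∀ a, a ∈ body r ↔ a ∈ r.body := fun r h a => by
    rw [← (hb r h).2, List.mem_toFinset]
  simp only [graphEdges, List.mem_append, List.mem_flatMap]
  constructor
  · rintro (⟨⟨t, s⟩, hp, he⟩ | ⟨r, hr', he⟩ | ⟨q, hq, he⟩ | ⟨x, hx, he⟩)
    · rw [hs] at hp
      obtain ⟨ht, hs'⟩ := D.sup_on_rules _ hp
      simp only [supEdges] at he
      split_ifs at he with hc
      · have hsup : t ∈ D.supportFor s.head.compl := by
          rw [Theory.mem_supportFor, ← hc.2, Literal.compl_compl]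
          refine ⟨ht, rfl, ?_⟩
          cases hta : t.arrow <;> simp_all
        simp only [List.mem_cons, List.not_mem_nil, or_false, Prod.mk.injEq] at he
        rcases he with ⟨rfl, rfl⟩ | ⟨rfl, rfl⟩
        · exact ⟨hw.labels s hs', Or.inr ⟨s, hs', rfl, t, hsup, hp, rfl⟩⟩
        · exact ⟨hw.labels s hs', Or.inr (Or.inr ⟨s, hs', rfl, t, hsup, hp, rfl⟩)⟩
      · simp at he
    · rw [hr] at hr'
      have hl := hw.labels r hr'
      have hh := hw.atoms _ (D.head_mem_atoms hr')
      simp only [ruleEdges, List.mem_append, List.mem_flatMap] at he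
      rcases he with ⟨a, ha, he⟩ | he | he | he
      · rw [hbd r hr'] at ha
        have haw := D.body_mem_atoms hr' ha
        simp only [bodyEdges, List.mem_cons, List.not_mem_nil, or_false, Prod.mk.injEq] at he
        rcases he with ⟨rfl, rfl⟩ | ⟨rfl, rfl⟩ | ⟨rfl, rfl⟩ | ⟨rfl, rfl⟩ | ⟨rfl, rfl⟩
        · exact ⟨hl, Or.inr ⟨r, hr', rfl, a, ha, rfl⟩⟩
        · exact ⟨hl, r, hr', rfl, a, ha, rfl⟩
        · exact ⟨hl, Or.inr ⟨r, hr', rfl, a, ha, rfl⟩⟩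
        · exact ⟨hl, r, hr', rfl, a, ha, rfl⟩
        · exact ⟨hw.atoms _ haw, rfl, haw⟩
      · simp only [supportEdges] at he
        split_ifs at he with hc
        · simp at he
        · have hsup : r ∈ D.supportFor r.head := by
            rw [Theory.mem_supportFor]
            refine ⟨hr', rfl, ?_⟩
            cases hta : r.arrow <;> simp_all
          simp only [List.mem_cons, List.not_mem_nil, or_false, Prod.mk.injEq] at he
          rcases he with ⟨rfl, rfl⟩ | ⟨rfl, rfl⟩
          · exact ⟨hh, r, hsup, rfl⟩
          · exact ⟨hh, Or.inr ⟨r, hsup, rfl⟩⟩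
      · simp only [strictEdges] at he
        split_ifs at he with hc
        · have hsup : r ∈ D.strictFor r.head := Theory.mem_strictFor.2 ⟨hr', rfl, hc⟩
          simp only [List.mem_cons, List.not_mem_nil, or_false, Prod.mk.injEq] at he
          rcases he with ⟨rfl, rfl⟩ | ⟨rfl, rfl⟩
          · exact ⟨hh, Or.inr ⟨r, hsup, rfl⟩⟩
          · exact ⟨hh, Or.inr (Or.inr ⟨r, hsup, rfl⟩)⟩
        · simp at he
      · have hsup : r ∈ D.rulesFor r.head.compl.compl :=
          Theory.mem_rulesFor.2 ⟨hr', (Literal.compl_compl _).symm⟩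
        simp only [headEdges, List.mem_cons, List.not_mem_nil, or_false, Prod.mk.injEq] at he
        rcases he with ⟨rfl, rfl⟩ | ⟨rfl, rfl⟩ | ⟨rfl, rfl⟩
        · exact ⟨hh, Or.inr (Or.inr (Or.inr ⟨r, hsup, rfl⟩))⟩
        · exact ⟨hh, Or.inr (Or.inr ⟨r, hsup, rfl⟩)⟩
        · exact ⟨hh, rfl, D.head_mem_atoms hr'⟩
    · rw [hf] at hq
      have hqa := D.fact_mem_atoms hq
      have hqw := hw.atoms _ hqa
      simp only [factEdges, List.mem_cons, List.not_mem_nil, or_false, Prod.mk.injEq] at he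
      rcases he with ⟨rfl, rfl⟩ | ⟨rfl, rfl⟩ | ⟨rfl, rfl⟩
      · exact ⟨hqw, Or.inl ⟨rfl, hq⟩⟩
      · exact ⟨hqw, Or.inr (Or.inl ⟨rfl, hq⟩)⟩
      · exact ⟨hqw, rfl, hqa⟩
    · have hlit : ∀ q : Literal, q.atom ∈ w → (u, v) ∈ literalEdges q →
          v.Known w ∧ D.Edge v u := by
        intro q hq he
        simp only [literalEdges, List.mem_cons, List.not_mem_nil, or_false, Prod.mk.injEq] at he
        rcases he with ⟨rfl, rfl⟩ | ⟨rfl, rfl⟩ | ⟨rfl, rfl⟩ | ⟨rfl, rfl⟩ | ⟨rfl, rfl⟩ |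
          ⟨rfl, rfl⟩ | ⟨rfl, rfl⟩ | ⟨rfl, rfl⟩ | ⟨rfl, rfl⟩ | ⟨rfl, rfl⟩ | ⟨rfl, rfl⟩ |
          ⟨rfl, rfl⟩ <;> exact ⟨hq, by simp [Theory.Edge]⟩
      simp only [nameEdges, List.mem_append] at he
      rcases he with he | he | he
      · exact hlit _ (by exact hx) he
      · exact hlit _ (by exact hx) he
      · simp only [labelEdges, List.mem_cons, List.not_mem_nil, or_false, Prod.mk.injEq] at he
        rcases he with ⟨rfl, rfl⟩ | ⟨rfl, rfl⟩ | ⟨rfl, rfl⟩ | ⟨rfl, rfl⟩ | ⟨rfl, rfl⟩ <;>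
          exact ⟨hx, by simp [Theory.Edge]⟩
  · rintro ⟨hv, he⟩
    simp only [← List.mem_flatMap (f := nameEdges)]
    have hlit : ∀ q : Literal, q.atom ∈ w → (u, v) ∈ literalEdges q →
        (u, v) ∈ w.flatMap nameEdges := fun q hq he => mem_literalEdges_of_mem hq he
    have hlab : ∀ l ∈ w, (u, v) ∈ labelEdges l → (u, v) ∈ w.flatMap nameEdges :=
      fun l hl he => List.mem_flatMap.2 ⟨l, hl, by simp [nameEdges, he]⟩
    have hrule : ∀ r ∈ D.rules, (u, v) ∈ ruleEdges r (body r) →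
        ∃ r ∈ rs, (u, v) ∈ ruleEdges r (body r) := fun r h he => ⟨r, (hr r).2 h, he⟩
    have hbody : ∀ r ∈ D.rules, ∀ a ∈ r.body, (u, v) ∈ bodyEdges r.label a →
        ∃ r ∈ rs, (u, v) ∈ ruleEdges r (body r) := fun r h a ha he =>
      hrule r h (List.mem_append_left _ (List.mem_flatMap.2 ⟨a, (hbd r h a).2 ha, he⟩))
    have hsupp : ∀ r : Rule, r.arrow = .strict ∨ r.arrow = .defeasible → r.arrow ≠ .defeater := by
      rintro r (h | h) <;> simp [h]
    have hsup' : ∀ s ∈ D.rules, ∀ t ∈ D.supportFor s.head.compl, (t, s) ∈ D.sup →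
        ∃ p ∈ ss, supEdges p = [(.rule .sp t.label, .rule .beaten s.label),
          (.rule .fp t.label, .rule .win s.label)] := by
      intro s _ t ht hts
      obtain ⟨h1, h2, h3⟩ := Theory.mem_supportFor.1 ht
      refine ⟨(t, s), (hs _).2 hts, ?_⟩
      rw [supEdges, if_pos ⟨hsupp t h3, by simp [h2]⟩]
    have hocc : ∀ a ∈ D.atoms, v = .occ a → u = .root →
        (∃ r ∈ rs, (u, v) ∈ ruleEdges r (body r)) ∨ ∃ q ∈ fs, (u, v) ∈ factEdges q := by
      rintro a ha rfl rfl
      simp only [Theory.atoms, Finset.mem_image, Theory.literals, Finset.mem_union,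
        Finset.mem_biUnion, Finset.mem_insert] at ha
      obtain ⟨q, hq | ⟨r, hr', rfl | ha⟩, rfl⟩ := ha
      · exact Or.inr ⟨q, (hf q).2 hq, by simp [factEdges]⟩
      · exact Or.inl (hrule r hr' (by simp [ruleEdges, headEdges]))
      · exact Or.inl (hbody r hr' q ha (by simp [bodyEdges]))
    match v, he with
    | .lit .pd q, he =>
      rcases he with ⟨rfl, hq⟩ | ⟨r, hr', rfl⟩
      · exact Or.inr (Or.inr (Or.inl ⟨q, (hf q).2 hq, by simp [factEdges]⟩))
      · obtain ⟨h1, rfl, h3⟩ := Theory.mem_strictFor.1 hr'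
        exact Or.inr (Or.inl (hrule r h1 (by simp [ruleEdges, strictEdges, h3])))
    | .lit .md q, he =>
      rcases he with rfl | ⟨rfl, hq⟩ | ⟨r, hr', rfl⟩
      · exact Or.inr (Or.inr (Or.inr (hlit q hv (by simp [literalEdges]))))
      · exact Or.inr (Or.inr (Or.inl ⟨q, (hf q).2 hq, by simp [factEdges]⟩))
      · obtain ⟨h1, rfl, h3⟩ := Theory.mem_strictFor.1 hr'
        exact Or.inr (Or.inl (hrule r h1 (by simp [ruleEdges, strictEdges, h3])))
    | .lit .pp q, he =>
      rcases he with rfl | rfl <;>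
        exact Or.inr (Or.inr (Or.inr (hlit q hv (by simp [literalEdges]))))
    | .lit .mp q, he =>
      rcases he with rfl | rfl | rfl <;>
        exact Or.inr (Or.inr (Or.inr (hlit q hv (by simp [literalEdges]))))
    | .lit .sup q, he =>
      obtain ⟨r, hr', rfl⟩ := he
      obtain ⟨h1, rfl, h3⟩ := Theory.mem_supportFor.1 hr'
      exact Or.inr (Or.inl (hrule r h1 (by simp [ruleEdges, supportEdges, hsupp r h3])))
    | .lit .ppand q, he =>
      rcases he with rfl | rfl | rfl | ⟨s, hs', rfl⟩
      iterate 3 exact Or.inr (Or.inr (Or.inr (hlit q hv (by simp [literalEdges]))))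
      obtain ⟨h1, h2⟩ := Theory.mem_rulesFor.1 hs'
      exact Or.inr (Or.inl (hrule s h1 (by simp [ruleEdges, headEdges, h2])))
    | .lit .mpand q, he =>
      rcases he with rfl | ⟨r, hr', rfl⟩
      · exact Or.inr (Or.inr (Or.inr (hlit q hv (by simp [literalEdges]))))
      obtain ⟨h1, rfl, h3⟩ := Theory.mem_supportFor.1 hr'
      exact Or.inr (Or.inl (hrule r h1 (by simp [ruleEdges, supportEdges, hsupp r h3])))
    | .lit .mpor q, he =>
      rcases he with rfl | rfl | ⟨s, hs', rfl⟩
      iterate 2 exact Or.inr (Or.inr (Or.inr (hlit q hv (by simp [literalEdges]))))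
      obtain ⟨h1, h2⟩ := Theory.mem_rulesFor.1 hs'
      exact Or.inr (Or.inl (hrule s h1 (by simp [ruleEdges, headEdges, h2])))
    | .rule .sd l, he | .rule .sp l, he =>
      rcases he with rfl | ⟨r, hr', rfl, a, ha, rfl⟩
      · exact Or.inr (Or.inr (Or.inr (hlab l hv (by simp [labelEdges]))))
      · exact Or.inr (Or.inl (hbody r hr' a ha (by simp [bodyEdges])))
    | .rule .fd l, he | .rule .fp l, he =>
      obtain ⟨r, hr', rfl, a, ha, rfl⟩ := he
      exact Or.inr (Or.inl (hbody r hr' a ha (by simp [bodyEdges])))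
    | .rule .beaten l, he =>
      rcases he with rfl | ⟨s, hs', rfl, t, ht, hts, rfl⟩
      · exact Or.inr (Or.inr (Or.inr (hlab l hv (by simp [labelEdges]))))
      · obtain ⟨p, hp, he⟩ := hsup' s hs' t ht hts
        exact Or.inl ⟨p, hp, by simp [he]⟩
    | .rule .win l, he =>
      rcases he with rfl | rfl | ⟨s, hs', rfl, t, ht, hts, rfl⟩
      iterate 2 exact Or.inr (Or.inr (Or.inr (hlab l hv (by simp [labelEdges]))))
      obtain ⟨p, hp, he⟩ := hsup' s hs' t ht hts
      exact Or.inl ⟨p, hp, by simp [he]⟩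
    | .occ a, he =>
      rcases hocc a he.2 rfl he.1 with h | h
      · exact Or.inr (Or.inl h)
      · exact Or.inr (Or.inr (Or.inl h))

/-- The part of the graph named by `w` is closed under predecessors, so the numbering is injective
on both ends of every listed edge. -/
theorem Theory.WrittenIn.known_of_edge {D : Theory} {w : List ℕ} (hw : D.WrittenIn w)
    {u v : Vertex} (hv : v.Known w) (he : D.Edge v u) : u.Known w := by
  have hS : ∀ q, ∀ r ∈ D.strictFor q, r.label ∈ w := fun q r hr =>
    hw.labels r (Theory.mem_strictFor.1 hr).1
  have hT : ∀ q, ∀ r ∈ D.supportFor q, r.label ∈ w := fun q r hr =>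
    hw.labels r (Theory.mem_supportFor.1 hr).1
  have hR : ∀ q, ∀ r ∈ D.rulesFor q, r.label ∈ w := fun q r hr =>
    hw.labels r (Theory.mem_rulesFor.1 hr).1
  have hB : ∀ r ∈ D.rules, ∀ a ∈ r.body, a.atom ∈ w := fun r hr a ha =>
    hw.atoms _ (D.body_mem_atoms hr ha)
  match v, he with
  | .lit .pd q, he => rcases he with ⟨rfl, _⟩ | ⟨r, hr, rfl⟩; exacts [trivial, hS q r hr]
  | .lit .md q, he =>
    rcases he with rfl | ⟨rfl, _⟩ | ⟨r, hr, rfl⟩; exacts [trivial, trivial, hS q r hr]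
  | .lit .pp q, he => rcases he with rfl | rfl <;> exact hv
  | .lit .mp q, he => rcases he with rfl | rfl | rfl; exacts [trivial, hv, hv]
  | .lit .sup q, he => obtain ⟨r, hr, rfl⟩ := he; exact hT q r hr
  | .lit .ppand q, he =>
    rcases he with rfl | rfl | rfl | ⟨r, hr, rfl⟩; exacts [trivial, hv, hv, hR _ r hr]
  | .lit .mpand q, he => rcases he with rfl | ⟨r, hr, rfl⟩; exacts [trivial, hT q r hr]
  | .lit .mpor q, he => rcases he with rfl | rfl | ⟨r, hr, rfl⟩; exacts [hv, hv, hR _ r hr]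
  | .rule .sd l, he | .rule .sp l, he =>
    rcases he with rfl | ⟨r, hr, _, a, ha, rfl⟩; exacts [trivial, hB r hr a ha]
  | .rule .fd l, he | .rule .fp l, he => obtain ⟨r, hr, _, a, ha, rfl⟩ := he; exact hB r hr a ha
  | .rule .beaten l, he =>
    rcases he with rfl | ⟨s, _, _, t, ht, _, rfl⟩; exacts [hv, hT _ t ht]
  | .rule .win l, he =>
    rcases he with rfl | rfl | ⟨s, _, _, t, ht, _, rfl⟩; exacts [trivial, hv, hT _ t ht]
  | .occ a, he => obtain ⟨rfl, _⟩ := he; trivial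

/-- The numbered edges. -/
def numbered (base : ℕ → ℕ) (E : List (Vertex × Vertex)) : List (ℕ × ℕ) :=
  E.map fun e => (e.1.id base, e.2.id base)

/-! ### From the dependency graph to its numbering and back. -/

section Transfer

variable {D : Theory} {w : List ℕ} {base : ℕ → ℕ} {E : List (Vertex × Vertex)}

/-- The root has no incoming edge and is not a disjunction; the propagation relies on this so as not
to stack it twice. -/
theorem threshold_root (hA : Allocates w base)
    (hE : ∀ u v, (u, v) ∈ E ↔ v.Known w ∧ D.Edge v u) :
    RAM.threshold (numbered base E) ((w.flatMap disjVertices).map (·.id base)) 0 = 0 := by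
  have hne : ∀ v : Vertex, v.Known w → v.id base = 0 → v = .root := fun v hv h =>
    Vertex.id_inj hA hv (v := .root) trivial h
  rw [RAM.threshold, if_neg, List.countP_eq_zero]
  · simp only [numbered, List.mem_map, decide_eq_true_eq]
    rintro _ ⟨⟨u, v⟩, he, rfl⟩ h0
    obtain ⟨hv, he⟩ := (hE u v).1 he
    obtain rfl := hne v hv h0
    exact he
  · simp only [List.mem_map, not_exists, not_and]
    intro v hv h0
    obtain ⟨hv, hd⟩ := mem_disjVertices.1 hv
    obtain rfl := hne v hv h0
    exact hd

theorem closed_of_isClosed (hA : Allocates w base)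
    (hE : ∀ u v, (u, v) ∈ E ↔ v.Known w ∧ D.Edge v u) {Y : ℕ → Prop}
    (hY : RAM.IsClosed (numbered base E) ((w.flatMap disjVertices).map (·.id base)) Y) :
    D.Closed w fun v => Y (v.id base) where
  root := hY.root
  disj v u hv hd he hu := by
    refine hY.disj (u.id base, v.id base) ?_ ?_ hu
    · exact List.mem_map.2 ⟨(u, v), (hE u v).2 ⟨hv, he⟩, rfl⟩
    · exact List.mem_map.2 ⟨v, mem_disjVertices.2 ⟨hv, hd⟩, rfl⟩
  conj v hv hd he hu := by
    refine hY.conj (v.id base) ?_ ?_ ?_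
    · simp only [List.mem_map, not_exists, not_and]
      intro v' hv' h
      obtain ⟨hv', hd'⟩ := mem_disjVertices.1 hv'
      obtain rfl := Vertex.id_inj hA hv' hv h
      exact hd hd'
    · obtain ⟨u, he⟩ := he
      exact ⟨_, List.mem_map.2 ⟨(u, v), (hE u v).2 ⟨hv, he⟩, rfl⟩, rfl⟩
    · simp only [numbered, List.mem_map]
      rintro _ ⟨⟨u, v'⟩, hm, rfl⟩ h
      obtain ⟨hv', he'⟩ := (hE u v').1 hm
      obtain rfl := Vertex.id_inj hA hv' hv h
      exact hu u he'

/-- The image of a closed set under the numbering is closed by injectivity. Applied to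
`Theory.Holds`, it bounds the result of the propagation from above. -/
theorem isClosed_of_closed (hw : D.WrittenIn w) (hA : Allocates w base)
    (hE : ∀ u v, (u, v) ∈ E ↔ v.Known w ∧ D.Edge v u) {X : Vertex → Prop} (hX : D.Closed w X) :
    RAM.IsClosed (numbered base E) ((w.flatMap disjVertices).map (·.id base))
      fun n => ∃ v : Vertex, v.Known w ∧ v.id base = n ∧ X v where
  root := ⟨.root, trivial, rfl, hX.root⟩
  disj := by
    simp only [numbered, List.mem_map]
    rintro _ ⟨⟨u, v⟩, he, rfl⟩ ⟨v', hv', h⟩ ⟨u', hu', h', hXu⟩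
    obtain ⟨hv, he⟩ := (hE u v).1 he
    obtain ⟨hv', hd'⟩ := mem_disjVertices.1 hv'
    obtain rfl := Vertex.id_inj hA hv' hv h
    obtain rfl := Vertex.id_inj hA hu' (hw.known_of_edge hv he) h'
    exact ⟨v', hv, rfl, hX.disj _ _ hv hd' he hXu⟩
  conj := by
    intro n hn hex hall
    simp only [numbered, List.mem_map] at hex
    obtain ⟨_, ⟨⟨u, v⟩, he, rfl⟩, rfl⟩ := hex
    obtain ⟨hv, he⟩ := (hE u v).1 he
    refine ⟨v, hv, rfl, hX.conj v hv (fun hd => hn ?_) ⟨u, he⟩ fun u' he' => ?_⟩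
    · exact List.mem_map.2 ⟨v, mem_disjVertices.2 ⟨hv, hd⟩, rfl⟩
    · obtain ⟨u'', hu'', h, hXu⟩ := hall (u'.id base, v.id base)
        (List.mem_map.2 ⟨(u', v), (hE u' v).2 ⟨hv, he'⟩, rfl⟩) rfl
      obtain rfl := Vertex.id_inj hA hu'' (hw.known_of_edge hv he') h
      exact hXu

/-- The counters after the propagation tell which vertices hold. -/
theorem count_eq_zero_iff (hw : D.WrittenIn w) (hA : Allocates w base)
    (hE : ∀ u v, (u, v) ∈ E ↔ v.Known w ∧ D.Edge v u) {E' : List (ℕ × ℕ)} {O : List ℕ}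
    (hE' : E' = numbered base E) (hO : O = (w.flatMap disjVertices).map (·.id base))
    {f : ℕ → ℕ}
    (hf : RAM.IsClosed E' O fun v => v = 0 ∨ 0 < RAM.threshold E' O v ∧ f v = 0)
    (hmin : ∀ C, RAM.IsClosed E' O C → ∀ v, 0 < RAM.threshold E' O v → f v = 0 → C v) :
    (∀ c : Conclusion, c.lit.atom ∈ w → (f (c.vertex.id base) = 0 ↔ D.Proves c)) ∧
    ∀ a ∈ w, f ((Vertex.occ a).id base) = 0 ↔ a ∈ D.atoms := by
  subst hE' hO
  -- A zero counter is informative only if the threshold was positive; a disjunction or a vertex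
  -- with an incoming edge guarantees this.
  have hpos : ∀ v : Vertex, v.Known w → (∃ u, D.Edge v u) ∨ v.IsDisj →
      0 < RAM.threshold (numbered base E) ((w.flatMap disjVertices).map (·.id base))
        (v.id base) := by
    intro v hv h
    rw [RAM.threshold]
    split_ifs with hO
    · exact one_pos
    · rcases h with ⟨u, he⟩ | hd
      · exact List.countP_pos_iff.2 ⟨_, List.mem_map.2 ⟨(u, v), (hE u v).2 ⟨hv, he⟩, rfl⟩, by simp⟩
      · exact absurd (List.mem_map.2 ⟨v, mem_disjVertices.2 ⟨hv, hd⟩, rfl⟩) hO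
  have hle : ∀ v : Vertex, v.Known w → ((∃ u, D.Edge v u) ∨ v.IsDisj) → f (v.id base) = 0 →
      D.Holds v := by
    intro v hv h h0
    obtain ⟨v', hv', h', hX⟩ := hmin _ (isClosed_of_closed hw hA hE (D.closed_holds w)) _
      (hpos v hv h) h0
    obtain rfl := Vertex.id_inj hA hv' hv h'
    exact hX
  have hcl := closed_of_isClosed hA hE hf
  refine ⟨fun c hc => ⟨fun h => ?_, fun h => ?_⟩, fun a ha => ⟨fun h => ?_, fun h => ?_⟩⟩
  · rw [← D.holds_vertex]
    refine hle _ hc ?_ h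
    obtain ⟨t, q⟩ := c
    cases t
    · exact Or.inr trivial
    · exact Or.inl ⟨.root, Or.inl rfl⟩
    · exact Or.inr trivial
    · exact Or.inl ⟨.root, Or.inl rfl⟩
  · have h2 : 2 ≤ c.vertex.id base :=
      Vertex.two_le_id hA (v := c.vertex) hc (by simp [Conclusion.vertex])
        (by simp [Conclusion.vertex])
    rcases hcl.of_proves hw h hc with h | h
    · omega
    · exact h.2
  · exact hle (.occ a) ha (Or.inr trivial) h
  · have h2 : 2 ≤ (Vertex.occ a).id base :=
      Vertex.two_le_id hA (v := .occ a) ha (by simp) (by simp)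
    rcases hcl.disj (.occ a) .root ha trivial ⟨rfl, h⟩ hcl.root with h | h
    · omega
    · exact h.2

end Transfer

end DefeasibleLogic

namespace DefeasibleLogic

open RAM

/-! ### The program that builds the dependency graph -/

theorem run_seq (p q : Prog) (σ : State) : (Prog.seq p q).run σ = q.run (p.run σ) := rfl

theorem run_ifEq (r s : ℕ) (p q : Prog) (σ : State) :
    (Prog.ifEq r s p q).run σ = if σ.reg r = σ.reg s then p.run σ else q.run σ := rfl

theorem run_skip (r : ℕ) (σ : State) : (Prog.copy r r).run σ = σ := State.setReg_self σ r

/-- Reads the next number of the input. -/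
def readNum (r : ℕ) : Prog := .seq (.load r 0 11) (.succ 11)

/-- Reads a literal; register `14` becomes the start of the block of its atom, registers `15` and
`16` become the numbers of the literal and of its complement. -/
def readLit : Prog := Prog.block
  [readNum 17, readNum 18, .load 14 7 18, .copy 15 14, .copy 16 14,
    -- Sign code `0` is positive, and the negative literal of a block starts `8` later.
    .ifEq 17 10 (.addK 16 8) (.addK 15 8)]

/-- Allocates a block for the next number of the input. -/
def allocStep : Prog := Prog.block
  -- The entry `0` means that there is no block yet; blocks start at `2` or later.
  [readNum 17, .load 14 7 17, .ifEq 14 10 (.seq (.store 7 17 23) (.addK 23 23)) (.copy 3 3)]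

/-- The register `q` holds the number of a literal, `q'` that of its complement; the offsets are the
values of `LitKind.idx`, in the order of `literalEdges`. -/
def literalLinks (q q' : ℕ) : List Link :=
  [⟨10, 0, q, 1⟩, ⟨10, 0, q, 3⟩, ⟨10, 0, q, 5⟩, ⟨10, 0, q, 6⟩, ⟨q, 0, q, 2⟩, ⟨q, 5, q, 2⟩,
    ⟨q, 1, q, 3⟩, ⟨q, 7, q, 3⟩, ⟨q, 4, q, 5⟩, ⟨q', 1, q, 5⟩, ⟨q, 6, q, 7⟩, ⟨q', 0, q, 7⟩]

def nameLinks : List Link :=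
  literalLinks 15 16 ++ (literalLinks 16 15 ++
    [⟨10, 0, 14, 16⟩, ⟨10, 0, 14, 18⟩, ⟨10, 0, 14, 21⟩, ⟨14, 19, 14, 20⟩, ⟨14, 18, 14, 21⟩])

def nameDisjs : List (ℕ × ℕ) :=
  [(15, 0), (15, 2), (15, 4), (15, 7), (16, 0), (16, 2), (16, 4), (16, 7),
    (14, 17), (14, 19), (14, 20), (14, 22)]

/-- Adds the vertices and edges that are named by the next number of the input. -/
def nameStep : Prog := Prog.block
  [Prog.block [readNum 17, .load 14 7 17, .copy 15 14, .copy 16 14, .addK 16 8],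
    disjs nameDisjs, links nameLinks]

/-- Reads a fact. -/
def factStep : Prog := Prog.block
  [.pred 12, readLit, links [⟨10, 0, 15, 0⟩, ⟨10, 1, 15, 1⟩, ⟨10, 0, 14, 22⟩]]

/-- Reads a literal of the body of a rule. -/
def bodyStep : Prog := Prog.block
  [.pred 13, readLit, links [⟨15, 0, 21, 16⟩, ⟨15, 1, 21, 17⟩, ⟨15, 2, 21, 18⟩, ⟨15, 3, 21, 19⟩,
    ⟨10, 0, 14, 22⟩]]

/-- Reads the label and the arrow of a rule. -/
def ruleIntro : Prog := Prog.block [.pred 12, readNum 19, readNum 20, .load 21 7 19, .const 22 2]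

/-- Stores the head of a rule in array `8`, and the complement of the head in array `9`, unless the
rule is a defeater. -/
def ruleStore : Prog := .seq (.store 8 19 15) (.ifEq 20 22 (.store 9 19 10) (.store 9 19 16))

/-- Reads a rule up to its head. -/
def ruleStart : Prog := Prog.block [ruleIntro, readLit, ruleStore]

/-- Adds the edges from a strict rule to its head. -/
def strictPart : Prog := .ifEq 20 10 (links [⟨21, 16, 15, 0⟩, ⟨21, 17, 15, 1⟩]) (.copy 3 3)

/-- Adds the edges from a strict or defeasible rule to its head. -/
def supportPart : Prog := .ifEq 20 22 (.copy 3 3) (links [⟨21, 18, 15, 4⟩, ⟨21, 19, 15, 6⟩])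

/-- Reads a rule up to the length of its body. -/
def ruleHead : Prog := Prog.block
  [ruleStart, links [⟨21, 20, 16, 5⟩, ⟨21, 21, 16, 7⟩, ⟨10, 0, 14, 22⟩], strictPart, supportPart,
    readNum 13]

def ruleStep : Prog := .seq ruleHead (.whileNe 13 10 bodyStep)

/-- Reads a superiority statement. -/
def supStep : Prog := Prog.block
  [Prog.block [.pred 12, readNum 17, readNum 18, .load 14 7 17, .load 15 7 18, .load 19 9 17,
      .load 20 8 18],
    -- Register `19` holds the complement of the head of the superior rule, or `0` for a defeater,
    -- which is no literal number. One comparison thus tests both conditions in `supEdges`.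
    .ifEq 19 20 (links [⟨14, 18, 15, 20⟩, ⟨14, 19, 15, 21⟩]) (.copy 3 3)]

/-- The state while the graph is being built: `E` are the edges so far, and `rest` is the part of
the input `w` that is still to be read. -/
structure Building (w : List ℕ) (base : ℕ → ℕ) (E : List (Vertex × Vertex)) (O rest : List ℕ)
    (σ : State) : Prop where
  stores : Stores (numbered base E) O σ
  input : σ.arr 0 = fun i => w.getD i 0
  blocks : σ.arr 7 = base
  length : σ.reg 0 = w.length
  output : σ.reg 1 = 0
  rest : w.drop (σ.reg 11) = rest

/-! ### Reading numbers and literals while the graph is being built. -/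

section Building

variable {w : List ℕ} {base : ℕ → ℕ} {E : List (Vertex × Vertex)} {O rest : List ℕ} {σ : State}

theorem Building.perm {E' : List (Vertex × Vertex)} (h : Building w base E O rest σ)
    (hE : E.Perm E') : Building w base E' O rest σ :=
  { h with stores := h.stores.perm (hE.map _) fun _ => Iff.rfl }

theorem Building.run (h : Building w base E O rest σ) {p : Prog}
    (hr : 0 ∉ p.regs ∧ 1 ∉ p.regs ∧ 2 ∉ p.regs ∧ 10 ∉ p.regs ∧ 11 ∉ p.regs)
    (ha : ∀ a < 8, a ∉ p.arrs) : Building w base E O rest (p.run σ) where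
  stores := h.stores.congr (Prog.run_reg hr.2.2.1 σ) (Prog.run_reg hr.2.2.2.1 σ)
    fun a _ h6 => Prog.run_arr (ha a (by omega)) σ
  input := (Prog.run_arr (ha 0 (by omega)) σ).trans h.input
  blocks := (Prog.run_arr (ha 7 (by omega)) σ).trans h.blocks
  length := (Prog.run_reg hr.1 σ).trans h.length
  output := (Prog.run_reg hr.2.1 σ).trans h.output
  rest := by rw [Prog.run_reg hr.2.2.2.2]; exact h.rest

theorem Building.of_frame (h : Building w base E O rest σ) {σ' : State} (hf : Frame σ σ')
    {E' : List (Vertex × Vertex)} {O' : List ℕ} (hs : Stores (numbered base E') O' σ') :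
    Building w base E' O' rest σ' where
  stores := hs
  input := (hf.arr 0 (by omega)).trans h.input
  blocks := (hf.arr 7 (by omega)).trans h.blocks
  length := (hf.reg 0 (by omega)).trans h.length
  output := (hf.reg 1 (by omega)).trans h.output
  rest := by rw [hf.reg 11 (by omega)]; exact h.rest

/-- Reduces each reading step to a comparison of register contents with vertex numbers. -/
theorem Building.links (h : Building w base E O rest σ) {l : List Link}
    {F : List (Vertex × Vertex)} (hl : ∀ e ∈ l, 10 ≤ e.src ∧ 10 ≤ e.tgt)
    (hF : l.map (·.edge σ) = numbered base F) :
    Building w base (F ++ E) O rest ((RAM.links l).run σ) ∧ Frame σ ((RAM.links l).run σ) := by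
  obtain ⟨h1, h2⟩ := run_links h.stores hl
  refine ⟨h.of_frame h2 ?_, h2⟩
  rw [hF] at h1
  simpa [numbered] using h1

theorem Building.readNum {x : ℕ} (h : Building w base E O (x :: rest) σ) {r : ℕ} (hr : 12 ≤ r) :
    Building w base E O rest ((readNum r).run σ) ∧ ((readNum r).run σ).reg r = x := by
  have hx : w.getD (σ.reg 11) 0 = x := by
    have h1 := congrArg (·[0]?) h.rest
    simp only [List.getElem?_drop, Nat.add_zero, List.getElem?_cons_zero] at h1
    simp [List.getD, h1]
  have hd : w.drop (σ.reg 11 + 1) = rest := by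
    rw [← List.drop_drop, h.rest]
    rfl
  have h11 : r ≠ 11 := by omega
  refine ⟨⟨h.stores.congr ?_ ?_ fun _ _ _ => rfl, h.input, h.blocks, ?_, ?_, ?_⟩, ?_⟩
  · exact Prog.run_reg (by simp [DefeasibleLogic.readNum, Prog.regs]; omega) σ
  · exact Prog.run_reg (by simp [DefeasibleLogic.readNum, Prog.regs]; omega) σ
  · exact (Prog.run_reg (by simp [DefeasibleLogic.readNum, Prog.regs]; omega) σ).trans h.length
  · exact (Prog.run_reg (by simp [DefeasibleLogic.readNum, Prog.regs]; omega) σ).trans h.output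
  · simpa [DefeasibleLogic.readNum, Prog.run, h11.symm] using hd
  · simpa [DefeasibleLogic.readNum, Prog.run, h11, h.input] using hx

theorem Building.readLit {q : Literal} (h : Building w base E O (q.code ++ rest) σ) :
    Building w base E O rest (readLit.run σ) ∧ (readLit.run σ).reg 14 = base q.atom ∧
      (readLit.run σ).reg 15 = litId base q ∧ (readLit.run σ).reg 16 = litId base q.compl := by
  obtain ⟨h1, hs⟩ := Building.readNum (r := 17) h (by omega)
  obtain ⟨h2, ha⟩ := h1.readNum (r := 18) (by omega)
  set σ₂ := (DefeasibleLogic.readNum 18).run ((DefeasibleLogic.readNum 17).run σ) with hσ₂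
  have hs : σ₂.reg 17 = if q.positive then 0 else 1 := by
    rw [hσ₂, Prog.run_reg (by decide), hs]
  let p := Prog.block [.load 14 7 18, .copy 15 14, .copy 16 14,
    .ifEq 17 10 (.addK 16 8) (.addK 15 8)]
  have hrun : DefeasibleLogic.readLit.run σ = p.run σ₂ := rfl
  rw [hrun]
  have hz := h2.stores.zero
  have hb := h2.blocks
  refine ⟨h2.run (by decide) (by decide), ?_⟩
  obtain ⟨a, pos⟩ := q
  cases pos <;> simp_all [p, Prog.block, Prog.run, litId, Literal.compl]

end Building

theorem readLit_loopFree : readLit.LoopFree := by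
  simp [readLit, readNum, Prog.block, Prog.LoopFree]

/-! ### The edges contributed by a fact, a body literal, a name, a superiority statement and the
head of a rule. -/

section Steps

variable {w : List ℕ} {base : ℕ → ℕ} {E : List (Vertex × Vertex)} {O rest : List ℕ} {σ : State}

theorem Building.factStep {q : Literal} (h : Building w base E O (q.code ++ rest) σ) :
    Building w base (factEdges q ++ E) O rest (factStep.run σ) ∧
      (factStep.run σ).reg 12 = σ.reg 12 - 1 := by
  have h0 := h.run (p := .pred 12) (by decide) (by decide)
  obtain ⟨h1, h14, h15, h16⟩ := h0.readLit
  set σ₁ := DefeasibleLogic.readLit.run ((Prog.pred 12).run σ) with hσ₁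
  obtain ⟨h2, hf⟩ := h1.links (F := factEdges q)
    (l := [⟨10, 0, 15, 0⟩, ⟨10, 1, 15, 1⟩, ⟨10, 0, 14, 22⟩]) (by simp) (by
      simp [factEdges, numbered, Link.edge, Vertex.id, LitKind.idx, h14, h15, h1.stores.zero])
  have hrun : DefeasibleLogic.factStep.run σ =
      (RAM.links [⟨10, 0, 15, 0⟩, ⟨10, 1, 15, 1⟩, ⟨10, 0, 14, 22⟩]).run σ₁ := by
    simp only [DefeasibleLogic.factStep, Prog.block, run_seq, hσ₁]
  rw [hrun]
  refine ⟨h2, (hf.reg 12 (by omega)).trans ?_⟩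
  rw [hσ₁, Prog.run_reg (by decide)]
  simp [Prog.run]

theorem Building.bodyStep {q : Literal} {l : ℕ} (h : Building w base E O (q.code ++ rest) σ)
    (hl : σ.reg 21 = base l) :
    Building w base (bodyEdges l q ++ E) O rest (bodyStep.run σ) ∧
      (bodyStep.run σ).reg 13 = σ.reg 13 - 1 ∧ (bodyStep.run σ).reg 12 = σ.reg 12 ∧
      (bodyStep.run σ).reg 21 = σ.reg 21 ∧ (bodyStep.run σ).arr 8 = σ.arr 8 ∧
      (bodyStep.run σ).arr 9 = σ.arr 9 := by
  have h0 := h.run (p := .pred 13) (by decide) (by decide)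
  obtain ⟨h1, h14, h15, h16⟩ := h0.readLit
  set σ₁ := DefeasibleLogic.readLit.run ((Prog.pred 13).run σ) with hσ₁
  have h21 : σ₁.reg 21 = σ.reg 21 := by
    rw [hσ₁, Prog.run_reg (by decide), Prog.run_reg (by decide)]
  obtain ⟨h2, hf⟩ := h1.links (F := bodyEdges l q)
    (l := [⟨15, 0, 21, 16⟩, ⟨15, 1, 21, 17⟩, ⟨15, 2, 21, 18⟩, ⟨15, 3, 21, 19⟩,
      ⟨10, 0, 14, 22⟩]) (by simp) (by
      simp [bodyEdges, numbered, Link.edge, Vertex.id, LitKind.idx, RuleKind.idx, h14, h15, h21,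
        hl, h1.stores.zero])
  have hrun : DefeasibleLogic.bodyStep.run σ =
      (RAM.links [⟨15, 0, 21, 16⟩, ⟨15, 1, 21, 17⟩, ⟨15, 2, 21, 18⟩, ⟨15, 3, 21, 19⟩,
        ⟨10, 0, 14, 22⟩]).run σ₁ := by
    simp only [DefeasibleLogic.bodyStep, Prog.block, run_seq, hσ₁]
  rw [hrun]
  refine ⟨h2, (hf.reg 13 (by omega)).trans ?_, (hf.reg 12 (by omega)).trans ?_,
    (hf.reg 21 (by omega)).trans h21, (hf.arr 8 (by omega)).trans ?_,
    (hf.arr 9 (by omega)).trans ?_⟩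
  · rw [hσ₁, Prog.run_reg (by decide)]
    simp [Prog.run]
  · rw [hσ₁, Prog.run_reg (by decide), Prog.run_reg (by decide)]
  · rw [hσ₁, Prog.run_arr (by decide), Prog.run_arr (by decide)]
  · rw [hσ₁, Prog.run_arr (by decide), Prog.run_arr (by decide)]

theorem Building.nameStep {x : ℕ} (h : Building w base E O (x :: rest) σ) :
    Building w base (nameEdges x ++ E) ((disjVertices x).map (·.id base) ++ O) rest
        (nameStep.run σ) ∧
      (nameStep.run σ).reg 11 = σ.reg 11 + 1 := by
  obtain ⟨h0, h17⟩ := h.readNum (r := 17) (by omega)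
  let p := Prog.block [.load 14 7 17, .copy 15 14, .copy 16 14, .addK 16 8]
  have h1 := h0.run (p := p) (by decide) (by decide)
  have hb := h0.blocks
  set σ₁ := p.run ((DefeasibleLogic.readNum 17).run σ) with hσ₁
  have h14 : σ₁.reg 14 = base x := by simp [hσ₁, p, Prog.block, Prog.run, h17, hb]
  have h15 : σ₁.reg 15 = base x := by simp [hσ₁, p, Prog.block, Prog.run, h17, hb]
  have h16 : σ₁.reg 16 = base x + 8 := by simp [hσ₁, p, Prog.block, Prog.run, h17, hb]
  have h11 : σ₁.reg 11 = σ.reg 11 + 1 := by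
    simp [hσ₁, p, Prog.block, Prog.run, DefeasibleLogic.readNum]
  obtain ⟨h2, hf2⟩ := run_disjs (l := nameDisjs) h1.stores (by simp [nameDisjs])
  have h2' := h1.of_frame hf2 h2
  set σ₂ := (disjs nameDisjs).run σ₁ with hσ₂
  obtain ⟨h3, hf3⟩ := h2'.links (F := nameEdges x) (l := nameLinks)
    (by simp [nameLinks, literalLinks]) (by
      simp [nameEdges, literalEdges, labelEdges, nameLinks, literalLinks, numbered, Link.edge,
        Vertex.id, LitKind.idx, RuleKind.idx, litId, Literal.compl, h2.zero,
        hf2.reg 14 (by omega), hf2.reg 15 (by omega), hf2.reg 16 (by omega), h14, h15, h16])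
  have hrun : DefeasibleLogic.nameStep.run σ = (RAM.links nameLinks).run σ₂ := by
    simp only [DefeasibleLogic.nameStep, Prog.block, run_seq, hσ₂, hσ₁, p]
  rw [hrun]
  refine ⟨?_, (hf3.reg 11 (by omega)).trans ((hf2.reg 11 (by omega)).trans h11)⟩
  convert h3 using 2
  simp [nameDisjs, disjVertices, Vertex.id, LitKind.idx, RuleKind.idx, litId, h14, h15, h16]

theorem litId_inj (hA : Allocates w base) {q q' : Literal} (hq : q.atom ∈ w) (hq' : q'.atom ∈ w)
    (h : litId base q = litId base q') : q = q' := by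
  have := Vertex.id_inj hA (u := .lit .pd q) (v := .lit .pd q') hq hq'
    (by simp [Vertex.id, h])
  simpa using this

/-- What the arrays `8` and `9` contain for a rule. -/
def HeadStored (base : ℕ → ℕ) (r : Rule) (σ : State) : Prop :=
  σ.arr 8 r.label = litId base r.head ∧
    σ.arr 9 r.label = if r.arrow = .defeater then 0 else litId base r.head.compl

theorem Building.supStep {p : Rule × Rule} (hA : Allocates w base)
    (h : Building w base E O (p.1.label :: p.2.label :: rest) σ) (h1 : HeadStored base p.1 σ)
    (h2 : HeadStored base p.2 σ) (hw1 : p.1.head.atom ∈ w) (hw2 : p.2.head.atom ∈ w) :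
    Building w base (supEdges p ++ E) O rest (supStep.run σ) ∧
      (supStep.run σ).reg 12 = σ.reg 12 - 1 ∧ (supStep.run σ).arr 8 = σ.arr 8 ∧
      (supStep.run σ).arr 9 = σ.arr 9 := by
  obtain ⟨t, s⟩ := p
  have e0 := h.run (p := .pred 12) (by decide) (by decide)
  obtain ⟨e1, h17⟩ := e0.readNum (r := 17) (by omega)
  obtain ⟨e2, h18⟩ := e1.readNum (r := 18) (by omega)
  set σ₂ := (DefeasibleLogic.readNum 18).run ((DefeasibleLogic.readNum 17).run
    ((Prog.pred 12).run σ)) with hσ₂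
  have h17 : σ₂.reg 17 = t.label := by rw [hσ₂, Prog.run_reg (by decide), h17]
  let p := Prog.block [.load 14 7 17, .load 15 7 18, .load 19 9 17, .load 20 8 18]
  have e3 := e2.run (p := p) (by decide) (by decide)
  have hb := e2.blocks
  have a8 : σ₂.arr 8 = σ.arr 8 := rfl
  have a9 : σ₂.arr 9 = σ.arr 9 := rfl
  have h12 : σ₂.reg 12 = σ.reg 12 - 1 := by
    rw [hσ₂, Prog.run_reg (by decide), Prog.run_reg (by decide)]
    simp [Prog.run]
  set σ₃ := p.run σ₂ with hσ₃
  have h14 : σ₃.reg 14 = base t.label := by simp [hσ₃, p, Prog.block, Prog.run, h17, hb]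
  have h15 : σ₃.reg 15 = base s.label := by simp [hσ₃, p, Prog.block, Prog.run, h18, hb]
  have h19 : σ₃.reg 19 = if t.arrow = .defeater then 0 else litId base t.head.compl := by
    simp [hσ₃, p, Prog.block, Prog.run, h17, a9, ← h1.2]
  have h20 : σ₃.reg 20 = litId base s.head := by
    simp [hσ₃, p, Prog.block, Prog.run, h18, a8, ← h2.1]
  have h12 : σ₃.reg 12 = σ.reg 12 - 1 := by rw [← h12, hσ₃, Prog.run_reg (by decide)]
  have hrun : DefeasibleLogic.supStep.run σ =
      if σ₃.reg 19 = σ₃.reg 20 then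
        (RAM.links [⟨14, 18, 15, 20⟩, ⟨14, 19, 15, 21⟩]).run σ₃ else σ₃ := by
    simp only [DefeasibleLogic.supStep, Prog.block, run_seq, run_ifEq, run_skip, hσ₃, hσ₂, p]
  have hiff : σ₃.reg 19 = σ₃.reg 20 ↔ t.arrow ≠ .defeater ∧ t.head.compl = s.head := by
    rw [h19, h20]
    split_ifs with hd
    · simp only [hd, ne_eq, not_true, false_and, iff_false]
      -- The default entry `0` of a defeater cannot be the number of a head.
      have : 2 ≤ base s.head.atom := hA.two_le _ hw2
      simp only [litId]
      omega
    · simp only [ne_eq, hd, not_false_eq_true, true_and]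
      exact ⟨litId_inj hA hw1 hw2, fun h => by rw [h]⟩
  rw [hrun]
  split_ifs with hc
  · obtain ⟨e4, hf⟩ := e3.links (F := supEdges (t, s))
      (l := [⟨14, 18, 15, 20⟩, ⟨14, 19, 15, 21⟩]) (by simp) (by
        rw [supEdges, if_pos (hiff.1 hc)]
        simp [numbered, Link.edge, Vertex.id, RuleKind.idx, h14, h15])
    exact ⟨e4, (hf.reg 12 (by omega)).trans h12, hf.arr 8 (by omega), hf.arr 9 (by omega)⟩
  · rw [supEdges, if_neg (fun h => hc (hiff.2 h))]
    exact ⟨e3, h12, rfl, rfl⟩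

theorem Building.ruleStart {r : Rule}
    (h : Building w base E O (r.label :: r.arrow.code :: (r.head.code ++ rest)) σ) :
    Building w base E O rest (ruleStart.run σ) ∧
      (ruleStart.run σ).reg 12 = σ.reg 12 - 1 ∧ (ruleStart.run σ).reg 14 = base r.head.atom ∧
      (ruleStart.run σ).reg 15 = litId base r.head ∧
      (ruleStart.run σ).reg 16 = litId base r.head.compl ∧
      (ruleStart.run σ).reg 20 = r.arrow.code ∧ (ruleStart.run σ).reg 21 = base r.label ∧
      (ruleStart.run σ).reg 22 = 2 ∧ HeadStored base r (ruleStart.run σ) ∧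
      ∀ l ≠ r.label, (ruleStart.run σ).arr 8 l = σ.arr 8 l ∧
        (ruleStart.run σ).arr 9 l = σ.arr 9 l := by
  have e0 := h.run (p := .pred 12) (by decide) (by decide)
  obtain ⟨e1, h19⟩ := e0.readNum (r := 19) (by omega)
  obtain ⟨e2, h20⟩ := e1.readNum (r := 20) (by omega)
  have e3 := e2.run (p := .seq (.load 21 7 19) (.const 22 2)) (by decide) (by decide)
  have hb := e2.blocks
  have hrun : DefeasibleLogic.ruleStart.run σ = ruleStore.run (DefeasibleLogic.readLit.run
      ((Prog.seq (.load 21 7 19) (.const 22 2)).run ((DefeasibleLogic.readNum 20).run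
        ((DefeasibleLogic.readNum 19).run ((Prog.pred 12).run σ))))) := by
    simp only [DefeasibleLogic.ruleStart, ruleIntro, Prog.block, run_seq]
  rw [hrun]
  have h12 : ((DefeasibleLogic.readNum 20).run ((DefeasibleLogic.readNum 19).run
      ((Prog.pred 12).run σ))).reg 12 = σ.reg 12 - 1 := by
    rw [Prog.run_reg (by decide), Prog.run_reg (by decide)]
    simp [Prog.run]
  have h19 : ((DefeasibleLogic.readNum 20).run ((DefeasibleLogic.readNum 19).run
      ((Prog.pred 12).run σ))).reg 19 = r.label := by rw [Prog.run_reg (by decide), h19]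
  have a2 : ((DefeasibleLogic.readNum 20).run ((DefeasibleLogic.readNum 19).run
      ((Prog.pred 12).run σ))).arr = σ.arr := rfl
  generalize (DefeasibleLogic.readNum 20).run ((DefeasibleLogic.readNum 19).run
    ((Prog.pred 12).run σ)) = σ₂ at *
  have h21 : ((Prog.seq (.load 21 7 19) (.const 22 2)).run σ₂).reg 21 = base r.label := by
    simp [Prog.run, hb, h19]
  have h22 : ((Prog.seq (.load 21 7 19) (.const 22 2)).run σ₂).reg 22 = 2 := by simp [Prog.run]
  have a3 : ((Prog.seq (.load 21 7 19) (.const 22 2)).run σ₂).arr = σ₂.arr := rfl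
  rw [← Prog.run_reg (p := .seq (.load 21 7 19) (.const 22 2)) (by decide)] at h12 h19 h20
  generalize (Prog.seq (.load 21 7 19) (.const 22 2)).run σ₂ = σ₃ at *
  obtain ⟨e4, h14, h15, h16⟩ := e3.readLit
  have a4 : ∀ a, (DefeasibleLogic.readLit.run σ₃).arr a = σ.arr a := fun a => by
    rw [Prog.run_arr (p := DefeasibleLogic.readLit) (by simp [DefeasibleLogic.readLit,
      DefeasibleLogic.readNum, Prog.block, Prog.arrs]), a3, a2]
  rw [← Prog.run_reg (p := DefeasibleLogic.readLit) (by decide)] at h12 h19 h20 h21 h22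
  generalize DefeasibleLogic.readLit.run σ₃ = σ₄ at *
  have e5 := e4.run (p := ruleStore) (by decide) (by decide)
  have hreg : ∀ k, (ruleStore.run σ₄).reg k = σ₄.reg k := fun k =>
    Prog.run_reg (p := ruleStore) (by simp [ruleStore, Prog.regs]) σ₄
  have a8 : (ruleStore.run σ₄).arr 8 = Function.update (σ.arr 8) r.label (litId base r.head) := by
    by_cases hc : σ₄.reg 20 = σ₄.reg 22 <;> simp [ruleStore, Prog.run, hc, h19, h15, a4]
  have a9 : (ruleStore.run σ₄).arr 9 = Function.update (σ.arr 9) r.label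
      (if r.arrow = .defeater then 0 else litId base r.head.compl) := by
    have : σ₄.reg 20 = σ₄.reg 22 ↔ r.arrow = .defeater := by
      rw [h20, h22]
      cases r.arrow <;> simp [Arrow.code]
    by_cases hc : r.arrow = .defeater <;>
      simp [ruleStore, Prog.run, this, hc, h19, h16, a4, e4.stores.zero]
  refine ⟨e5, (hreg _).trans h12, (hreg _).trans h14, (hreg _).trans h15, (hreg _).trans h16,
    (hreg _).trans h20, (hreg _).trans h21, (hreg _).trans h22, ⟨?_, ?_⟩, fun l hl => ⟨?_, ?_⟩⟩
  · rw [a8, Function.update_self]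
  · rw [a9, Function.update_self]
  · rw [a8, Function.update_of_ne hl]
  · rw [a9, Function.update_of_ne hl]

theorem Building.strictPart {r : Rule} (h : Building w base E O rest σ)
    (h15 : σ.reg 15 = litId base r.head) (h20 : σ.reg 20 = r.arrow.code)
    (h21 : σ.reg 21 = base r.label) :
    Building w base (strictEdges r ++ E) O rest (strictPart.run σ) ∧
      Frame σ (strictPart.run σ) := by
  have : σ.reg 20 = σ.reg 10 ↔ r.arrow = .strict := by
    rw [h20, h.stores.zero]
    cases r.arrow <;> simp [Arrow.code]
  simp only [DefeasibleLogic.strictPart, run_ifEq, run_skip, this, strictEdges]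
  split_ifs with hc
  · exact h.links (by simp) (by
      simp [numbered, Link.edge, Vertex.id, LitKind.idx, RuleKind.idx, h15, h21])
  · exact ⟨h, Frame.refl _⟩

theorem Building.supportPart {r : Rule} (h : Building w base E O rest σ)
    (h15 : σ.reg 15 = litId base r.head) (h20 : σ.reg 20 = r.arrow.code)
    (h21 : σ.reg 21 = base r.label) (h22 : σ.reg 22 = 2) :
    Building w base (supportEdges r ++ E) O rest (supportPart.run σ) ∧
      Frame σ (supportPart.run σ) := by
  have : σ.reg 20 = σ.reg 22 ↔ r.arrow = .defeater := by
    rw [h20, h22]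
    cases r.arrow <;> simp [Arrow.code]
  simp only [DefeasibleLogic.supportPart, run_ifEq, run_skip, this, supportEdges]
  split_ifs with hc
  · exact ⟨h, Frame.refl _⟩
  · exact h.links (by simp) (by
      simp [numbered, Link.edge, Vertex.id, LitKind.idx, RuleKind.idx, h15, h21])

theorem Building.ruleHead {r : Rule} {n : ℕ}
    (h : Building w base E O (r.label :: r.arrow.code :: (r.head.code ++ n :: rest)) σ) :
    Building w base (supportEdges r ++ (strictEdges r ++ (headEdges r ++ E))) O rest
        (ruleHead.run σ) ∧
      (ruleHead.run σ).reg 12 = σ.reg 12 - 1 ∧ (ruleHead.run σ).reg 13 = n ∧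
      (ruleHead.run σ).reg 21 = base r.label ∧ HeadStored base r (ruleHead.run σ) ∧
      ∀ l ≠ r.label, (ruleHead.run σ).arr 8 l = σ.arr 8 l ∧
        (ruleHead.run σ).arr 9 l = σ.arr 9 l := by
  obtain ⟨e5, h12, h14, h15, h16, h20, h21, h22, hs, hl⟩ := h.ruleStart
  have hrun : DefeasibleLogic.ruleHead.run σ = (DefeasibleLogic.readNum 13).run
      (DefeasibleLogic.supportPart.run (DefeasibleLogic.strictPart.run
        ((RAM.links [⟨21, 20, 16, 5⟩, ⟨21, 21, 16, 7⟩, ⟨10, 0, 14, 22⟩]).run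
          (DefeasibleLogic.ruleStart.run σ)))) := by
    simp only [DefeasibleLogic.ruleHead, Prog.block, run_seq]
  rw [hrun]
  generalize DefeasibleLogic.ruleStart.run σ = σ₅ at *
  obtain ⟨e6, f6⟩ := e5.links (F := headEdges r)
    (l := [⟨21, 20, 16, 5⟩, ⟨21, 21, 16, 7⟩, ⟨10, 0, 14, 22⟩]) (by simp) (by
      simp [headEdges, numbered, Link.edge, Vertex.id, LitKind.idx, RuleKind.idx, h14, h16,
        h21, e5.stores.zero])
  generalize (RAM.links [⟨21, 20, 16, 5⟩, ⟨21, 21, 16, 7⟩, ⟨10, 0, 14, 22⟩]).run σ₅ = σ₆ at *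
  obtain ⟨e7, f7⟩ := e6.strictPart (r := r) (by rw [f6.reg 15 (by omega), h15])
    (by rw [f6.reg 20 (by omega), h20]) (by rw [f6.reg 21 (by omega), h21])
  generalize DefeasibleLogic.strictPart.run σ₆ = σ₇ at *
  have f7 := f6.trans f7
  obtain ⟨e8, f8⟩ := e7.supportPart (r := r) (by rw [f7.reg 15 (by omega), h15])
    (by rw [f7.reg 20 (by omega), h20]) (by rw [f7.reg 21 (by omega), h21])
    (by rw [f7.reg 22 (by omega), h22])
  generalize DefeasibleLogic.supportPart.run σ₇ = σ₈ at *
  have f8 := f7.trans f8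
  obtain ⟨e9, h13⟩ := e8.readNum (r := 13) (by omega)
  have ha : ∀ a, 7 ≤ a → ((DefeasibleLogic.readNum 13).run σ₈).arr a = σ₅.arr a :=
    fun a h7 => f8.arr a (by omega)
  refine ⟨e9, ?_, h13, ?_, ?_, fun l hne => ?_⟩
  · rw [Prog.run_reg (by decide), f8.reg 12 (by omega), h12]
  · rw [Prog.run_reg (by decide), f8.reg 21 (by omega), h21]
  · rw [HeadStored, ha 8 (by omega), ha 9 (by omega)]
    exact hs
  · rw [ha 8 (by omega), ha 9 (by omega)]
    exact hl l hne

end Steps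

end DefeasibleLogic

namespace DefeasibleLogic

open RAM

/-! ### The loops of the program -/

section Loops

variable {w : List ℕ} {base : ℕ → ℕ} {E : List (Vertex × Vertex)} {O rest : List ℕ} {σ : State}

theorem allocStep_loopFree : allocStep.LoopFree := by
  simp [allocStep, readNum, Prog.block, Prog.LoopFree]

theorem nameStep_loopFree : nameStep.LoopFree := by
  simp [nameStep, readNum, Prog.block, Prog.LoopFree, links_loopFree, disjs_loopFree]

theorem factStep_loopFree : factStep.LoopFree := by
  simp [factStep, Prog.block, Prog.LoopFree, links_loopFree, readLit_loopFree]

theorem bodyStep_loopFree : bodyStep.LoopFree := by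
  simp [bodyStep, Prog.block, Prog.LoopFree, links_loopFree, readLit_loopFree]

theorem supStep_loopFree : supStep.LoopFree := by
  simp [supStep, readNum, Prog.block, Prog.LoopFree, links_loopFree]

theorem ruleHead_loopFree : ruleHead.LoopFree := by
  simp [ruleHead, ruleStart, ruleIntro, ruleStore, strictPart, supportPart, readNum, Prog.block,
    Prog.LoopFree, links_loopFree, readLit_loopFree]

/-- The invariant of the allocation of the blocks. -/
structure Allocating (w l : List ℕ) (σ : State) : Prop where
  -- As long as there are no edges, the numbering may still grow.
  building : Building w (σ.arr 7) [] [] l σ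
  pos : σ.reg 11 + l.length = w.length
  bounds : ∀ x, σ.arr 7 x ≠ 0 → 2 ≤ σ.arr 7 x ∧ σ.arr 7 x + 23 ≤ σ.reg 23
  two_le : 2 ≤ σ.reg 23
  disjoint : ∀ x y, σ.arr 7 x ≠ 0 → σ.arr 7 y ≠ 0 → x ≠ y →
    σ.arr 7 x + 23 ≤ σ.arr 7 y ∨ σ.arr 7 y + 23 ≤ σ.arr 7 x
  allocated : ∀ x ∈ w, x ∉ l → σ.arr 7 x ≠ 0

/-- Register `23` lies at or beyond the end of every block allocated so far, so a block that starts
there is disjoint from all of them. -/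
theorem Allocating.step {x : ℕ} {l : List ℕ} (h : Allocating w (x :: l) σ) :
    Allocating w l (allocStep.run σ) := by
  obtain ⟨h1, h17⟩ := h.building.readNum (r := 17) (by omega)
  have hrun : allocStep.run σ = if σ.arr 7 x = 0 then
      ((((readNum 17).run σ).setReg 14 (σ.arr 7 x)).setArr 7 x (σ.reg 23)).setReg 23
        (σ.reg 23 + 23) else (((readNum 17).run σ).setReg 14 (σ.arr 7 x)) := by
    have h17' : ((readNum 17).run σ).reg 17 = x := h17
    have hz : ((readNum 17).run σ).reg 10 = 0 := h1.stores.zero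
    have ha : ((readNum 17).run σ).arr = σ.arr := rfl
    have h23 : ((readNum 17).run σ).reg 23 = σ.reg 23 := Prog.run_reg (by decide) σ
    simp only [allocStep, Prog.block, run_seq, run_ifEq, run_skip]
    generalize (readNum 17).run σ = σ' at *
    simp [Prog.run, h17', hz, ha, h23]
  have h11 : ((readNum 17).run σ).reg 11 = σ.reg 11 + 1 := by simp [readNum, Prog.run]
  have h23 : ((readNum 17).run σ).reg 23 = σ.reg 23 := Prog.run_reg (by decide) σ
  have ha : ((readNum 17).run σ).arr = σ.arr := rfl
  have hpos := h.pos
  simp only [List.length_cons] at hpos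
  rw [hrun]
  generalize (readNum 17).run σ = σ' at *
  split_ifs with h0
  · have hr : ∀ r, r ≠ 14 → r ≠ 23 → (((σ'.setReg 14 (σ.arr 7 x)).setArr 7 x (σ.reg 23)).setReg 23
        (σ.reg 23 + 23)).reg r = σ'.reg r := by
      intro r h14 h23
      simp [h14, h23]
    have ha' : ∀ a, a ≠ 7 → (((σ'.setReg 14 (σ.arr 7 x)).setArr 7 x (σ.reg 23)).setReg 23
        (σ.reg 23 + 23)).arr a = σ'.arr a := by
      intro a h7
      simp [h7]
    have h7 : (((σ'.setReg 14 (σ.arr 7 x)).setArr 7 x (σ.reg 23)).setReg 23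
        (σ.reg 23 + 23)).arr 7 = Function.update (σ.arr 7) x (σ.reg 23) := by
      simp [ha]
    have e23 : (((σ'.setReg 14 (σ.arr 7 x)).setArr 7 x (σ.reg 23)).setReg 23
        (σ.reg 23 + 23)).reg 23 = σ.reg 23 + 23 := by simp
    generalize ((σ'.setReg 14 (σ.arr 7 x)).setArr 7 x (σ.reg 23)).setReg 23 (σ.reg 23 + 23)
      = σ'' at *
    have h2 := h.two_le
    refine ⟨⟨?_, ?_, rfl, ?_, ?_, ?_⟩, ?_, ?_, ?_, ?_, ?_⟩
    · exact h1.stores.congr (hr 2 (by omega) (by omega)) (hr 10 (by omega) (by omega))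
        fun a _ h6 => ha' a (by omega)
    · exact (ha' 0 (by omega)).trans h1.input
    · exact (hr 0 (by omega) (by omega)).trans h1.length
    · exact (hr 1 (by omega) (by omega)).trans h1.output
    · rw [hr 11 (by omega) (by omega)]; exact h1.rest
    · rw [hr 11 (by omega) (by omega), h11]; omega
    · intro y
      rw [h7, e23]
      by_cases hy : y = x
      · subst hy
        simp
        omega
      · rw [Function.update_of_ne hy]
        intro h0
        have := h.bounds y h0
        omega
    · omega
    · intro y z
      rw [h7]
      by_cases hy : y = x
      · subst hy
        by_cases hz : z = y
        · exact fun _ _ h => absurd hz.symm h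
        · rw [Function.update_self, Function.update_of_ne hz]
          intro _ h0 _
          exact Or.inr (h.bounds z h0).2
      · rw [Function.update_of_ne hy]
        by_cases hz : z = x
        · subst hz
          rw [Function.update_self]
          intro h0 _ _
          exact Or.inl (h.bounds y h0).2
        · rw [Function.update_of_ne hz]
          exact h.disjoint y z
    · intro y hy hyl
      rw [h7]
      by_cases hyx : y = x
      · subst hyx
        rw [Function.update_self]
        omega
      · rw [Function.update_of_ne hyx]
        exact h.allocated y hy (by simp [hyx, hyl])
  · have e7 : (σ'.setReg 14 (σ.arr 7 x)).arr 7 = σ.arr 7 := by simp [ha]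
    have e23 : (σ'.setReg 14 (σ.arr 7 x)).reg 23 = σ.reg 23 := by simp [h23]
    refine ⟨?_, ?_, ?_, ?_, ?_, ?_⟩
    · rw [e7]
      exact h1.run (p := .const 14 (σ.arr 7 x)) (by simp [Prog.regs]) (by simp [Prog.arrs])
    · simp [h11]; omega
    · rw [e7, e23]; exact h.bounds
    · rw [e23]; exact h.two_le
    · rw [e7]; exact h.disjoint
    · rw [e7]
      intro y hy hyl
      by_cases hyx : y = x
      · subst hyx
        exact h0
      · exact h.allocated y hy (by simp [hyx, hyl])

theorem ev_alloc (w : List ℕ) :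
    Ev (.whileNe 11 0 allocStep) (w.length * (allocStep.cost + 1) + 1) ((init w).setReg 23 2)
      fun σ => ∃ base, Allocates w base ∧ Building w base [] [] [] σ := by
  refine (Ev.forList_loopFree allocStep_loopFree (Allocating w) (fun σ h => ?_)
    (fun x l σ h => ⟨?_, h.step⟩) w _ ?_).mono le_rfl fun σ h => ⟨σ.arr 7, ⟨?_, ?_⟩, h.building⟩
  · rw [h.building.length]
    simpa using h.pos
  · have := h.pos
    rw [h.building.length]
    simp only [List.length_cons] at this
    omega
  · refine ⟨⟨⟨?_, ?_, ?_, ?_, ?_⟩, ?_, rfl, ?_, ?_, ?_⟩, ?_, ?_, ?_, ?_, ?_⟩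
    · simp [init]
    · simp [init, numbered]
    · exact fun u => ⟨[], by simp [targets, numbered], by simp [init, Chain]⟩
    · simp [init, threshold, numbered]
    · simp [init]
    all_goals simp +contextual [init]
  · exact fun x hx => (h.bounds x (h.allocated x hx (by simp))).1
  · exact fun x hx y hy => h.disjoint x y (h.allocated x hx (by simp)) (h.allocated y hy (by simp))

theorem ev_names (h : Building w base [] [] w σ) (h11 : σ.reg 11 = 0) :
    Ev (.whileNe 11 0 nameStep) (w.length * (nameStep.cost + 1) + 1) σ
      (Building w base (w.flatMap nameEdges) ((w.flatMap disjVertices).map (·.id base)) []) := by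
  -- Each pass puts its edges in front, so the list of edges is controlled only up to permutation,
  -- and `O` only as a set.
  let I : List ℕ → State → Prop := fun l σ => ∃ E O, Building w base E O l σ ∧
    σ.reg 11 + l.length = w.length ∧ (l.flatMap nameEdges ++ E).Perm (w.flatMap nameEdges) ∧
    ∀ n, (n ∈ (l.flatMap disjVertices).map (·.id base) ++ O) ↔
      n ∈ (w.flatMap disjVertices).map (·.id base)
  refine (Ev.forList_loopFree nameStep_loopFree I ?_ ?_ w _ ?_).mono le_rfl ?_
  · rintro σ ⟨E, O, hB, hp, -⟩
    rw [hB.length]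
    simpa using hp
  · rintro x l σ ⟨E, O, hB, hp, hE, hO⟩
    simp only [List.length_cons] at hp
    obtain ⟨h1, h2⟩ := hB.nameStep
    refine ⟨by rw [hB.length]; omega, _, _, h1, by rw [h2]; omega, ?_, fun n => ?_⟩
    · refine List.Perm.trans ?_ hE
      rw [List.flatMap_cons, ← List.append_assoc]
      exact List.perm_append_comm.append_right _
    · rw [← hO, List.flatMap_cons]
      simp only [List.map_append, List.mem_append]
      exact or_left_comm.trans or_assoc.symm
  · exact ⟨[], [], h, by simp [h11], by simp, by simp⟩
  · rintro σ ⟨E, O, hB, -, hE, hO⟩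
    have := hB.perm hE
    exact { this with stores := this.stores.perm (List.Perm.refl _) (by simpa using hO) }

theorem perm_flatMap_cons {α β : Type*} (f : α → List β) (a : α) (l : List α) (E : List β) :
    (l.flatMap f ++ (f a ++ E)).Perm ((a :: l).flatMap f ++ E) := by
  rw [List.flatMap_cons, ← List.append_assoc]
  exact List.perm_append_comm.append_right _

theorem ev_facts {fs : List Literal}
    (h : Building w base E O (fs.flatMap Literal.code ++ rest) σ) (h12 : σ.reg 12 = fs.length) :
    Ev (.whileNe 12 10 factStep) (fs.length * (factStep.cost + 1) + 1) σ
      (Building w base (fs.flatMap factEdges ++ E) O rest) := by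
  let I : List Literal → State → Prop := fun l σ => ∃ E',
    Building w base E' O (l.flatMap Literal.code ++ rest) σ ∧ σ.reg 12 = l.length ∧
    (l.flatMap factEdges ++ E').Perm (fs.flatMap factEdges ++ E)
  refine (Ev.forList_loopFree factStep_loopFree I ?_ ?_ fs _ ⟨E, h, h12, .refl _⟩).mono le_rfl ?_
  · rintro σ ⟨E', hB, hp, -⟩
    rw [hB.stores.zero]
    simpa using hp
  · rintro q l σ ⟨E', hB, hp, hE⟩
    rw [List.flatMap_cons, List.append_assoc] at hB
    simp only [List.length_cons] at hp
    obtain ⟨h1, h2⟩ := hB.factStep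
    exact ⟨by rw [hB.stores.zero]; omega, _, h1, by rw [h2]; omega,
      (perm_flatMap_cons _ _ _ _).trans hE⟩
  · rintro σ ⟨E', hB, -, hE⟩
    exact Building.perm hB hE

theorem ev_body {b : List Literal} {l : ℕ}
    (h : Building w base E O (b.flatMap Literal.code ++ rest) σ) (h13 : σ.reg 13 = b.length)
    (h21 : σ.reg 21 = base l) :
    Ev (.whileNe 13 10 bodyStep) (b.length * (bodyStep.cost + 1) + 1) σ fun σ' =>
      Building w base (b.flatMap (bodyEdges l) ++ E) O rest σ' ∧ σ'.reg 12 = σ.reg 12 ∧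
      σ'.arr 8 = σ.arr 8 ∧ σ'.arr 9 = σ.arr 9 := by
  let I : List Literal → State → Prop := fun l' σ' => ∃ E',
    Building w base E' O (l'.flatMap Literal.code ++ rest) σ' ∧ σ'.reg 13 = l'.length ∧
    σ'.reg 21 = base l ∧ σ'.reg 12 = σ.reg 12 ∧ σ'.arr 8 = σ.arr 8 ∧ σ'.arr 9 = σ.arr 9 ∧
    (l'.flatMap (bodyEdges l) ++ E').Perm (b.flatMap (bodyEdges l) ++ E)
  refine (Ev.forList_loopFree bodyStep_loopFree I ?_ ?_ b _
    ⟨E, h, h13, h21, rfl, rfl, rfl, .refl _⟩).mono le_rfl ?_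
  · rintro σ ⟨E', hB, hp, -⟩
    rw [hB.stores.zero]
    simpa using hp
  · rintro q l' σ ⟨E', hB, hp, h21, h12, h8, h9, hE⟩
    rw [List.flatMap_cons, List.append_assoc] at hB
    simp only [List.length_cons] at hp
    obtain ⟨h1, h2, h3, h4, h5, h6⟩ := hB.bodyStep h21
    exact ⟨by rw [hB.stores.zero]; omega, _, h1, by rw [h2]; omega, h4.trans h21, h3.trans h12,
      h5.trans h8, h6.trans h9, (perm_flatMap_cons _ _ _ _).trans hE⟩
  · rintro σ ⟨E', hB, -, -, h12, h8, h9, hE⟩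
    exact ⟨Building.perm hB hE, h12, h8, h9⟩

/-- A bound for the time that the program takes to read a rule. -/
def ruleCost (b : List Literal) : ℕ :=
  ruleHead.cost + (b.length * (bodyStep.cost + 1) + 1) + 1

theorem ev_rule {r : Rule} {b : List Literal}
    (h : Building w base E O (r.code b ++ rest) σ) :
    Ev ruleStep (ruleCost b) σ fun σ' =>
      Building w base (ruleEdges r b ++ E) O rest σ' ∧ σ'.reg 12 = σ.reg 12 - 1 ∧
      HeadStored base r σ' ∧
      ∀ l ≠ r.label, σ'.arr 8 l = σ.arr 8 l ∧ σ'.arr 9 l = σ.arr 9 l := by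
  have h' : Building w base E O (r.label :: r.arrow.code :: (r.head.code ++ b.length ::
      (b.flatMap Literal.code ++ rest))) σ := by
    simpa [Rule.code] using h
  obtain ⟨h1, h12, h13, h21, hs, hl⟩ := h'.ruleHead
  refine Ev.seq (ruleHead_loopFree.ev σ rfl) ?_
  rintro _ rfl
  refine (ev_body h1 h13 h21).mono le_rfl ?_
  rintro σ' ⟨hB, h12', h8, h9⟩
  refine ⟨by simpa [ruleEdges] using hB, h12'.trans h12, ?_, ?_⟩
  · rw [HeadStored, h8, h9]
    exact hs
  · rw [h8, h9]
    exact hl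

theorem ev_rules {rs : List Rule} {body : Rule → List Literal}
    (hl : ∀ r ∈ rs, ∀ s ∈ rs, r.label = s.label → r = s)
    (h : Building w base E O (rs.flatMap (fun r => r.code (body r)) ++ rest) σ)
    (h12 : σ.reg 12 = rs.length) :
    Ev (.whileNe 12 10 ruleStep) ((rs.map fun r => ruleCost (body r) + 1).sum + 1) σ fun σ' =>
      Building w base (rs.flatMap (fun r => ruleEdges r (body r)) ++ E) O rest σ' ∧
      ∀ r ∈ rs, HeadStored base r σ' := by
  let I : List Rule → State → Prop := fun l σ' => ∃ E', (∀ r ∈ l, r ∈ rs) ∧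
    Building w base E' O (l.flatMap (fun r => r.code (body r)) ++ rest) σ' ∧
    σ'.reg 12 = l.length ∧ (∀ r ∈ rs, r ∉ l → HeadStored base r σ') ∧
    (l.flatMap (fun r => ruleEdges r (body r)) ++ E').Perm
      (rs.flatMap (fun r => ruleEdges r (body r)) ++ E)
  refine (Ev.forList I (fun r => ruleCost (body r)) ?_ ?_ rs _
    ⟨E, fun _ => id, h, h12, fun r hr hr' => absurd hr hr', .refl _⟩).mono le_rfl ?_
  · rintro σ ⟨E', -, hB, hp, -⟩
    rw [hB.stores.zero]
    simpa using hp
  · rintro r l σ ⟨E', hsub, hB, hp, hs, hE⟩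
    rw [List.flatMap_cons, List.append_assoc] at hB
    simp only [List.length_cons] at hp
    refine ⟨by rw [hB.stores.zero]; omega, (ev_rule hB).mono le_rfl ?_⟩
    rintro σ' ⟨h1, h2, h3, h4⟩
    have hr : r ∈ rs := hsub r (by simp)
    refine ⟨_, fun s hs => hsub s (List.mem_cons_of_mem _ hs), h1, by rw [h2]; omega,
      fun s hs' hsl => ?_, (perm_flatMap_cons _ _ _ _).trans hE⟩
    by_cases hsr : s = r
    · exact hsr ▸ h3
    -- Labels are unique, so the head of a later rule does not overwrite that of `s`.
    · obtain ⟨h5, h6⟩ := h4 s.label fun he => hsr (hl s hs' r hr he)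
      rw [HeadStored, h5, h6]
      exact hs s hs' (by simp [hsr, hsl])
  · rintro σ ⟨E', -, hB, -, hs, hE⟩
    exact ⟨Building.perm hB hE, fun r hr => hs r hr (by simp)⟩

/-- The superiority statements come last in the input, when the heads of all rules are stored; each
statement can therefore be judged in constant time. -/
theorem ev_sup {ss : List (Rule × Rule)} (hA : Allocates w base)
    (hs : ∀ p ∈ ss, (HeadStored base p.1 σ ∧ p.1.head.atom ∈ w) ∧
      HeadStored base p.2 σ ∧ p.2.head.atom ∈ w)
    (h : Building w base E O (ss.flatMap (fun p => [p.1.label, p.2.label]) ++ rest) σ)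
    (h12 : σ.reg 12 = ss.length) :
    Ev (.whileNe 12 10 supStep) (ss.length * (supStep.cost + 1) + 1) σ
      (Building w base (ss.flatMap supEdges ++ E) O rest) := by
  let I : List (Rule × Rule) → State → Prop := fun l σ' => ∃ E', (∀ p ∈ l, p ∈ ss) ∧
    Building w base E' O (l.flatMap (fun p => [p.1.label, p.2.label]) ++ rest) σ' ∧
    σ'.reg 12 = l.length ∧ σ'.arr 8 = σ.arr 8 ∧ σ'.arr 9 = σ.arr 9 ∧
    (l.flatMap supEdges ++ E').Perm (ss.flatMap supEdges ++ E)
  refine (Ev.forList_loopFree supStep_loopFree I ?_ ?_ ss _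
    ⟨E, fun _ => id, h, h12, rfl, rfl, .refl _⟩).mono le_rfl ?_
  · rintro σ ⟨E', -, hB, hp, -⟩
    rw [hB.stores.zero]
    simpa using hp
  · rintro p l σ' ⟨E', hsub, hB, hp, h8, h9, hE⟩
    rw [List.flatMap_cons, List.append_assoc] at hB
    simp only [List.length_cons] at hp
    obtain ⟨⟨s1, w1⟩, s2, w2⟩ := hs p (hsub p (by simp))
    obtain ⟨h1, h2, h3, h4⟩ := Building.supStep hA hB (by rwa [HeadStored, h8, h9])
      (by rwa [HeadStored, h8, h9]) w1 w2
    exact ⟨by rw [hB.stores.zero]; omega, _, fun s hs => hsub s (List.mem_cons_of_mem _ hs), h1,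
      by rw [h2]; omega, h3.trans h8, h4.trans h9, (perm_flatMap_cons _ _ _ _).trans hE⟩
  · rintro σ ⟨E', -, hB, -, -, -, hE⟩
    exact Building.perm hB hE

end Loops

/-! ### The output -/

/-- Appends the contents of a register to the output. -/
def print (r : ℕ) : Prog := .seq (.store 1 1 r) (.succ 1)

theorem output_print (r : ℕ) (σ : State) :
    ((print r).run σ).output = σ.output ++ [σ.reg r] := by
  simp only [print, Prog.run, State.output, State.setReg_reg, State.setReg_arr,
    State.setArr_reg, State.setArr_arr, Function.update_self, List.range_succ, List.map_append,
    List.map_cons, List.map_nil]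
  congr 1
  refine List.map_congr_left fun i hi => ?_
  rw [Function.update_of_ne (List.mem_range.1 hi).ne]

/-- Outputs the conclusion with tag `p.2` about the literal with sign `p.1` whose atom is in
register `17`, if its counter is zero; the block of the atom starts at the number in register
`14`. -/
def emit (p : Bool × Tag) : Prog := Prog.block
  [.copy 20 14, .addK 20 ((if p.1 then 0 else 8) + p.2.kind.idx), .load 19 5 20,
    .ifEq 19 10 (Prog.block [.const 21 p.2.code, print 21, .const 21 (if p.1 then 0 else 1),
      print 21, print 17]) (.copy 3 3)]

theorem emit_regs (p : Bool × Tag) (r : ℕ) (h : r = 0 ∨ r = 10 ∨ r = 11 ∨ r = 14 ∨ r = 17) :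
    r ∉ (emit p).regs := by
  simp [emit, Prog.block, print, Prog.regs]
  omega

theorem emit_arrs (p : Bool × Tag) (a : ℕ) (h : a ≠ 1) : a ∉ (emit p).arrs := by
  simp [emit, Prog.block, print, Prog.arrs, h]

theorem output_emit {p : Bool × Tag} {base : ℕ → ℕ} {x : ℕ} {σ : State} (hz : σ.reg 10 = 0)
    (h14 : σ.reg 14 = base x) (h17 : σ.reg 17 = x) :
    ((emit p).run σ).output = σ.output ++
      if σ.arr 5 ((Conclusion.mk p.2 ⟨x, p.1⟩).vertex.id base) = 0 then
        (Conclusion.mk p.2 ⟨x, p.1⟩).code else [] := by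
  have hid : (Conclusion.mk p.2 ⟨x, p.1⟩).vertex.id base =
      base x + ((if p.1 then 0 else 8) + p.2.kind.idx) := by
    simp [Conclusion.vertex, Vertex.id, litId_eq]
  rw [hid]
  have hrun : (emit p).run σ =
      if σ.arr 5 (base x + ((if p.1 then 0 else 8) + p.2.kind.idx)) = 0 then
        (print 17).run ((print 21).run ((Prog.const 21 (if p.1 then 0 else 1)).run
          ((print 21).run ((Prog.const 21 p.2.code).run ((σ.setReg 20
            (base x + ((if p.1 then 0 else 8) + p.2.kind.idx))).setReg 19
              (σ.arr 5 (base x + ((if p.1 then 0 else 8) + p.2.kind.idx))))))))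
      else (σ.setReg 20 (base x + ((if p.1 then 0 else 8) + p.2.kind.idx))).setReg 19
              (σ.arr 5 (base x + ((if p.1 then 0 else 8) + p.2.kind.idx))) := by
    simp only [emit, Prog.block, run_seq, run_ifEq, run_skip, Prog.run_addK]
    simp [Prog.run, h14, hz, State.setReg]
  rw [hrun]
  generalize base x + ((if p.1 then 0 else 8) + p.2.kind.idx) = k
  by_cases hc : σ.arr 5 k = 0
  · rw [if_pos hc, if_pos hc]
    rw [output_print, output_print, Prog.run_reg (p := print 21) (r := 17) (by decide)]
    have : ∀ (r v : ℕ) (σ : State), r ≠ 1 → ((Prog.const r v).run σ).output = σ.output := by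
      intro r v σ hr
      simp [State.output, Prog.run, hr.symm]
    rw [this _ _ _ (by omega), output_print, this _ _ _ (by omega)]
    rw [Prog.run_reg (p := .const 21 _) (r := 17) (by simp [Prog.regs]),
      Prog.run_reg (p := print 21) (r := 17) (by decide),
      Prog.run_reg (p := .const 21 _) (r := 17) (by simp [Prog.regs])]
    simp [Prog.run, Conclusion.code, Literal.code, h17, State.output]
  · rw [if_neg hc, if_neg hc]
    simp [State.output]

def emitAll : List (Bool × Tag) → Prog
  | [] => .copy 3 3
  | p :: l => .seq (emit p) (emitAll l)

theorem emitAll_loopFree (l : List (Bool × Tag)) : (emitAll l).LoopFree := by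
  induction l with
  | nil => trivial
  | cons p l ih => exact ⟨by simp [emit, Prog.block, print, Prog.LoopFree], ih⟩

theorem emitAll_regs (l : List (Bool × Tag)) (r : ℕ)
    (h : r = 0 ∨ r = 10 ∨ r = 11 ∨ r = 14 ∨ r = 17) : r ∉ (emitAll l).regs := by
  induction l with
  | nil => simp [emitAll, Prog.regs]; omega
  | cons p l ih => simp [emitAll, Prog.regs, ih, emit_regs p r h]

theorem emitAll_arrs (l : List (Bool × Tag)) (a : ℕ) (h : a ≠ 1) : a ∉ (emitAll l).arrs := by
  induction l with
  | nil => simp [emitAll, Prog.arrs]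
  | cons p l ih => simp [emitAll, Prog.arrs, ih, emit_arrs p a h]

theorem output_emitAll (l : List (Bool × Tag)) {base : ℕ → ℕ} {x : ℕ} {σ : State}
    (hz : σ.reg 10 = 0) (h14 : σ.reg 14 = base x) (h17 : σ.reg 17 = x) :
    ((emitAll l).run σ).output = σ.output ++
      ((l.map fun p => Conclusion.mk p.2 ⟨x, p.1⟩).filter fun c =>
        σ.arr 5 (c.vertex.id base) = 0).flatMap Conclusion.code := by
  induction l generalizing σ with
  | nil => simp [emitAll, run_skip]
  | cons p l ih =>
    rw [emitAll, run_seq, ih, output_emit hz h14 h17,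
      Prog.run_arr (emit_arrs p 5 (by omega)), List.append_assoc, List.map_cons]
    · congr 1
      split_ifs with hc <;> simp [hc]
    · rw [Prog.run_reg (emit_regs p 10 (by omega)), hz]
    · rw [Prog.run_reg (emit_regs p 14 (by omega)), h14]
    · rw [Prog.run_reg (emit_regs p 17 (by omega)), h17]

/-- All signs and tags. -/
def signedTags : List (Bool × Tag) :=
  [(true, .plusDelta), (true, .minusDelta), (true, .plusPartial), (true, .minusPartial),
    (false, .plusDelta), (false, .minusDelta), (false, .plusPartial), (false, .minusPartial)]

/-- Outputs the conclusions about the atom that is the next number of the input, if it occurs in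
the theory and has not been handled before. -/
def outputStep : Prog := Prog.block
  [Prog.block [.load 17 0 11, .succ 11, .load 14 7 17, .copy 20 14, .addK 20 22, .load 19 5 20],
    .ifEq 19 10 (Prog.block [.const 21 1, .store 5 20 21, emitAll signedTags]) (.copy 3 3)]

theorem outputStep_loopFree : outputStep.LoopFree := by
  simp [outputStep, Prog.block, Prog.LoopFree, emitAll_loopFree]

/-- The invariant of the output: `pre` is the part of the input that has been handled. -/
structure Printing (D : Theory) (w : List ℕ) (base : ℕ → ℕ) (pre l : List ℕ)
    (cs : List Conclusion) (σ : State) : Prop where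
  append : pre ++ l = w
  pos : σ.reg 11 = pre.length
  zero : σ.reg 10 = 0
  length : σ.reg 0 = w.length
  input : σ.arr 0 = fun i => w.getD i 0
  blocks : σ.arr 7 = base
  proved : ∀ c : Conclusion, c.lit.atom ∈ w → (σ.arr 5 (c.vertex.id base) = 0 ↔ D.Proves c)
  -- The counter of `occ a` also marks whether `a` has been handled: it is set to `1` on the first
  -- visit, which prevents repeated output.
  occurs : ∀ a ∈ w, σ.arr 5 ((Vertex.occ a).id base) = 0 ↔ a ∈ D.atoms ∧ a ∉ pre
  output : σ.output = cs.flatMap Conclusion.code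
  nodup : cs.Nodup
  mem : ∀ c, c ∈ cs ↔ c.lit.atom ∈ pre ∧ c.lit.atom ∈ D.atoms ∧ D.Proves c

theorem Printing.step {D : Theory} {w : List ℕ} {base : ℕ → ℕ} (hA : Allocates w base) {x : ℕ}
    {pre l : List ℕ} {cs : List Conclusion} {σ : State}
    (h : Printing D w base pre (x :: l) cs σ) :
    ∃ cs', Printing D w base (pre ++ [x]) l cs' (outputStep.run σ) := by
  let p := Prog.block [.load 17 0 11, .succ 11, .load 14 7 17, .copy 20 14, .addK 20 22,
    .load 19 5 20]
  have hxw : x ∈ w := by rw [← h.append]; simp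
  have hx : σ.arr 0 (σ.reg 11) = x := by
    rw [h.input, h.pos, ← h.append]
    simp
  have h17 : (p.run σ).reg 17 = x := by simp [p, Prog.block, Prog.run, hx]
  have h14 : (p.run σ).reg 14 = base x := by simp [p, Prog.block, Prog.run, hx, h.blocks]
  have h20 : (p.run σ).reg 20 = (Vertex.occ x).id base := by
    simp [p, Prog.block, Prog.run, hx, h.blocks, Vertex.id]
  have h19 : (p.run σ).reg 19 = σ.arr 5 ((Vertex.occ x).id base) := by
    simp [p, Prog.block, Prog.run, hx, h.blocks, Vertex.id]
  have h11 : (p.run σ).reg 11 = (pre ++ [x]).length := by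
    simp [p, Prog.block, Prog.run, h.pos]
  have h10 : (p.run σ).reg 10 = 0 := by rw [Prog.run_reg (by decide), h.zero]
  have h0 : (p.run σ).reg 0 = w.length := by rw [Prog.run_reg (by decide), h.length]
  have ha : (p.run σ).arr = σ.arr := rfl
  have ho : (p.run σ).output = σ.output := by
    rw [State.output, Prog.run_reg (by decide), ha]
    rfl
  have hrun : outputStep.run σ = if σ.arr 5 ((Vertex.occ x).id base) = 0 then
      (emitAll signedTags).run (((p.run σ).setReg 21 1).setArr 5 ((Vertex.occ x).id base) 1)
      else p.run σ := by
    have : outputStep.run σ = if (p.run σ).reg 19 = (p.run σ).reg 10 then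
        (emitAll signedTags).run (((p.run σ).setReg 21 1).setArr 5 ((p.run σ).reg 20) 1)
        else p.run σ := by
      simp only [outputStep, p, Prog.block, run_seq, run_ifEq, run_skip]
      simp [Prog.run]
    rw [this, h19, h10, h20]
  rw [hrun]
  have happ : pre ++ [x] ++ l = w := by rw [← h.append]; simp
  generalize p.run σ = σ' at *
  split_ifs with hc
  · obtain ⟨hxa, hxp⟩ := (h.occurs x hxw).1 hc
    -- Marking `x` as handled does not touch the counter of any tagged literal.
    have hlit : ∀ c : Conclusion, c.lit.atom ∈ w →
        c.vertex.id base ≠ (Vertex.occ x).id base := by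
      intro c hcw he
      have := Vertex.id_inj hA (u := c.vertex) (v := .occ x) hcw hxw he
      simp [Conclusion.vertex] at this
    have hd : ∀ c : Conclusion, c.lit.atom ∈ w →
        ((((σ'.setReg 21 1).setArr 5 ((Vertex.occ x).id base) 1).arr 5 (c.vertex.id base) = 0) ↔
          D.Proves c) := by
      intro c hcw
      rw [← h.proved c hcw]
      simp [Function.update_of_ne (hlit c hcw), ha]
    have hout := output_emitAll signedTags (base := base) (x := x)
      (σ := (σ'.setReg 21 1).setArr 5 ((Vertex.occ x).id base) 1) (by simpa using h10)
      (by simpa using h14) (by simpa using h17)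
    have hreg : ∀ r, r = 0 ∨ r = 10 ∨ r = 11 ∨ r = 14 ∨ r = 17 →
        ((emitAll signedTags).run
          ((σ'.setReg 21 1).setArr 5 ((Vertex.occ x).id base) 1)).reg r = σ'.reg r := by
      intro r hr
      rw [Prog.run_reg (emitAll_regs _ r hr)]
      have : r ≠ 21 := by omega
      simp [this]
    have harr : ∀ a, a ≠ 1 → ((emitAll signedTags).run
          ((σ'.setReg 21 1).setArr 5 ((Vertex.occ x).id base) 1)).arr a =
          ((σ'.setReg 21 1).setArr 5 ((Vertex.occ x).id base) 1).arr a :=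
      fun a h1 => Prog.run_arr (emitAll_arrs _ a h1) _
    have hmem : ∀ c : Conclusion, c ∈ (signedTags.map fun p => Conclusion.mk p.2 ⟨x, p.1⟩) ↔
        c.lit.atom = x := by
      rintro ⟨t, a, s⟩
      cases t <;> cases s <;> simp [signedTags, eq_comm]
    refine ⟨cs ++ ((signedTags.map fun p => Conclusion.mk p.2 ⟨x, p.1⟩).filter fun c =>
        ((σ'.setReg 21 1).setArr 5 ((Vertex.occ x).id base) 1).arr 5 (c.vertex.id base) = 0),
      happ, ?_, ?_, ?_, ?_, ?_, ?_, ?_, ?_, ?_, ?_⟩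
    · rw [hreg 11 (by omega), h11]
    · rw [hreg 10 (by omega), h10]
    · rw [hreg 0 (by omega), h0]
    · rw [harr 0 (by omega), ← h.input, ← ha]
      simp
    · rw [harr 7 (by omega), ← h.blocks, ← ha]
      simp
    · intro c hcw
      rw [harr 5 (by omega), hd c hcw]
    · intro a haw
      rw [harr 5 (by omega)]
      by_cases hax : a = x
      · subst hax
        simp
      · have hne : (Vertex.occ a).id base ≠ (Vertex.occ x).id base := by
          intro he
          have := Vertex.id_inj hA (u := .occ a) (v := .occ x) haw hxw he
          simp [hax] at this
        have := h.occurs a haw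
        simp only [State.setArr_arr, State.setReg_arr, Function.update_self,
          Function.update_of_ne hne, ha, this]
        simp [hax]
    · rw [hout, List.flatMap_append, ← h.output, ← ho]
      congr 1
    · refine List.nodup_append.2 ⟨h.nodup, List.Nodup.filter _ ?_, ?_⟩
      · simp [signedTags]
      · rintro c hc1 _ hc2 rfl
        rw [List.mem_filter, hmem] at hc2
        exact hxp (hc2.1 ▸ ((h.mem c).1 hc1).1)
    · intro c
      rw [List.mem_append, h.mem, List.mem_filter, hmem, decide_eq_true_eq, List.mem_append,
        List.mem_singleton]
      constructor
      · rintro (⟨h1, h2, h3⟩ | ⟨h1, h2⟩)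
        · exact ⟨Or.inl h1, h2, h3⟩
        · exact ⟨Or.inr h1, h1 ▸ hxa, (hd c (h1 ▸ hxw)).1 h2⟩
      · rintro ⟨h1 | h1, h2, h3⟩
        · exact Or.inl ⟨h1, h2, h3⟩
        · exact Or.inr ⟨h1, (hd c (h1 ▸ hxw)).2 h3⟩
  -- Nothing is printed: `x` is not an atom of the theory, or it was handled before.
  · have hx' : x ∈ D.atoms → x ∈ pre := fun hxa => by
      by_contra hxp
      exact hc ((h.occurs x hxw).2 ⟨hxa, hxp⟩)
    refine ⟨cs, happ, h11, h10, h0, by rw [ha, h.input], by rw [ha, h.blocks],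
      by rw [ha]; exact h.proved, fun a haw => ?_, ho.trans h.output, h.nodup, fun c => ?_⟩
    · rw [ha, h.occurs a haw]
      constructor
      · rintro ⟨h1, h2⟩
        refine ⟨h1, fun h3 => ?_⟩
        rcases List.mem_append.1 h3 with h3 | h3
        · exact h2 h3
        · rw [List.mem_singleton] at h3
          subst h3
          exact h2 (hx' h1)
      · exact fun ⟨h1, h2⟩ => ⟨h1, fun h3 => h2 (List.mem_append_left _ h3)⟩
    · rw [h.mem]
      constructor
      · exact fun ⟨h1, h2, h3⟩ => ⟨List.mem_append_left _ h1, h2, h3⟩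
      · rintro ⟨h1, h2, h3⟩
        refine ⟨?_, h2, h3⟩
        rcases List.mem_append.1 h1 with h1 | h1
        · exact h1
        · rw [List.mem_singleton] at h1
          exact h1 ▸ hx' (h1 ▸ h2)

/-- The input itself serves as the list of candidate atoms, since every atom of `D` is written in
it. -/
theorem ev_output {D : Theory} {w : List ℕ} {base : ℕ → ℕ} (hA : Allocates w base)
    (hw : D.WrittenIn w) {σ : State} (h : Printing D w base [] w [] σ) :
    Ev (.whileNe 11 0 outputStep) (w.length * (outputStep.cost + 1) + 1) σ fun σ' =>
      D.IsConclusionList σ'.output := by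
  let I : List ℕ → State → Prop := fun l σ => ∃ pre cs, Printing D w base pre l cs σ
  refine (Ev.forList_loopFree outputStep_loopFree I ?_ ?_ w _ ⟨[], [], h⟩).mono le_rfl ?_
  · rintro σ ⟨pre, cs, h⟩
    rw [h.pos, h.length, ← h.append]
    simp
  · rintro x l σ ⟨pre, cs, h⟩
    refine ⟨?_, _, h.step hA⟩
    rw [h.pos, h.length, ← h.append]
    simp
  · rintro σ ⟨pre, cs, h⟩
    refine ⟨cs, h.nodup, fun c => ?_, h.output⟩
    have : pre = w := by simpa using h.append
    rw [h.mem, this]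
    exact ⟨fun h => h.2, fun h => ⟨hw.atoms _ h.1, h⟩⟩

end DefeasibleLogic

namespace DefeasibleLogic

open RAM

/-! ### The whole program -/

/-- The program that computes the conclusions of a defeasible theory. -/
def conclusionsProg : Prog := Prog.block
  [.const 23 2, .whileNe 11 0 allocStep, .const 11 0, .whileNe 11 0 nameStep, .const 11 0,
    readNum 12, .whileNe 12 10 factStep, readNum 12, .whileNe 12 10 ruleStep,
    readNum 12, .whileNe 12 10 supStep, propagate, .const 11 0, .whileNe 11 0 outputStep]

/-- A bound for the running time of `conclusionsProg`. -/
def runningTime (w : List ℕ) (fs : List Literal) (rs : List Rule) (body : Rule → List Literal)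
    (ss : List (Rule × Rule)) : ℕ :=
  w.length * (allocStep.cost + 1) + w.length * (nameStep.cost + 1) +
    fs.length * (factStep.cost + 1) + (rs.map fun r => ruleCost (body r) + 1).sum +
    ss.length * (supStep.cost + 1) +
    (2 * (graphEdges w fs rs body ss).length + 3) * (propagateStep.cost + 1) +
    w.length * (outputStep.cost + 1) + 50

theorem Building.pos_reset {w : List ℕ} {base : ℕ → ℕ} {E : List (Vertex × Vertex)}
    {O rest : List ℕ} {σ : State} (h : Building w base E O rest σ) {w' : List ℕ} (hw : w = w') :
    Building w base E O w' (σ.setReg 11 0) where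
  stores := h.stores.congr rfl rfl fun _ _ _ => rfl
  input := h.input
  blocks := h.blocks
  length := h.length
  output := h.output
  rest := by simpa using hw

theorem ev_const_seq {r n : ℕ} {p : Prog} {T : ℕ} {σ : State} {Q : State → Prop}
    (h : Ev p T (σ.setReg r n) Q) : Ev (.seq (.const r n) p) (T + 2) σ Q := by
  refine (Ev.seq (Prog.LoopFree.ev (p := .const r n) trivial σ rfl) ?_).mono
    (T := 1 + T + 1) (by omega) fun _ h => h
  rintro _ rfl
  exact h

theorem ev_readNum_seq {p : Prog} {T : ℕ} {σ : State} {Q : State → Prop}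
    (h : Ev p T ((readNum 12).run σ) Q) : Ev (.seq (readNum 12) p) (T + 4) σ Q := by
  refine (Ev.seq (Prog.LoopFree.ev (p := readNum 12) ⟨trivial, trivial⟩ σ rfl) ?_).mono
    (T := 3 + T + 1) (by omega) fun _ h => h
  rintro _ rfl
  exact h

theorem writtenIn_of_presentation {D : Theory} {fs : List Literal} {rs : List Rule}
    {body : Rule → List Literal} (hfs : Lists fs D.facts) (hrs : Lists rs D.rules)
    (hb : ∀ r ∈ D.rules, Lists (body r) r.body) (tail : List ℕ) :
    D.WrittenIn (fs.length :: (fs.flatMap Literal.code ++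
      (rs.length :: (rs.flatMap (fun r => r.code (body r)) ++ tail)))) := by
  have hcode : ∀ q : Literal, q.atom ∈ q.code := fun q => by simp [Literal.code]
  have hrule : ∀ r ∈ D.rules, ∀ x ∈ r.code (body r),
      x ∈ fs.length :: (fs.flatMap Literal.code ++
        (rs.length :: (rs.flatMap (fun r => r.code (body r)) ++ tail))) := by
    intro r hr x hx
    rw [← hrs.2, List.mem_toFinset] at hr
    have : x ∈ rs.flatMap fun r => r.code (body r) := List.mem_flatMap.2 ⟨r, hr, hx⟩
    simp only [List.mem_cons, List.mem_append, this, true_or, or_true]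
  constructor
  · intro a ha
    simp only [Theory.atoms, Finset.mem_image, Theory.literals, Finset.mem_union,
      Finset.mem_biUnion, Finset.mem_insert] at ha
    obtain ⟨q, hq | ⟨r, hr, rfl | hq⟩, rfl⟩ := ha
    · rw [← hfs.2, List.mem_toFinset] at hq
      have : q.atom ∈ fs.flatMap Literal.code := List.mem_flatMap.2 ⟨q, hq, hcode q⟩
      simp only [List.mem_cons, List.mem_append, this, true_or, or_true]
    · exact hrule r hr _ (by simp [Rule.code, hcode])
    · refine hrule r hr _ ?_
      rw [← (hb r hr).2, List.mem_toFinset] at hq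
      have : q.atom ∈ (body r).flatMap Literal.code := List.mem_flatMap.2 ⟨q, hq, hcode q⟩
      simp only [Rule.code, List.mem_append, this, or_true]
  · exact fun r hr => hrule r hr _ (by simp [Rule.code])

theorem ev_conclusionsProg {D : Theory} {w : List ℕ} {fs : List Literal} {rs : List Rule}
    {body : Rule → List Literal} {ss : List (Rule × Rule)} (hfs : Lists fs D.facts)
    (hrs : Lists rs D.rules) (hb : ∀ r ∈ D.rules, Lists (body r) r.body) (hss : Lists ss D.sup)
    (hw : w = fs.length :: (fs.flatMap Literal.code ++
      (rs.length :: (rs.flatMap (fun r => r.code (body r)) ++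
        (ss.length :: (ss.flatMap (fun p => [p.1.label, p.2.label]) ++ [])))))) :
    Ev conclusionsProg (runningTime w fs rs body ss) (init w) fun σ =>
      D.IsConclusionList σ.output := by
  have hwr : D.WrittenIn w := hw ▸ writtenIn_of_presentation hfs hrs hb _
  have hr : ∀ r, r ∈ rs ↔ r ∈ D.rules := fun r => by rw [← hrs.2, List.mem_toFinset]
  have hs : ∀ p, p ∈ ss ↔ p ∈ D.sup := fun p => by rw [← hss.2, List.mem_toFinset]
  -- The rest of the program may use what the allocation leaves of the total; the `10` covers the
  -- single steps around the loop.
  refine (ev_const_seq (Ev.seq (ev_alloc w) (R := _) (T₂ := runningTime w fs rs body ss -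
    (w.length * (allocStep.cost + 1) + 10)) ?_)).mono ?_ fun _ h => h
  swap
  · simp only [runningTime]
    omega
  rintro σ₁ ⟨base, hA, h1⟩
  have h1 := h1.pos_reset rfl
  refine (ev_const_seq (Ev.seq (ev_names h1 (by simp)) fun σ₂ h2 => ev_const_seq
    (ev_readNum_seq (Ev.seq (T₁ := fs.length * (factStep.cost + 1) + 1)
      (R := Building w base (fs.flatMap factEdges ++ w.flatMap nameEdges)
        ((w.flatMap disjVertices).map (·.id base))
        (rs.length :: (rs.flatMap (fun r => r.code (body r)) ++
          (ss.length :: (ss.flatMap (fun p => [p.1.label, p.2.label]) ++ []))))) ?_ fun σ₃ h3 =>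
    ev_readNum_seq (Ev.seq (T₁ := (rs.map fun r => ruleCost (body r) + 1).sum + 1)
      (R := fun σ => Building w base (rs.flatMap (fun r => ruleEdges r (body r)) ++
          (fs.flatMap factEdges ++ w.flatMap nameEdges))
        ((w.flatMap disjVertices).map (·.id base))
        (ss.length :: (ss.flatMap (fun p => [p.1.label, p.2.label]) ++ [])) σ ∧
          ∀ r ∈ rs, HeadStored base r σ) ?_ fun σ₄ h4 =>
    ev_readNum_seq (Ev.seq (T₁ := ss.length * (supStep.cost + 1) + 1)
      (R := Building w base (graphEdges w fs rs body ss)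
        ((w.flatMap disjVertices).map (·.id base)) []) ?_ fun σ₅ h5 =>
    Ev.seq ((ev_propagate h5.stores
        (threshold_root hA (mem_graphEdges hwr hfs hrs hb hss))).mono le_rfl
        fun σ h => And.intro h h5)
      fun σ₆ h6 => ev_const_seq (ev_output hA hwr ?_))))))).mono ?_ fun _ h => h
  · obtain ⟨h3, h12⟩ := (h2.pos_reset hw).readNum (r := 12) (by omega)
    exact ev_facts h3 h12
  · obtain ⟨h3, h12⟩ := h3.readNum (r := 12) (by omega)
    exact ev_rules (fun r hr1 s hs1 => D.label_unique r ((hr r).1 hr1) s ((hr s).1 hs1)) h3 h12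
  · obtain ⟨h5, h12⟩ := h4.1.readNum (r := 12) (by omega)
    have hst : ∀ r ∈ D.rules, HeadStored base r ((readNum 12).run σ₄) ∧ r.head.atom ∈ w :=
      fun r hr1 => ⟨h4.2 r ((hr r).2 hr1), hwr.atoms _ (D.head_mem_atoms hr1)⟩
    refine ev_sup hA (fun p hp => ?_) h5 h12
    obtain ⟨h1, h2⟩ := D.sup_on_rules p ((hs p).1 hp)
    exact ⟨hst _ h1, hst _ h2⟩
  · obtain ⟨⟨⟨hreg, harr⟩, hf, hmin⟩, h5⟩ := h6
    obtain ⟨hc, ho⟩ := count_eq_zero_iff hwr hA (mem_graphEdges hwr hfs hrs hb hss) rfl rfl hf hmin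
    refine ⟨rfl, by simp, ?_, ?_, ?_, ?_, hc, by simpa using ho, ?_, .nil, by simp⟩
    · exact (hreg 10 (by omega)).trans h5.stores.zero
    · exact (hreg 0 (by omega)).trans h5.length
    · exact (harr 0 (by omega) (by omega)).trans h5.input
    · exact (harr 7 (by omega) (by omega)).trans h5.blocks
    · have : (σ₆.setReg 11 0).reg 1 = 0 := (hreg 1 (by omega)).trans h5.output
      simp [State.output, this]
  · simp only [runningTime, numbered, List.length_map]
    omega

/-! ### The running time is linear -/

theorem Literal.one_le_size (q : Literal) : 1 ≤ q.size := by
  rw [Literal.size]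
  split_ifs <;> omega

theorem length_flatMap_code (fs : List Literal) : (fs.flatMap Literal.code).length = 2 * fs.length := by
  induction fs with
  | nil => rfl
  | cons q l ih => simp [ih, Literal.code]; omega

theorem length_le_sum_size (l : List Literal) : l.length ≤ (l.map Literal.size).sum := by
  induction l with
  | nil => simp
  | cons q l ih =>
    have := q.one_le_size
    simp only [List.length_cons, List.map_cons, List.sum_cons]
    omega

theorem sum_lists {α : Type} [DecidableEq α] {l : List α} {S : Finset α} (h : Lists l S)
    (f : α → ℕ) : ∑ a ∈ S, f a = (l.map f).sum := by
  rw [← h.2, List.sum_toFinset f h.1]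

/-- A literal has two entries and at least one symbol. A rule has five entries besides those of its
body, and at least three symbols. A superiority statement has two entries and three symbols. The
summand `3` is for the lengths of the three sequences. -/
theorem length_le_size {D : Theory} {w : List ℕ} {fs : List Literal} {rs : List Rule}
    {body : Rule → List Literal} {ss : List (Rule × Rule)} (hfs : Lists fs D.facts)
    (hrs : Lists rs D.rules) (hb : ∀ r ∈ D.rules, Lists (body r) r.body) (hss : Lists ss D.sup)
    (hw : w = fs.length :: (fs.flatMap Literal.code ++
      (rs.length :: (rs.flatMap (fun r => r.code (body r)) ++
        (ss.length :: (ss.flatMap (fun p => [p.1.label, p.2.label]) ++ [])))))) :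
    w.length ≤ 2 * D.size + 3 := by
  have h1 : fs.length ≤ ∑ q ∈ D.facts, q.size := by
    rw [sum_lists hfs]
    exact length_le_sum_size fs
  have h2 : (rs.flatMap fun r => r.code (body r)).length ≤ 2 * ∑ r ∈ D.rules, r.size := by
    rw [sum_lists hrs, List.length_flatMap, ← List.sum_map_mul_left]
    refine List.sum_le_sum fun r hr => ?_
    have hr : r ∈ D.rules := by rwa [← hrs.2, List.mem_toFinset]
    have h3 := length_le_sum_size (body r)
    have h4 := r.head.one_le_size
    rw [Rule.size, sum_lists (hb r hr)]
    simp only [Rule.code, List.length_append, length_flatMap_code, Literal.code, List.length_cons,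
      List.length_nil]
    omega
  have h3 : ss.length = D.sup.card := by
    rw [← hss.2, List.toFinset_card_of_nodup hss.1]
  have h4 : (ss.flatMap fun p => [p.1.label, p.2.label]).length = 2 * ss.length := by
    simp [List.length_flatMap, mul_comm]
  rw [hw, Theory.size]
  simp only [List.length_cons, List.length_append, length_flatMap_code, h4, List.length_nil]
  omega

/-- The factor in the running time. -/
def timeFactor : ℕ :=
  allocStep.cost + nameStep.cost + factStep.cost + (ruleHead.cost + bodyStep.cost + 5) +
    supStep.cost + 100 * (propagateStep.cost + 1) + outputStep.cost + 60

/-- Each input entry gives twice twelve edges for literals and five for a label. A rule gives five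
for each body literal and at most `2 + 2 + 3` for its head. -/
theorem length_graphEdges_le {w : List ℕ} {fs : List Literal} {rs : List Rule}
    {body : Rule → List Literal} {ss : List (Rule × Rule)} :
    (graphEdges w fs rs body ss).length ≤ 29 * w.length + 3 * fs.length +
      (rs.map fun r => 5 * (body r).length + 7).sum + 2 * ss.length := by
  have h1 : (w.flatMap nameEdges).length = 29 * w.length := by
    simp [List.length_flatMap, nameEdges, literalEdges, labelEdges, mul_comm]
  have h2 : (fs.flatMap factEdges).length = 3 * fs.length := by
    simp [List.length_flatMap, factEdges, mul_comm]
  have h3 : (rs.flatMap fun r => ruleEdges r (body r)).length ≤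
      (rs.map fun r => 5 * (body r).length + 7).sum := by
    rw [List.length_flatMap]
    refine List.sum_le_sum fun r _ => ?_
    have h4 : ((body r).flatMap (bodyEdges r.label)).length = 5 * (body r).length := by
      simp [List.length_flatMap, bodyEdges, mul_comm]
    have h5 : (supportEdges r).length ≤ 2 := by
      rw [supportEdges]
      split_ifs <;> simp
    have h6 : (strictEdges r).length ≤ 2 := by
      rw [strictEdges]
      split_ifs <;> simp
    have h7 : (headEdges r).length = 3 := rfl
    simp only [ruleEdges, List.length_append]
    omega
  have h4 : (ss.flatMap supEdges).length ≤ 2 * ss.length := by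
    have : (ss.flatMap supEdges).length ≤ (ss.map fun _ => 2).sum := by
      rw [List.length_flatMap]
      refine List.sum_le_sum fun p _ => ?_
      rw [supEdges]
      split_ifs <;> simp
    simpa [mul_comm] using this
  simp only [graphEdges, List.length_append]
  omega

theorem runningTime_le {w : List ℕ} {fs : List Literal} {rs : List Rule}
    {body : Rule → List Literal} {ss : List (Rule × Rule)}
    (hw : w = fs.length :: (fs.flatMap Literal.code ++
      (rs.length :: (rs.flatMap (fun r => r.code (body r)) ++
        (ss.length :: (ss.flatMap (fun p => [p.1.label, p.2.label]) ++ [])))))) :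
    runningTime w fs rs body ss ≤ timeFactor * w.length := by
  have hlen : w.length = 3 + 2 * fs.length + (rs.map fun r => 5 + 2 * (body r).length).sum +
      2 * ss.length := by
    have h2 : (rs.flatMap fun r => r.code (body r)).length =
        (rs.map fun r => 5 + 2 * (body r).length).sum := by
      rw [List.length_flatMap]
      refine congrArg List.sum (List.map_congr_left fun r _ => ?_)
      simp only [Rule.code, List.length_append, length_flatMap_code, Literal.code, List.length_cons,
        List.length_nil]
    have h4 : (ss.flatMap fun p => [p.1.label, p.2.label]).length = 2 * ss.length := by
      simp [List.length_flatMap, mul_comm]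
    rw [hw]
    simp only [List.length_cons, List.length_append, length_flatMap_code, h4, h2, List.length_nil]
    omega
  have hrules : (rs.map fun r => ruleCost (body r) + 1).sum ≤
      (ruleHead.cost + bodyStep.cost + 4) * (rs.map fun r => 5 + 2 * (body r).length).sum := by
    rw [← List.sum_map_mul_left]
    refine List.sum_le_sum fun r _ => ?_
    rw [ruleCost]
    nlinarith
  have hgraph : (rs.map fun r => 5 * (body r).length + 7).sum ≤
      3 * (rs.map fun r => 5 + 2 * (body r).length).sum := by
    rw [← List.sum_map_mul_left]
    exact List.sum_le_sum fun r _ => by omega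
  -- A generous constant: the edges that stem from facts, rules and superiority statements number at
  -- most `3 * w.length`.
  have hE : (graphEdges w fs rs body ss).length ≤ 40 * w.length := by
    have := @length_graphEdges_le w fs rs body ss
    omega
  rw [runningTime, timeFactor]
  generalize (rs.map fun r => 5 + 2 * (body r).length).sum = m at *
  generalize (graphEdges w fs rs body ss).length = e at *
  have b1 : fs.length * (factStep.cost + 1) ≤ w.length * (factStep.cost + 1) :=
    Nat.mul_le_mul_right _ (by omega)
  have b2 : ss.length * (supStep.cost + 1) ≤ w.length * (supStep.cost + 1) :=
    Nat.mul_le_mul_right _ (by omega)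
  have b3 : (ruleHead.cost + bodyStep.cost + 4) * m ≤
      (ruleHead.cost + bodyStep.cost + 4) * w.length := Nat.mul_le_mul_left _ (by omega)
  have b4 : (2 * e + 3) * (propagateStep.cost + 1) ≤
      (100 * w.length) * (propagateStep.cost + 1) := Nat.mul_le_mul_right _ (by omega)
  nlinarith

end DefeasibleLogic

theorem theorem5 :
    ∃ (p : RAM.Prog) (C : ℕ), ∀ (D : DefeasibleLogic.Theory) (w : List ℕ), D.IsPresentation w →
      ∃ out : List ℕ, D.IsConclusionList out ∧ RAM.Computes p w out (C * (D.size + 1)) := by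
  -- The `3` comes from `w.length ≤ 2 * D.size + 3 ≤ 3 * (D.size + 1)`.
  refine ⟨DefeasibleLogic.conclusionsProg, 3 * DefeasibleLogic.timeFactor, fun D w h => ?_⟩
  obtain ⟨fs, rs, body, ss, hfs, hrs, hb, hss, hw⟩ := h
  have hw : w = fs.length :: (fs.flatMap DefeasibleLogic.Literal.code ++
      (rs.length :: (rs.flatMap (fun r => r.code (body r)) ++
        (ss.length :: (ss.flatMap (fun p => [p.1.label, p.2.label]) ++ []))))) := by
    rw [hw]
    simp
  obtain ⟨t, ht, σ, h1, h2⟩ := DefeasibleLogic.ev_conclusionsProg hfs hrs hb hss hw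
  refine ⟨σ.output, h2, t, ?_, σ, h1 [], rfl⟩
  have hle := DefeasibleLogic.length_le_size hfs hrs hb hss hw
  calc t ≤ DefeasibleLogic.timeFactor * w.length :=
        ht.trans (DefeasibleLogic.runningTime_le hw)
    _ ≤ DefeasibleLogic.timeFactor * (3 * (D.size + 1)) := Nat.mul_le_mul_left _ (by omega)
    _ = _ := by ring
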